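/- Work with symmetric functions over $\mathbb{Q}$, completed with respect to the degree and written in the power sums, i.e. with the ring $\mathbb{Q}[[p_1,p_2,p_3,\dots]]$ ($p_k$ of degree $k$), and with the same ring over $\mathbb{Q}[t]$. Let $\circ$ be plethysm, with $p_k\circ p_j=p_{kj}$ and $p_k\circ t=t^k$, and let $$\Sigma_t f=-\tfrac1t\, f(-tp_1,-t^2p_2,-t^3p_3,\dots),\qquad \Sigma=\Sigma_{t=1}.$$ Let $\mathrm{Assoc}=p_1/(1-p_1)$ and $\mathrm{Comm}=\exp\big(\sum_{k\ge1}p_k/k\big)-1$. Let $\mathrm{Lie}$ be the sum over $n\ge 1$ of the Frobenius characteristics of the $\mathfrak{S}_n$-modules $\mathrm{Lie}(n)$ (the multilinear part of the free Lie algebra over $\mathbb{Q}$ on $n$ generators), and let $\mathrm{PreLie}$ be the sum over $n\ge1$ of the Frobenius characteristics of the permutation representations of $\mathfrak{S}_n$ on the rooted trees with vertex set $\{1,\dots,n\}$. There is exactly one symmetric function $\mathsf{HAL}^{pa}$ with parameter $t$ such that $$\mathsf{HAL}^{pa}=p_1\,[\Sigma_t\mathrm{Assoc}]\circ\mathrm{Comm}\circ[p_1+(-t)\mathsf{HAL}^{pa}].$$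 Put $$\mathsf{HAL}^{p}=p_1\,[\Sigma_t\mathrm{Lie}]\circ\mathrm{Comm}\circ[p_1+(-t)\mathsf{HAL}^{pa}],\qquad \mathsf{HAL}^{a}=[\mathrm{Comm}-p_1]\circ[p_1+(-t)\mathsf{HAL}^{pa}],$$ $$\mathsf{HAL}=\mathsf{HAL}^{p}+\mathsf{HAL}^{a}-\mathsf{HAL}^{pa},$$ and denote specialisation at $t=1$ by an overline. There is also exactly one symmetric function $M$ (with $p_1/\mathrm{PreLie}$ a symmetric function) such that $$M+1=p_1\Big(1+\mathrm{PreLie}+\frac{1}{\mathrm{PreLie}}\Big);$$ this relation is the one that characterises the symmetric function of the anticyclic operad $\mathrm{PreLie}$. Proposition. One has $$\overline{\mathsf{HAL}}=-\Sigma M .$$ Moreover $\overline{\mathsf{HAL}}^{pa}=p_1-\Sigma\mathrm{PreLie}$, $\ \overline{\mathsf{HAL}}^{p}=p_1\,\Sigma\mathrm{PreLie}$ and $\partial_{p_1}\overline{\mathsf{HAL}}=\Sigma\mathrm{PreLie}$. -/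

import Mathlib

/-! ## Symmetric functions in terms of power sums -/

/-- Symmetric functions over a `ℚ`-algebra `R` (completed with respect to the degree), written in
terms of the power sums: formal power series in `p₁, p₂, p₃, …`, the variable `k : ℕ+` being `p_k`,
of degree `k`. -/
abbrev SymFun (R : Type) : Type := MvPowerSeries ℕ+ R

namespace SymFun

/-- The power sum `p_k`. -/
noncomputable def p {R : Type} [CommRing R] (k : ℕ+) : SymFun R := MvPowerSeries.X k

/-- The degree of the monomial `∏ p_k ^ m_k`, where `p_k` has degree `k`. -/
def degree (m : ℕ+ →₀ ℕ) : ℕ := m.sum fun k e => (k : ℕ) * e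

/-- The number of factors `ℓ` of the monomial `∏ p_k ^ m_k`. -/
def length (m : ℕ+ →₀ ℕ) : ℕ := m.sum fun _ e => e

/-- The suspension `Σ_t f = -(1/t) f(-t p₁, -t² p₂, -t³ p₃, …)`. The substitution multiplies a
monomial of degree `d` with `ℓ` factors by `(-1)^ℓ t^d`. The truncated exponent `d - 1` matters only
for the constant term: the formula is the definition above if `f` has no constant term, and also
if `t = 1`. -/
noncomputable def suspension {R : Type} [CommRing R] (t : R) (f : SymFun R) : SymFun R :=
  fun m => -((-1) ^ length m * t ^ (degree m - 1) * MvPowerSeries.coeff m f)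

/-- Symmetric functions with rational coefficients, seen as symmetric functions with a
parameter `t`. -/
noncomputable def withParam (f : SymFun ℚ) : SymFun (Polynomial ℚ) :=
  MvPowerSeries.map (Polynomial.C : ℚ →+* Polynomial ℚ) f

/-- Specialisation of the parameter at `t = 1`. -/
noncomputable def atOne (f : SymFun (Polynomial ℚ)) : SymFun ℚ :=
  MvPowerSeries.map (Polynomial.evalRingHom (1 : ℚ)) f

/-- The plethysm `p_k ∘ g`: it replaces `p_j` by `p_{k j}` and `t` by `t ^ k`. -/
noncomputable def adams (k : ℕ+) (g : SymFun (Polynomial ℚ)) : SymFun (Polynomial ℚ) :=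
  MvPowerSeries.subst (fun j : ℕ+ => (p (k * j) : SymFun (Polynomial ℚ)))
    (MvPowerSeries.map (Polynomial.expand ℚ (k : ℕ) : Polynomial ℚ →+* Polynomial ℚ) g)

/-- The plethysm `f ∘ g` of symmetric functions with a parameter, for `g` without constant term:
substitution of `p_k ∘ g` for `p_k` in `f`. -/
noncomputable def plethysm (f g : SymFun (Polynomial ℚ)) : SymFun (Polynomial ℚ) :=
  MvPowerSeries.subst (fun k : ℕ+ => adams k g) f

/-! ## The Frobenius characteristic -/

/-- The monomial `p_σ`, the product of the `p_k` over the lengths `k` of the cycles of `σ`,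
fixed points included. -/
noncomputable def cycleExponent {n : ℕ} (σ : Equiv.Perm (Fin n)) : ℕ+ →₀ ℕ :=
  (Multiset.toFinsupp σ.partition.parts).comapDomain (fun k : ℕ+ => (k : ℕ))
    PNat.coe_injective.injOn

/-- The homogeneous symmetric function `(1 / n!) ∑_σ χ(σ) p_σ` of a character `χ` of the symmetric
group on `n` letters. -/
noncomputable def frobenius (n : ℕ) (χ : Equiv.Perm (Fin n) → ℚ) : SymFun ℚ :=
  MvPowerSeries.C (1 / (n.factorial : ℚ)) *
    ∑ σ : Equiv.Perm (Fin n), MvPowerSeries.monomial (cycleExponent σ) (χ σ)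

/-- The sum over `n` of the symmetric functions of a sequence of characters `χ n`; the part of
degree `n` comes from `χ n`. -/
noncomputable def frobeniusSeries (χ : (n : ℕ) → Equiv.Perm (Fin n) → ℚ) : SymFun ℚ :=
  fun m => MvPowerSeries.coeff m (frobenius (degree m) (χ (degree m)))

/-! ## The symmetric functions of some operads -/

/-- `Assoc = p₁ / (1 - p₁)`. -/
noncomputable def Assoc : SymFun ℚ := p 1 * (1 - p 1)⁻¹

/-- The series `∑_{k ≥ 1} p_k / k`. -/
noncomputable def powerSumSeries : SymFun ℚ :=
  fun m => ∑ k ∈ m.support, MvPowerSeries.coeff m (MvPowerSeries.C (1 / ((k : ℕ) : ℚ)) * p k)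

/-- `Comm = exp (∑_{k ≥ 1} p_k / k) - 1`. -/
noncomputable def Comm : SymFun ℚ := PowerSeries.subst powerSumSeries (PowerSeries.exp ℚ) - 1

end SymFun

/-! ### The operad `Lie` -/

/-- `IsLieMonomial S x`: the element `x` of the free Lie algebra is an iterated bracket in which
each generator with index in `S` occurs exactly once and no other generator occurs. -/
inductive IsLieMonomial {n : ℕ} : Finset (Fin n) → FreeLieAlgebra ℚ (Fin n) → Prop
  | of (i : Fin n) : IsLieMonomial {i} (FreeLieAlgebra.of ℚ i)
  | lie {S T : Finset (Fin n)} {x y : FreeLieAlgebra ℚ (Fin n)} (hST : Disjoint S T)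
      (hx : IsLieMonomial S x) (hy : IsLieMonomial T y) : IsLieMonomial (S ∪ T) ⁅x, y⁆

/-- The space `Lie(n)`: the multilinear part of the free Lie algebra on `n` generators. -/
noncomputable def lieOperad (n : ℕ) : Submodule ℚ (FreeLieAlgebra ℚ (Fin n)) :=
  Submodule.span ℚ {x | IsLieMonomial Finset.univ x}

/-- The action of a permutation on the free Lie algebra, by permutation of the generators. -/
noncomputable def lieAction {n : ℕ} (σ : Equiv.Perm (Fin n)) :
    FreeLieAlgebra ℚ (Fin n) →ₗ⁅ℚ⁆ FreeLieAlgebra ℚ (Fin n) :=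
  FreeLieAlgebra.lift ℚ fun i => FreeLieAlgebra.of ℚ (σ i)

theorem IsLieMonomial.lieAction {n : ℕ} (σ : Equiv.Perm (Fin n)) {S : Finset (Fin n)}
    {x : FreeLieAlgebra ℚ (Fin n)} (h : IsLieMonomial S x) :
    IsLieMonomial (S.map σ.toEmbedding) (lieAction σ x) := by
  induction h with
  | of i =>
    rw [_root_.lieAction, FreeLieAlgebra.lift_of_apply, Finset.map_singleton]
    exact IsLieMonomial.of (σ i)
  | lie hST _ _ hx hy =>
    rw [LieHom.map_lie, Finset.map_union]
    exact IsLieMonomial.lie ((Finset.disjoint_map _).2 hST) hx hy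

theorem lieAction_mem {n : ℕ} (σ : Equiv.Perm (Fin n)) :
    ∀ x ∈ lieOperad n, (lieAction σ : FreeLieAlgebra ℚ (Fin n) →ₗ[ℚ] FreeLieAlgebra ℚ (Fin n)) x
      ∈ lieOperad n := by
  intro x hx
  refine (Submodule.span_le (p := (lieOperad n).comap
    (lieAction σ : FreeLieAlgebra ℚ (Fin n) →ₗ[ℚ] FreeLieAlgebra ℚ (Fin n)))).2 ?_ hx
  intro y hy
  have h := IsLieMonomial.lieAction σ hy
  rw [Finset.map_univ_equiv] at h
  exact Submodule.subset_span h

/-- The character of the representation `Lie(n)` of the symmetric group. -/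
noncomputable def lieCharacter (n : ℕ) (σ : Equiv.Perm (Fin n)) : ℚ :=
  LinearMap.trace ℚ (lieOperad n)
    ((lieAction σ : FreeLieAlgebra ℚ (Fin n) →ₗ[ℚ] FreeLieAlgebra ℚ (Fin n)).restrict
      (lieAction_mem σ))

/-! ### The operad `PreLie` -/

/-- The number of rooted trees (a tree with a distinguished vertex) on the vertex set `Fin n` that
are fixed by the relabelling `σ`: the character of the permutation representation on rooted
trees. -/
noncomputable def rootedTreeCharacter (n : ℕ) (σ : Equiv.Perm (Fin n)) : ℚ :=
  (Nat.card {T : SimpleGraph (Fin n) × Fin n //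
    T.1.IsTree ∧ T.1.map σ.toEmbedding = T.1 ∧ σ T.2 = T.2} : ℚ)

namespace SymFun

/-- The symmetric function of the operad `Lie`. -/
noncomputable def Lie : SymFun ℚ := frobeniusSeries lieCharacter

/-- The symmetric function of the operad `PreLie`, that is, of rooted trees. -/
noncomputable def PreLie : SymFun ℚ := frobeniusSeries rootedTreeCharacter

/-- The characterisation `M + 1 = p₁ (1 + PreLie + 1 / PreLie)` of the symmetric function `M` of
the anticyclic operad `PreLie`; the quotient `Q = p₁ / PreLie` is taken in the domain of
symmetric functions. -/
def IsAnticyclicPreLie (M : SymFun ℚ) : Prop :=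
  ∃ Q : SymFun ℚ, Q * PreLie = p 1 ∧ M + 1 = p 1 + p 1 * PreLie + Q

/-! ## The symmetric functions `HAL` -/

/-- The argument `p₁ + (-t) H` of the plethysms below. -/
noncomputable def halArg (H : SymFun (Polynomial ℚ)) : SymFun (Polynomial ℚ) :=
  p 1 + (-(Polynomial.X : Polynomial ℚ)) • H

/-- The equation `H = p₁ [Σ_t Assoc] ∘ Comm ∘ [p₁ + (-t) H]` that defines `H = HAL^{pa}`. -/
def IsHALpa (H : SymFun (Polynomial ℚ)) : Prop :=
  H = p 1 * plethysm (suspension Polynomial.X (withParam Assoc))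
    (plethysm (withParam Comm) (halArg H))

/-- `HAL^p = p₁ [Σ_t Lie] ∘ Comm ∘ [p₁ + (-t) H]`, where `H` is `HAL^{pa}`. -/
noncomputable def HALp (H : SymFun (Polynomial ℚ)) : SymFun (Polynomial ℚ) :=
  p 1 * plethysm (suspension Polynomial.X (withParam Lie))
    (plethysm (withParam Comm) (halArg H))

/-- `HAL^a = [Comm - p₁] ∘ [p₁ + (-t) H]`, where `H` is `HAL^{pa}`. -/
noncomputable def HALa (H : SymFun (Polynomial ℚ)) : SymFun (Polynomial ℚ) :=
  plethysm (withParam Comm - p 1) (halArg H)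

/-- `HAL = HAL^p + HAL^a - HAL^{pa}`, where `H` is `HAL^{pa}`. -/
noncomputable def HAL (H : SymFun (Polynomial ℚ)) : SymFun (Polynomial ℚ) :=
  HALp H + HALa H - H

end SymFun

/-! ### Degree filtration, substitution and fixed points -/

namespace SymFun

open MvPowerSeries

section Degree

/-! Write `P` for `PreLie`, `Exp g = 1 + Comm ∘ g = exp (∑ (p_k ∘ g) / k)` (in the code `expOf
(logSum g)`), and `s` for `p_k ↦ -p_k` (`signHom`), so that `Σ = -s` at `t = 1`. Two facts about
operads are needed: the functional equation `P = p₁ · Exp P` (`PreLie_eq`) and the Koszul duality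
`ΣLie ∘ Comm = p₁` (`plethQ_suspension_plethQ_Comm`). The rest is algebra (`main_of_series`). The
equation for `HAL^{pa}` is a contraction for the degree filtration, because of its factor `p₁`, so
it has exactly one solution, before and after specialisation. As `s` commutes with `p_k ∘ -`, the
series `Exp (ΣP)` is inverse to `s (Exp P)`, and with `ΣAssoc = p₁ / (1 + p₁)` this shows that `p₁ -
ΣP` solves the specialised equation. The argument of all plethysms is then `ΣP`; hence `HAL^p = p₁
ΣP` and `HAL^a = Exp (ΣP) - 1 - ΣP`. Since `p₁ / P = exp (-logSum P)`, applying `s` to `M` gives the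
sum of these terms. The derivative comes from differentiating `P = p₁ · Exp P`.

The coefficients of a symmetric function on the basis `p_m / z_m` (`ghost`) are the values of its
character. For trees, removal of the root gives `P = p₁ F` with `F` the series of forests. That `F =
Exp P` is checked after the Euler derivation (`eq_expOf_of_euler`): an invariant forest with a
marked point splits into the `σ`-orbit of the tree of that point and an arbitrary invariant forest
(`degree_mul_forestCount`), and `logSum P` counts the forests whose roots are permuted transitively
(`ghost_logSum_PreLie`).

For `Lie`, the Adams operations of the Hopf algebra of words act on multilinear words by matrices
that count stable sortings with `k` colours. These matrices are polynomial in `k` and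
multiplicative, so their linear coefficient is an idempotent `E` (`eulerian_mul_self`). Lie elements
are primitive, hence fixed by `E`; the trace of `E` and, by Dynkin–Specht–Wever, the dimension of
`Lie(n)` are both `(n - 1)!`, so the image of `E` is `Lie(n)` (`lieCharacter_eq_sum_eulerian`). Its
character is the linear coefficient in `k` of the number of pairs of an automorphism of `σ` and an
invariant primitive colouring (`sum_sortCount_eq`), a product over the cycles of `σ` that involves
the number of primitive words. This coefficient vanishes unless all cycles have one length `d`, and
it yields `Lie = -∑ μ(d)/d · log (1 - p_d)`; Möbius inversion then gives the Koszul duality. -/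

theorem degree_zero : degree 0 = 0 := Finsupp.sum_zero_index

theorem degree_add (m n : ℕ+ →₀ ℕ) : degree (m + n) = degree m + degree n :=
  Finsupp.sum_add_index' (fun _ => mul_zero _) (fun _ _ _ => mul_add _ _ _)

theorem degree_single (k : ℕ+) (e : ℕ) : degree (Finsupp.single k e) = k * e :=
  Finsupp.sum_single_index (mul_zero _)

theorem length_zero : length 0 = 0 := Finsupp.sum_zero_index

theorem length_add (m n : ℕ+ →₀ ℕ) : length (m + n) = length m + length n :=
  Finsupp.sum_add_index' (fun _ => rfl) (fun _ _ _ => rfl)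

theorem length_single (k : ℕ+) (e : ℕ) : length (Finsupp.single k e) = e :=
  Finsupp.sum_single_index rfl

theorem mul_le_degree (m : ℕ+ →₀ ℕ) (k : ℕ+) : (k : ℕ) * m k ≤ degree m := by
  by_cases hk : k ∈ m.support
  · exact Finset.single_le_sum (f := fun k : ℕ+ => (k : ℕ) * m k) (fun _ _ => Nat.zero_le _) hk
  · simp [Finsupp.notMem_support_iff.1 hk]

theorem le_degree {m : ℕ+ →₀ ℕ} {k : ℕ+} (hk : m k ≠ 0) : (k : ℕ) ≤ degree m :=
  (Nat.le_mul_of_pos_right _ (Nat.pos_of_ne_zero hk)).trans (mul_le_degree m k)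

theorem degree_eq_zero {m : ℕ+ →₀ ℕ} (h : degree m = 0) : m = 0 := by
  ext k
  by_contra hk
  have := le_degree hk
  have := k.pos
  omega

end Degree

variable {R S : Type} [CommRing R] [CommRing S]

/-- The series without terms of degree less than `N`. -/
noncomputable def degGE (R : Type) [CommRing R] (N : ℕ) : Ideal (SymFun R) where
  carrier := {f | ∀ m, degree m < N → coeff m f = 0}
  add_mem' hf hg m hm := by rw [map_add, hf m hm, hg m hm, add_zero]
  zero_mem' m _ := map_zero _
  smul_mem' c f hf m hm := by
    classical
    rw [smul_eq_mul, coeff_mul]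
    refine Finset.sum_eq_zero fun x hx => ?_
    rw [Finset.HasAntidiagonal.mem_antidiagonal] at hx
    rw [hf x.2 (lt_of_le_of_lt _ hm), mul_zero]
    rw [← hx, degree_add]
    exact Nat.le_add_left _ _

theorem mem_degGE {N : ℕ} {f : SymFun R} :
    f ∈ degGE R N ↔ ∀ m, degree m < N → coeff m f = 0 := Iff.rfl

theorem mem_degGE_zero (f : SymFun R) : f ∈ degGE R 0 := fun _ h => absurd h (Nat.not_lt_zero _)

theorem mem_degGE_one {f : SymFun R} : f ∈ degGE R 1 ↔ constantCoeff f = 0 := by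
  refine ⟨fun h => h 0 (by rw [degree_zero]; exact one_pos), fun h m hm => ?_⟩
  rw [degree_eq_zero (Nat.lt_one_iff.1 hm)]
  exact h

theorem degGE_anti {M N : ℕ} (h : M ≤ N) : degGE R N ≤ degGE R M :=
  fun _ hf m hm => hf m (hm.trans_le h)

theorem mul_mem_degGE {M N : ℕ} {f g : SymFun R} (hf : f ∈ degGE R M) (hg : g ∈ degGE R N) :
    f * g ∈ degGE R (M + N) := by
  classical
  intro m hm
  rw [coeff_mul]
  refine Finset.sum_eq_zero fun x hx => ?_
  rw [Finset.HasAntidiagonal.mem_antidiagonal] at hx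
  rw [← hx, degree_add] at hm
  rcases lt_or_ge (degree x.1) M with h | h
  · rw [hf _ h, zero_mul]
  · rw [hg _ (by omega), mul_zero]

theorem pow_mem_degGE {M : ℕ} {f : SymFun R} (hf : f ∈ degGE R M) (n : ℕ) :
    f ^ n ∈ degGE R (M * n) := by
  induction n with
  | zero => exact mem_degGE_zero _
  | succ n ih => rw [pow_succ, Nat.mul_succ]; exact mul_mem_degGE ih hf

theorem p_mem_degGE (k : ℕ+) : (p k : SymFun R) ∈ degGE R k := by
  classical
  intro m hm
  rw [p, coeff_X, if_neg]
  rintro rfl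
  rw [degree_single] at hm
  omega

theorem prod_mem_degGE {a : ℕ+ → SymFun R} (ha : ∀ k : ℕ+, a k ∈ degGE R k) (d : ℕ+ →₀ ℕ) :
    (d.prod fun s e => a s ^ e) ∈ degGE R (degree d) := by
  induction d using Finsupp.induction with
  | zero => rw [degree_zero]; exact mem_degGE_zero _
  | single_add k e d hk he ih =>
    rw [Finsupp.prod_add_index' (fun _ => pow_zero _) (fun _ _ _ => pow_add _ _ _), degree_add,
      degree_single]
    refine mul_mem_degGE ?_ ih
    have h1 : (Finsupp.single k e).prod (fun s e => a s ^ e) = a k ^ e :=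
      Finsupp.prod_single_index (pow_zero _)
    exact (congrArg (· ∈ degGE R (k * e)) h1).mpr (pow_mem_degGE (ha k) e)

theorem eq_of_forall_sub_mem_degGE {f g : SymFun R} (h : ∀ N, f - g ∈ degGE R N) : f = g := by
  ext m
  have := h (degree m + 1) m (Nat.lt_succ_self _)
  rwa [map_sub, sub_eq_zero] at this

/-- The `k`-th series starts in degree `k`, so a given monomial occurs in only finitely many of
them; this is the criterion of convergence behind every plethysm. -/
theorem hasSubst_of_degGE {a : ℕ+ → SymFun R} (ha : ∀ k : ℕ+, a k ∈ degGE R k) : HasSubst a where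
  const_coeff k := by
    rw [mem_degGE_one.1 (degGE_anti k.pos (ha k))]
    exact IsNilpotent.zero
  coeff_zero m := by
    refine Set.Finite.subset (Set.finite_Iic (⟨degree m + 1, Nat.succ_pos _⟩ : ℕ+)) fun k hk => ?_
    by_contra h
    refine hk (ha k m ?_)
    have : degree m + 1 < PNat.val k := not_le.1 h
    exact (Nat.lt_succ_self _).trans this

theorem subst_mem_degGE [Algebra S R] {a : ℕ+ → SymFun R} (ha : ∀ k : ℕ+, a k ∈ degGE R k) {N : ℕ}
    {f : SymFun S} (hf : f ∈ degGE S N) : subst a f ∈ degGE R N := by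
  intro m hm
  rw [coeff_subst (hasSubst_of_degGE ha)]
  refine finsum_eq_zero_of_forall_eq_zero fun d => ?_
  rcases lt_or_ge (degree d) N with h | h
  · rw [hf d h, zero_smul]
  · rw [prod_mem_degGE ha d m (hm.trans_le h), smul_zero]

/-- In the quotient by the ideal the two families become equal. -/
theorem prod_sub_prod_mem {a b : ℕ+ → SymFun R} {I : Ideal (SymFun R)}
    (h : ∀ k, a k - b k ∈ I) (d : ℕ+ →₀ ℕ) :
    (d.prod fun s e => a s ^ e) - (d.prod fun s e => b s ^ e) ∈ I := by
  simp_rw [← Ideal.Quotient.eq] at h ⊢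
  simp only [Finsupp.prod, map_prod, map_pow, h]

theorem subst_sub_subst_mem [Algebra S R] {a b : ℕ+ → SymFun R} (ha : ∀ k : ℕ+, a k ∈ degGE R k)
    (hb : ∀ k : ℕ+, b k ∈ degGE R k) {N : ℕ} (h : ∀ k, a k - b k ∈ degGE R N) (f : SymFun S) :
    subst a f - subst b f ∈ degGE R N := by
  intro m hm
  rw [map_sub, sub_eq_zero, coeff_subst (hasSubst_of_degGE ha), coeff_subst (hasSubst_of_degGE hb)]
  refine finsum_congr fun d => ?_
  have := prod_sub_prod_mem h d m hm
  rw [map_sub, sub_eq_zero] at this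
  rw [this]

/-- Multiplication by `k` on the indices of the power sums. -/
def mulEmb (k : ℕ+) : ℕ+ ↪ ℕ+ := ⟨fun j => k * j, mul_right_injective k⟩

theorem mulEmb_apply (k j : ℕ+) : mulEmb k j = k * j := rfl

/-- The homomorphism replacing `p_j` by `p_{k j}`. -/
noncomputable def frob (k : ℕ+) : SymFun R →ₐ[R] SymFun R := rename (mulEmb k)

theorem frob_eq_subst (k : ℕ+) (g : SymFun R) : frob k g = subst (fun j => p (k * j)) g :=
  rename_eq_subst _ _

theorem coeff_frob (k : ℕ+) (g : SymFun R) (m : ℕ+ →₀ ℕ) :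
    coeff (m.embDomain (mulEmb k)) (frob k g) = coeff m g := coeff_embDomain_rename _ _ _

theorem coeff_frob_eq_zero (k : ℕ+) (g : SymFun R) {m : ℕ+ →₀ ℕ}
    (h : ∀ n : ℕ+ →₀ ℕ, n.embDomain (mulEmb k) ≠ m) : coeff m (frob k g) = 0 := by
  refine coeff_rename_eq_zero _ _ ?_
  rintro ⟨n, hn⟩
  exact h n (by rw [Finsupp.embDomain_eq_mapDomain, hn])

theorem degree_embDomain (k : ℕ+) (m : ℕ+ →₀ ℕ) :
    degree (m.embDomain (mulEmb k)) = k * degree m := by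
  rw [degree, Finsupp.sum_embDomain, degree, Finsupp.mul_sum]
  simp only [mulEmb_apply, PNat.mul_coe, mul_assoc]

theorem length_embDomain (k : ℕ+) (m : ℕ+ →₀ ℕ) :
    length (m.embDomain (mulEmb k)) = length m := by
  rw [length, Finsupp.sum_embDomain, length]

theorem frob_mem_degGE (k : ℕ+) {N : ℕ} {g : SymFun R} (hg : g ∈ degGE R N) :
    frob k g ∈ degGE R (k * N) := by
  intro m hm
  by_cases h : ∃ n : ℕ+ →₀ ℕ, n.embDomain (mulEmb k) = m
  · obtain ⟨n, rfl⟩ := h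
    rw [coeff_frob]
    rw [degree_embDomain] at hm
    exact hg n (lt_of_mul_lt_mul_left hm (Nat.zero_le _))
  · exact coeff_frob_eq_zero k g (not_exists.1 h)

theorem map_mem_degGE (θ : R →+* S) {N : ℕ} {g : SymFun R} (hg : g ∈ degGE R N) :
    map θ g ∈ degGE S N := fun m hm => by rw [coeff_map, hg m hm, map_zero]

theorem map_frob (θ : R →+* S) (k : ℕ+) (g : SymFun R) : map θ (frob k g) = frob k (map θ g) :=
  (rename_map _ _ _).symm

theorem map_p (θ : R →+* S) (k : ℕ+) : map θ (p k) = p k := map_X _ _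

theorem frob_frob (k l : ℕ+) (g : SymFun R) : frob k (frob l g) = frob (k * l) g := by
  have : (mulEmb k : ℕ+ → ℕ+) ∘ mulEmb l = mulEmb (k * l) := by
    ext j; simp [mulEmb_apply, mul_assoc]
  unfold frob
  rw [rename_rename]
  congr! 2

theorem frob_one (g : SymFun R) : frob 1 g = g := by
  have : (mulEmb 1 : ℕ+ → ℕ+) = id := by ext j; simp [mulEmb_apply]
  have h2 := rename_id_apply g
  unfold frob
  convert h2 using 3

/-- Plethysm over a ring of coefficients on which `θ k` is the plethysm by `p_k`. -/
noncomputable def pleth (θ : ℕ+ → R →+* R) (f g : SymFun R) : SymFun R :=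
  subst (fun k => frob k (map (θ k) g)) f

theorem pleth_arg_mem (θ : ℕ+ → R →+* R) {g : SymFun R} (hg : constantCoeff g = 0) (k : ℕ+) :
    frob k (map (θ k) g) ∈ degGE R k := by
  simpa using frob_mem_degGE k (map_mem_degGE (θ k) (mem_degGE_one.2 hg))

/-- Plethysm loses no accuracy in its inner argument: `p_k ∘ -` multiplies degrees by `k`, so an
error only moves up. A single factor `p₁` then suffices for a contraction. -/
theorem pleth_sub_mem (θ : ℕ+ → R →+* R) {f g g' : SymFun R} (hg : constantCoeff g = 0)
    (hg' : constantCoeff g' = 0) {N : ℕ} (h : g - g' ∈ degGE R N) :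
    pleth θ f g - pleth θ f g' ∈ degGE R N := by
  refine subst_sub_subst_mem (pleth_arg_mem θ hg) (pleth_arg_mem θ hg') (fun k => ?_) f
  rw [← map_sub, ← map_sub]
  exact degGE_anti (Nat.le_mul_of_pos_left _ k.pos) (frob_mem_degGE k (map_mem_degGE _ h))

theorem constantCoeff_pleth (θ : ℕ+ → R →+* R) {f g : SymFun R} (hf : constantCoeff f = 0)
    (hg : constantCoeff g = 0) : constantCoeff (pleth θ f g) = 0 :=
  mem_degGE_one.1 (subst_mem_degGE (pleth_arg_mem θ hg) (mem_degGE_one.2 hf))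

/-- The plethysm by `p_k` on polynomials in the parameter. -/
noncomputable def expandHom (k : ℕ+) : Polynomial ℚ →+* Polynomial ℚ := Polynomial.expand ℚ (k : ℕ)

theorem plethysm_eq_pleth (f g : SymFun (Polynomial ℚ)) : plethysm f g = pleth expandHom f g := by
  unfold plethysm pleth adams
  congr 1
  funext k
  rw [frob_eq_subst]
  rfl

/-- Meant for the specialisation at `t = 1`, where `t ↦ t ^ k` on the source becomes the identity on
the target. -/
theorem map_pleth {θ : ℕ+ → R →+* R} {θ' : ℕ+ → S →+* S} (φ : R →+* S)
    (h : ∀ k, φ.comp (θ k) = (θ' k).comp φ) (f : SymFun R) {g : SymFun R}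
    (hg : constantCoeff g = 0) : map φ (pleth θ f g) = pleth θ' (map φ f) (map φ g) := by
  unfold pleth
  rw [map_subst (hasSubst_of_degGE (pleth_arg_mem θ hg))]
  congr 1
  funext k
  rw [map_frob, ← RingHom.comp_apply, ← RingHom.comp_apply, ← map_comp, ← map_comp, h]

/-- A map on series without constant term that increases the degree of agreement has exactly one
fixed point. -/
theorem exists_fixedPoint (T : SymFun R → SymFun R)
    (hT : ∀ f, constantCoeff (T f) = 0)
    (h : ∀ f g, constantCoeff f = 0 → constantCoeff g = 0 → ∀ N, f - g ∈ degGE R N →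
      T f - T g ∈ degGE R (N + 1)) : ∃ f, f = T f := by
  have h0 : ∀ n, constantCoeff (T^[n] 0) = 0 := by
    rintro (_ | n)
    · exact map_zero _
    · rw [Function.iterate_succ_apply']; exact hT _
  have h1 : ∀ n, T^[n + 1] 0 - T^[n] 0 ∈ degGE R n := by
    intro n
    induction n with
    | zero => exact mem_degGE_zero _
    | succ n ih =>
      rw [Function.iterate_succ_apply' T (n + 1), Function.iterate_succ_apply' T n]
      rw [Function.iterate_succ_apply'] at ih
      exact h _ _ (by rw [← Function.iterate_succ_apply' T]; exact h0 _) (h0 _) _ ih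
  have h2 : ∀ n k, T^[n + k] 0 - T^[n] 0 ∈ degGE R n := by
    intro n k
    induction k with
    | zero => simp
    | succ k ih =>
      have := (degGE R n).add_mem (degGE_anti (Nat.le_add_right n k) (h1 (n + k))) ih
      rwa [sub_add_sub_cancel] at this
  -- The limit of the iteration: coefficients of degree `d` no longer change after `d + 1` steps.
  let F : SymFun R := fun m => coeff m (T^[degree m + 1] 0)
  have h3 : ∀ n, F - T^[n] 0 ∈ degGE R n := by
    intro n m hm
    obtain ⟨k, rfl⟩ := Nat.exists_eq_add_of_lt hm
    have h4 := h2 (degree m + 1) k m (Nat.lt_succ_self _)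
    rw [map_sub, sub_eq_zero] at h4 ⊢
    rw [add_right_comm, h4]
    rfl
  have hF : constantCoeff F = 0 := by
    have := h3 1
    rw [mem_degGE_one, map_sub, h0, sub_zero] at this
    exact this
  refine ⟨F, eq_of_forall_sub_mem_degGE fun N => degGE_anti (Nat.le_succ N) ?_⟩
  have := (degGE R (N + 1)).sub_mem (h3 (N + 1)) (h F _ hF (h0 N) N (h3 N))
  rwa [Function.iterate_succ_apply', sub_sub_sub_cancel_right] at this

theorem fixedPoint_unique (T : SymFun R → SymFun R)
    (h : ∀ f g, constantCoeff f = 0 → constantCoeff g = 0 → ∀ N, f - g ∈ degGE R N →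
      T f - T g ∈ degGE R (N + 1)) {f g : SymFun R} (hf : f = T f) (hg : g = T g)
    (hf0 : constantCoeff f = 0) (hg0 : constantCoeff g = 0) : f = g := by
  refine eq_of_forall_sub_mem_degGE fun N => ?_
  induction N with
  | zero => exact mem_degGE_zero _
  | succ N ih => rw [hf, hg]; exact h f g hf0 hg0 N ih

end SymFun

/-! ### Exponentials, logarithms and the series `∑ (p_k ∘ g) / k` -/

namespace SymFun

open MvPowerSeries

section Exponential

theorem psHasSubst {a : SymFun ℚ} (ha : constantCoeff a = 0) : PowerSeries.HasSubst a :=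
  PowerSeries.HasSubst.of_constantCoeff_zero ha

/-- The chain rule, with no continuity of `D` assumed: `f` is cut at order `N + 1`. The polynomial
part is algebra, and on the remainder both sides are divisible by `a ^ N`, so they vanish below
degree `N`. -/
theorem derivation_psSubst (D : Derivation ℚ (SymFun ℚ) (SymFun ℚ)) {a : SymFun ℚ}
    (ha : constantCoeff a = 0) (f : PowerSeries ℚ) :
    D (f.subst a) = (PowerSeries.derivative ℚ f).subst a * D a := by
  have hs := psHasSubst ha
  refine eq_of_forall_sub_mem_degGE fun N => ?_
  set g : PowerSeries ℚ := PowerSeries.mk fun i => PowerSeries.coeff (i + (N + 1)) f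
  have hf : f = PowerSeries.X ^ (N + 1) * g + ((PowerSeries.trunc (N + 1) f : Polynomial ℚ) : PowerSeries ℚ) :=
    PowerSeries.eq_X_pow_mul_shift_add_trunc (N + 1) f
  set P := PowerSeries.trunc (N + 1) f
  have hp : D ((P : PowerSeries ℚ).subst a) =
      (PowerSeries.derivative ℚ (P : PowerSeries ℚ)).subst a * D a := by
    rw [PowerSeries.derivative_coe, PowerSeries.subst_coe hs, PowerSeries.subst_coe hs,
      D.map_aeval, smul_eq_mul]
  have hm : a ^ N ∈ degGE ℚ N := by simpa using pow_mem_degGE (mem_degGE_one.2 ha) N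
  have hd : PowerSeries.derivative ℚ (PowerSeries.X ^ (N + 1) * g) = PowerSeries.X ^ N *
      (PowerSeries.X * PowerSeries.derivative ℚ g + ((N + 1 : ℕ) : PowerSeries ℚ) * g) := by
    rw [Derivation.leibniz, PowerSeries.derivative_pow, PowerSeries.derivative_X,
      Nat.add_sub_cancel, smul_eq_mul, smul_eq_mul]
    ring
  have hd' : D ((PowerSeries.X ^ (N + 1) * g).subst a) =
      a ^ N * (a * D (g.subst a) + g.subst a * ((N + 1 : ℕ) * D a)) := by
    rw [PowerSeries.subst_mul hs, PowerSeries.subst_pow hs, PowerSeries.subst_X hs, D.leibniz,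
      D.leibniz_pow, Nat.add_sub_cancel, nsmul_eq_mul, smul_eq_mul, smul_eq_mul, smul_eq_mul]
    ring
  rw [hf, map_add, PowerSeries.subst_add hs, map_add, hp, PowerSeries.subst_add hs,
    add_mul, add_sub_add_right_eq_sub, hd, hd', PowerSeries.subst_mul hs, PowerSeries.subst_pow hs,
    PowerSeries.subst_X hs, mul_assoc, ← mul_sub]
  exact Ideal.mul_mem_right _ _ hm

/-- The exponential of a series without constant term. -/
noncomputable def expOf (a : SymFun ℚ) : SymFun ℚ := (PowerSeries.exp ℚ).subst a

theorem derivation_expOf (D : Derivation ℚ (SymFun ℚ) (SymFun ℚ)) {a : SymFun ℚ}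
    (ha : constantCoeff a = 0) : D (expOf a) = expOf a * D a := by
  rw [expOf, derivation_psSubst D ha, PowerSeries.derivative_exp]

theorem constantCoeff_expOf {a : SymFun ℚ} (ha : constantCoeff a = 0) :
    constantCoeff (expOf a) = 1 := by
  have h : constantCoeff (((PowerSeries.exp ℚ) - 1).subst a) = 0 :=
    PowerSeries.constantCoeff_subst_eq_zero ha _ (by simp)
  have h1 : (1 : PowerSeries ℚ).subst a = 1 := by
    rw [← PowerSeries.coe_substAlgHom (psHasSubst ha), map_one]
  rw [PowerSeries.subst_sub (psHasSubst ha), map_sub, h1, map_one, sub_eq_zero] at h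
  exact h

/-- All partial derivatives of the product cancel, and in characteristic zero these and the constant
term determine a series. -/
theorem expOf_neg_mul {a : SymFun ℚ} (ha : constantCoeff a = 0) : expOf (-a) * expOf a = 1 := by
  have ha' : constantCoeff (-a) = 0 := by rw [map_neg, ha, neg_zero]
  refine pderiv.ext (fun k => ?_) ?_
  · rw [Derivation.leibniz, derivation_expOf _ ha, derivation_expOf _ ha', map_neg, pderiv_one,
      smul_eq_mul, smul_eq_mul]
    ring
  · rw [map_mul, constantCoeff_expOf ha, constantCoeff_expOf ha', map_one, mul_one]

theorem subst_psSubst {a : SymFun ℚ} (ha : constantCoeff a = 0) {b : ℕ+ → SymFun ℚ}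
    (hb : HasSubst b) (f : PowerSeries ℚ) : subst b (f.subst a) = f.subst (subst b a) :=
  subst_comp_subst_apply (psHasSubst ha).const hb f

/-- In one variable `log (1 + (exp X - 1))` has derivative `1` and constant term `0`, so it is `X`;
then `a` is substituted. -/
theorem log_subst_expOf {a : SymFun ℚ} (ha : constantCoeff a = 0) :
    (PowerSeries.log ℚ).subst (expOf a - 1) = a := by
  have hs := PowerSeries.HasSubst.exp_sub_one (A := ℚ)
  have h1 : (PowerSeries.log ℚ).subst (PowerSeries.exp ℚ - 1) = PowerSeries.X := by
    refine PowerSeries.derivative.ext ?_ ?_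
    · rw [PowerSeries.derivative_subst hs, PowerSeries.deriv_log, PowerSeries.derivative_X, map_sub,
        PowerSeries.derivative_one, sub_zero, PowerSeries.derivative_exp]
      have h2 : (PowerSeries.mk fun n => algebraMap ℚ ℚ ((-1 : ℚ) ^ n)) * (1 + PowerSeries.X) = 1 := by
        ext n
        rw [mul_add, mul_one, map_add]
        rcases n with _ | n
        · simp
        · rw [PowerSeries.coeff_succ_mul_X]
          simp [pow_succ, PowerSeries.coeff_one]
      have h3 := congrArg (PowerSeries.subst (PowerSeries.exp ℚ - 1)) h2
      rw [PowerSeries.subst_mul hs, PowerSeries.subst_add hs, PowerSeries.subst_X hs,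
        ← PowerSeries.coe_substAlgHom hs, map_one, add_sub_cancel, PowerSeries.coe_substAlgHom] at h3
      exact h3
    · rw [PowerSeries.constantCoeff_X]
      exact PowerSeries.constantCoeff_subst_eq_zero
        ((map_sub _ _ _).trans (sub_eq_zero.2 PowerSeries.constantCoeff_exp)) _
        PowerSeries.constantCoeff_log
  have h4 : expOf a - 1 = (PowerSeries.exp ℚ - 1).subst a := by
    rw [PowerSeries.subst_sub (psHasSubst ha), ← PowerSeries.coe_substAlgHom (psHasSubst ha),
      map_one, PowerSeries.coe_substAlgHom]; rfl
  rw [h4, ← PowerSeries.subst_comp_subst_apply hs (psHasSubst ha), h1,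
    PowerSeries.subst_X (psHasSubst ha)]

end Exponential

section LogSum

/-- Plethysm of symmetric functions with rational coefficients. -/
noncomputable def plethQ (f g : SymFun ℚ) : SymFun ℚ := subst (fun k => frob k g) f

theorem frob_mem {g : SymFun ℚ} (hg : constantCoeff g = 0) (k : ℕ+) : frob k g ∈ degGE ℚ k := by
  simpa using frob_mem_degGE k (mem_degGE_one.2 hg)

theorem plethQ_hasSubst {g : SymFun ℚ} (hg : constantCoeff g = 0) :
    HasSubst (fun k => frob k g) := hasSubst_of_degGE (frob_mem hg)

theorem pleth_id_eq_plethQ (f g : SymFun ℚ) : pleth (fun _ => RingHom.id ℚ) f g = plethQ f g := by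
  unfold pleth plethQ
  simp_rw [MvPowerSeries.map_id, RingHom.id_apply]

/-- The series `∑ (p_k ∘ g) / k`. -/
noncomputable def logSum (g : SymFun ℚ) : SymFun ℚ := plethQ powerSumSeries g

/-- A monomial of degree at most `N` contains no `p_k` with `k > N`, so below degree `N + 1` the
infinite sum is a finite one. -/
theorem powerSumSeries_sub_mem (N : ℕ+) :
    powerSumSeries - ∑ k ∈ Finset.Icc 1 N, (1 / ((k : ℕ) : ℚ)) • p k ∈ degGE ℚ (N + 1) := by
  classical
  intro m hm
  rw [map_sub, sub_eq_zero, map_sum]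
  change ∑ k ∈ m.support, _ = _
  simp_rw [coeff_C_mul, map_smul, smul_eq_mul]
  refine Finset.sum_subset (fun k hk => ?_) fun k _ hk => ?_
  · rw [Finset.mem_Icc]
    refine ⟨one_le, ?_⟩
    have := le_degree (Finsupp.mem_support_iff.1 hk)
    rw [← PNat.coe_le_coe]
    omega
  · rw [p, coeff_X, if_neg, mul_zero]
    rintro rfl
    simp at hk

theorem logSum_sub_mem {g : SymFun ℚ} (hg : constantCoeff g = 0) (N : ℕ+) :
    logSum g - ∑ k ∈ Finset.Icc 1 N, (1 / ((k : ℕ) : ℚ)) • frob k g ∈ degGE ℚ (N + 1) := by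
  have h := subst_mem_degGE (frob_mem hg) (powerSumSeries_sub_mem N)
  have hs := plethQ_hasSubst hg
  rw [← coe_substAlgHom hs, map_sub, map_sum] at h
  simp_rw [map_smul] at h
  simpa only [p, substAlgHom_X, coe_substAlgHom] using! h

theorem constantCoeff_powerSumSeries : constantCoeff powerSumSeries = 0 := by
  rfl

theorem constantCoeff_plethQ {f g : SymFun ℚ} (hf : constantCoeff f = 0)
    (hg : constantCoeff g = 0) : constantCoeff (plethQ f g) = 0 :=
  mem_degGE_one.1 (subst_mem_degGE (frob_mem hg) (mem_degGE_one.2 hf))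

theorem constantCoeff_logSum {g : SymFun ℚ} (hg : constantCoeff g = 0) :
    constantCoeff (logSum g) = 0 := constantCoeff_plethQ constantCoeff_powerSumSeries hg

theorem plethQ_Comm {g : SymFun ℚ} (hg : constantCoeff g = 0) :
    plethQ Comm g = expOf (logSum g) - 1 := by
  have hs := plethQ_hasSubst hg
  rw [plethQ, Comm, subst_sub hs, subst_psSubst constantCoeff_powerSumSeries hs,
    ← coe_substAlgHom hs, map_one, coe_substAlgHom]
  rfl

theorem constantCoeff_frob (k : ℕ+) {g : SymFun ℚ} (hg : constantCoeff g = 0) :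
    constantCoeff (frob k g) = 0 := mem_degGE_one.1 (degGE_anti k.pos (frob_mem hg k))

theorem frob_expOf (k : ℕ+) {a : SymFun ℚ} (ha : constantCoeff a = 0) :
    frob k (expOf a) = expOf (frob k a) := by
  have hs : HasSubst fun j => (p (k * j) : SymFun ℚ) := by
    refine hasSubst_of_degGE fun j => degGE_anti ?_ (p_mem_degGE (k * j))
    rw [PNat.mul_coe]
    exact Nat.le_mul_of_pos_left _ k.pos
  rw [frob_eq_subst, frob_eq_subst, expOf, expOf, subst_psSubst ha hs]

/-- The homomorphism replacing `p_k` by `-p_k`. -/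
noncomputable def signHom : SymFun ℚ →+* SymFun ℚ := rescale fun _ => (-1 : ℚ)

theorem coeff_signHom (f : SymFun ℚ) (m : ℕ+ →₀ ℕ) :
    coeff m (signHom f) = (-1) ^ length m * coeff m f := by
  rw [signHom, coeff_rescale, Finsupp.prod, Finset.prod_pow_eq_pow_sum]
  rfl

theorem suspension_one (f : SymFun ℚ) : suspension 1 f = -signHom f := by
  ext m
  rw [map_neg, coeff_signHom]
  change -((-1) ^ length m * 1 ^ (degree m - 1) * _) = _
  rw [one_pow, mul_one]

theorem signHom_p (k : ℕ+) : signHom (p k) = -p k := by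
  classical
  ext m
  rw [coeff_signHom, map_neg, p, coeff_X]
  split_ifs with h
  · rw [h, length_single]; simp
  · simp

theorem signHom_mem {N : ℕ} {f : SymFun ℚ} (hf : f ∈ degGE ℚ N) : signHom f ∈ degGE ℚ N :=
  fun m hm => by rw [coeff_signHom, hf m hm, mul_zero]

theorem signHom_frob (k : ℕ+) (f : SymFun ℚ) : signHom (frob k f) = frob k (signHom f) := by
  ext m
  rw [coeff_signHom]
  by_cases h : ∃ n : ℕ+ →₀ ℕ, n.embDomain (mulEmb k) = m
  · obtain ⟨n, rfl⟩ := h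
    rw [coeff_frob, coeff_frob, coeff_signHom, length_embDomain]
  · rw [coeff_frob_eq_zero k _ (not_exists.1 h), coeff_frob_eq_zero k _ (not_exists.1 h), mul_zero]

theorem signHom_smul (c : ℚ) (f : SymFun ℚ) : signHom (c • f) = c • signHom f := by
  ext m
  rw [coeff_signHom, map_smul, map_smul, coeff_signHom, smul_eq_mul, smul_eq_mul]
  ring

theorem constantCoeff_signHom (f : SymFun ℚ) : constantCoeff (signHom f) = constantCoeff f := by
  have := coeff_signHom f 0
  rw [length_zero, pow_zero, one_mul] at this
  exact this

theorem signHom_expOf {a : SymFun ℚ} (ha : constantCoeff a = 0) :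
    signHom (expOf a) = expOf (signHom a) := by
  have hs : HasSubst ((fun _ => (-1 : ℚ)) • X : ℕ+ → SymFun ℚ) := HasSubst.smul_X _
  rw [signHom, rescale_eq_subst, rescale_eq_subst, expOf, expOf, subst_psSubst ha hs]

/-- Converse of `logSum_sub_mem`: the congruences for all `N` determine the series, which reduces
identities for `logSum` to finite sums. -/
theorem eq_logSum {g L : SymFun ℚ} (hg : constantCoeff g = 0)
    (h : ∀ N : ℕ+, L - ∑ k ∈ Finset.Icc 1 N, (1 / ((k : ℕ) : ℚ)) • frob k g ∈ degGE ℚ (N + 1)) :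
    L = logSum g := by
  refine eq_of_forall_sub_mem_degGE fun N => ?_
  have := (degGE ℚ (N.succPNat + 1)).sub_mem (h N.succPNat) (logSum_sub_mem hg N.succPNat)
  rw [sub_sub_sub_cancel_right] at this
  refine degGE_anti ?_ this
  rw [Nat.succPNat_coe]
  omega

theorem signHom_logSum {g : SymFun ℚ} (hg : constantCoeff g = 0) :
    signHom (logSum g) = logSum (signHom g) := by
  refine eq_logSum (by rw [constantCoeff_signHom, hg]) fun N => ?_
  have := signHom_mem (logSum_sub_mem hg N)
  rw [map_sub, map_sum] at this
  simpa only [signHom_smul, signHom_frob] using this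

theorem logSum_neg {g : SymFun ℚ} (hg : constantCoeff g = 0) : logSum (-g) = -logSum g := by
  refine (eq_logSum (by rw [map_neg, hg, neg_zero]) fun N => ?_).symm
  have := (degGE ℚ (N + 1)).neg_mem (logSum_sub_mem hg N)
  simp only [map_neg, smul_neg, Finset.sum_neg_distrib]
  rwa [neg_sub, ← neg_sub_neg] at this

end LogSum

end SymFun

/-! ### Möbius inversion and the Koszul duality of `Lie` and `Comm` -/

namespace SymFun

open MvPowerSeries

section Mobius

/-- All divisors of `n` lie in the box because `n ≤ N`, so the double sum collapses to the sum of
`μ` over the divisors of `n`. -/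
theorem sum_moebius_Icc (N n : ℕ+) (hn : n ≤ N) :
    ∑ d ∈ Finset.Icc 1 N, ∑ k ∈ Finset.Icc 1 N,
      (if d * k = n then (ArithmeticFunction.moebius (d : ℕ) : ℚ) else 0) = if n = 1 then 1 else 0 := by
  have h1 : ∀ d ∈ Finset.Icc 1 N, ∑ k ∈ Finset.Icc 1 N,
      (if d * k = n then (ArithmeticFunction.moebius (d : ℕ) : ℚ) else 0) =
      if (d : ℕ) ∣ n then (ArithmeticFunction.moebius (d : ℕ) : ℚ) else 0 := by
    intro d _
    split_ifs with h
    · obtain ⟨k, rfl⟩ := PNat.dvd_iff.2 h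
      rw [Finset.sum_eq_single k]
      · rw [if_pos rfl]
      · intro b _ hb
        rw [if_neg fun h => hb (mul_left_cancel h)]
      · intro hk
        exact absurd (Finset.mem_Icc.2 ⟨one_le, (le_mul_of_one_le_left' one_le).trans hn⟩) hk
    · refine Finset.sum_eq_zero fun k _ => if_neg ?_
      rintro rfl
      exact h ⟨k, PNat.mul_coe _ _⟩
  rw [Finset.sum_congr rfl h1, ← Finset.sum_filter]
  have h2 : ∑ d ∈ (Finset.Icc 1 N).filter (fun d : ℕ+ => (d : ℕ) ∣ n),
      (ArithmeticFunction.moebius (d : ℕ) : ℚ) =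
      ∑ d ∈ (n : ℕ).divisors, (ArithmeticFunction.moebius d : ℚ) := by
    refine Finset.sum_bij (fun d _ => (d : ℕ)) ?_ ?_ ?_ fun _ _ => rfl
    · intro d hd
      exact Nat.mem_divisors.2 ⟨(Finset.mem_filter.1 hd).2, n.ne_zero⟩
    · intro a _ b _ h
      exact PNat.coe_injective h
    · intro d hd
      have hd' := Nat.mem_divisors.1 hd
      have hd0 : 0 < d := Nat.pos_of_dvd_of_pos hd'.1 n.pos
      let e : ℕ+ := ⟨d, hd0⟩
      have he : e ≤ n := Nat.le_of_dvd n.pos hd'.1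
      exact ⟨e, Finset.mem_filter.2 ⟨Finset.mem_Icc.2 ⟨one_le, he.trans hn⟩, hd'.1⟩, rfl⟩
  rw [h2]
  have h3 := congrArg (fun f : ArithmeticFunction ℤ => f n) ArithmeticFunction.moebius_mul_coe_zeta
  simp only [ArithmeticFunction.coe_mul_zeta_apply, ArithmeticFunction.one_apply] at h3
  rw [← Int.cast_sum, h3]
  simp [PNat.coe_eq_one_iff]

end Mobius

section Koszul

theorem coeff_frob_of_lt {g : SymFun ℚ} (hg : constantCoeff g = 0) {k : ℕ+} {m : ℕ+ →₀ ℕ}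
    (h : degree m < k) : coeff m (frob k g) = 0 := frob_mem hg k m h

/-- Möbius inversion of `logSum`. -/
theorem sum_moebius_frob_logSum_mem {g : SymFun ℚ} (hg : constantCoeff g = 0) (N : ℕ+) :
    ∑ d ∈ Finset.Icc 1 N, ((ArithmeticFunction.moebius (d : ℕ) : ℚ) / (d : ℕ)) • frob d (logSum g)
      - g ∈ degGE ℚ (N + 1) := by
  have h1 : ∀ d : ℕ+, frob d (logSum g) -
      ∑ k ∈ Finset.Icc 1 N, (1 / ((k : ℕ) : ℚ)) • frob (d * k) g ∈ degGE ℚ (N + 1) := by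
    intro d
    have := degGE_anti (Nat.le_mul_of_pos_left _ d.pos)
      (frob_mem_degGE d (logSum_sub_mem hg N))
    rw [map_sub, map_sum] at this
    simpa only [map_smul, frob_frob] using this
  intro m hm
  rw [map_sub, sub_eq_zero, map_sum]
  have h2 : ∀ d ∈ Finset.Icc 1 N, coeff m
      (((ArithmeticFunction.moebius (d : ℕ) : ℚ) / (d : ℕ)) • frob d (logSum g)) =
      ∑ k ∈ Finset.Icc 1 N, ∑ n ∈ Finset.Icc 1 N,
        (if d * k = n then (ArithmeticFunction.moebius (d : ℕ) : ℚ) else 0) *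
          (coeff m (frob n g) / (n : ℕ)) := by
    intro d _
    have h3 := h1 d m hm
    rw [map_sub, sub_eq_zero, map_sum] at h3
    rw [map_smul, h3, Finset.smul_sum]
    refine Finset.sum_congr rfl fun k _ => ?_
    rw [map_smul, smul_eq_mul, smul_eq_mul]
    -- A pair with `d * k > N` is missing from the sum over `n`; this is harmless because `p_{d k} ∘
    -- g` starts in degree `d k`, above the degree of `m`.
    by_cases hk : d * k ≤ N
    · rw [Finset.sum_eq_single (d * k)]
      · rw [if_pos rfl, PNat.mul_coe, Nat.cast_mul]
        have := d.ne_zero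
        have := k.ne_zero
        field_simp
      · intro n _ hn
        rw [if_neg hn.symm, zero_mul]
      · intro h
        exact absurd (Finset.mem_Icc.2 ⟨one_le, hk⟩) h
    · rw [coeff_frob_of_lt hg, mul_zero, mul_zero, Finset.sum_eq_zero]
      · intro n hn
        rw [if_neg, zero_mul]
        rintro rfl
        exact hk (Finset.mem_Icc.1 hn).2
      · have : (N : ℕ) < (d * k : ℕ+) := not_le.1 hk
        omega
  rw [Finset.sum_congr rfl h2]
  calc _ = ∑ n ∈ Finset.Icc 1 N, (∑ d ∈ Finset.Icc 1 N, ∑ k ∈ Finset.Icc 1 N,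
        (if d * k = n then (ArithmeticFunction.moebius (d : ℕ) : ℚ) else 0)) *
          (coeff m (frob n g) / (n : ℕ)) := by
        simp_rw [Finset.sum_mul]
        rw [Finset.sum_congr rfl fun d _ => Finset.sum_comm, Finset.sum_comm]
    _ = ∑ n ∈ Finset.Icc 1 N, (if n = 1 then 1 else 0) * (coeff m (frob n g) / (n : ℕ)) :=
        Finset.sum_congr rfl fun n hn => by rw [sum_moebius_Icc N n (Finset.mem_Icc.1 hn).2]
    _ = coeff m g := by
        rw [Finset.sum_eq_single 1]
        · simp [frob_one]
        · intro n _ hn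
          rw [if_neg hn, zero_mul]
        · intro h
          exact absurd (Finset.mem_Icc.2 ⟨le_rfl, one_le⟩) h

/-- The Koszul duality between `Lie` and `Comm`, for a series with the coefficients of `Lie`. -/
theorem plethQ_suspension_plethQ_Comm {L : SymFun ℚ}
    (h1 : ∀ (d : ℕ+) (n : ℕ), n ≠ 0 → coeff (Finsupp.single d n) L =
      (ArithmeticFunction.moebius (d : ℕ) : ℚ) / ((d : ℕ) * n))
    (h0 : ∀ m, (∀ (d : ℕ+) (n : ℕ), n ≠ 0 → m ≠ Finsupp.single d n) → coeff m L = 0)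
    {g : SymFun ℚ} (hg : constantCoeff g = 0) :
    plethQ (suspension 1 L) (plethQ Comm g) = g := by
  classical
  have hL := constantCoeff_logSum hg
  have hc : plethQ Comm g = expOf (logSum g) - 1 := plethQ_Comm hg
  have hC0 : constantCoeff (plethQ Comm g) = 0 := by
    rw [hc, map_sub, constantCoeff_expOf hL, map_one, sub_self]
  have hs := plethQ_hasSubst hC0
  -- Since `1 + Comm ∘ g` is an exponential, substitution turns `log (1 + p_d)` into `p_d` of its
  -- exponent.
  have hlog : ∀ d : ℕ+, subst (fun k => frob k (plethQ Comm g)) ((PowerSeries.log ℚ).subst (p d : SymFun ℚ))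
      = frob d (logSum g) := by
    intro d
    rw [subst_psSubst (by rw [p, constantCoeff_X]) hs, p, subst_X hs, hc, map_sub, map_one,
      frob_expOf d hL, log_subst_expOf (constantCoeff_frob d hL)]
  refine eq_of_forall_sub_mem_degGE fun N => ?_
  -- By `h1` and `h0`, `L` is `-∑ μ(d)/d · log (1 - p_d)`; the suspension changes it into `∑ μ(d)/d
  -- · log (1 + p_d)`.
  have h2 : suspension 1 L - ∑ d ∈ Finset.Icc 1 N.succPNat,
      ((ArithmeticFunction.moebius (d : ℕ) : ℚ) / (d : ℕ)) • (PowerSeries.log ℚ).subst (p d : SymFun ℚ)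
      ∈ degGE ℚ (N.succPNat + 1) := by
    intro m hm
    rw [map_sub, sub_eq_zero, suspension_one, map_neg, coeff_signHom, map_sum]
    simp_rw [map_smul, p, PowerSeries.coeff_subst_single, PowerSeries.coeff_log, smul_eq_mul]
    by_cases h : ∃ (d : ℕ+) (n : ℕ), n ≠ 0 ∧ m = Finsupp.single d n
    · obtain ⟨d, n, hn, rfl⟩ := h
      rw [h1 d n hn, length_single, Finset.sum_eq_single d]
      · rw [Finsupp.single_eq_same, if_pos rfl, if_neg hn, pow_succ, Algebra.algebraMap_self,
          RingHom.id_apply]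
        have := d.ne_zero
        field_simp
      · intro b _ hb
        rw [if_neg, mul_zero]
        intro h
        have := congrArg (fun f => f d) h
        simp [Ne.symm hb, hn] at this
      · intro hd
        rw [degree_single] at hm
        refine absurd (Finset.mem_Icc.2 ⟨one_le, ?_⟩) hd
        rw [← PNat.coe_le_coe]
        exact (Nat.le_mul_of_pos_right _ (Nat.pos_of_ne_zero hn)).trans (Nat.lt_succ_iff.1 hm)
    · push Not at h
      rw [h0 m h, mul_zero, neg_zero]
      refine (Finset.sum_eq_zero fun d _ => ?_).symm
      rcases eq_or_ne (m d) 0 with hd | hd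
      · simp [hd]
      · rw [if_neg (h d _ hd), mul_zero]
  have h3 := subst_mem_degGE (frob_mem hC0) h2
  rw [← coe_substAlgHom hs, map_sub, map_sum] at h3
  simp_rw [map_smul, coe_substAlgHom, hlog] at h3
  have h4 := (degGE ℚ _).add_mem h3 (sum_moebius_frob_logSum_mem hg N.succPNat)
  rw [sub_add_sub_cancel] at h4
  refine degGE_anti ?_ h4
  rw [Nat.succPNat_coe]
  omega

end Koszul

/-! ### The equation of `HAL^{pa}` and its specialisation -/

section FixedPoint

variable {R : Type} [CommRing R]

theorem constantCoeff_p_mul (f : SymFun R) : constantCoeff (p 1 * f) = 0 := by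
  rw [map_mul, p, constantCoeff_X, zero_mul]

theorem constantCoeff_p_add_smul {f : SymFun R} (hf : constantCoeff f = 0) (c : R) :
    constantCoeff (p 1 + c • f) = 0 := by
  rw [map_add, p, constantCoeff_X, zero_add, ← coeff_zero_eq_constantCoeff_apply, map_smul,
    coeff_zero_eq_constantCoeff_apply, hf, smul_zero]

theorem smul_mem_degGE {N : ℕ} {f : SymFun R} (c : R) (hf : f ∈ degGE R N) :
    c • f ∈ degGE R N := fun m hm => by rw [map_smul, hf m hm, smul_zero]

/-- The plethysms preserve the order of agreement and the outer factor `p₁` raises it by one. Both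
the equation with parameter (`c = -t`) and its specialisation (`c = -1`) have this form. -/
theorem pleth_contraction (θ : ℕ+ → R →+* R) (A : SymFun R) {B : SymFun R}
    (hB : constantCoeff B = 0) (c : R) {f g : SymFun R} (hf : constantCoeff f = 0)
    (hg : constantCoeff g = 0) (N : ℕ) (h : f - g ∈ degGE R N) :
    p 1 * pleth θ A (pleth θ B (p 1 + c • f)) - p 1 * pleth θ A (pleth θ B (p 1 + c • g))
      ∈ degGE R (N + 1) := by
  have hf' := constantCoeff_p_add_smul hf c
  have hg' := constantCoeff_p_add_smul hg c
  rw [← mul_sub, add_comm N 1]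
  refine mul_mem_degGE (p_mem_degGE 1) (pleth_sub_mem θ (constantCoeff_pleth θ hB hf')
    (constantCoeff_pleth θ hB hg') (pleth_sub_mem θ hf' hg' ?_))
  rw [add_sub_add_left_eq_sub, ← smul_sub]
  exact smul_mem_degGE c h

theorem constantCoeff_Comm : constantCoeff Comm = 0 := by
  rw [Comm, map_sub, map_one, sub_eq_zero]
  exact constantCoeff_expOf constantCoeff_powerSumSeries

theorem constantCoeff_withParam {f : SymFun ℚ} (hf : constantCoeff f = 0) :
    constantCoeff (withParam f) = 0 := by
  rw [withParam, constantCoeff_map, hf, map_zero]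

theorem isHALpa_iff (H : SymFun (Polynomial ℚ)) : IsHALpa H ↔
    H = p 1 * pleth expandHom (suspension Polynomial.X (withParam Assoc))
      (pleth expandHom (withParam Comm) (p 1 + (-(Polynomial.X : Polynomial ℚ)) • H)) := by
  unfold IsHALpa halArg
  rw [plethysm_eq_pleth, plethysm_eq_pleth]

/-- The factor `p₁` forces this, so uniqueness holds among all series and not only among those
without constant term. -/
theorem IsHALpa.constantCoeff {H : SymFun (Polynomial ℚ)} (h : IsHALpa H) :
    MvPowerSeries.constantCoeff H = 0 := by
  unfold IsHALpa at h
  rw [h]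
  exact constantCoeff_p_mul _

theorem existsUnique_isHALpa : ∃! H : SymFun (Polynomial ℚ), IsHALpa H := by
  have hC := constantCoeff_withParam constantCoeff_Comm
  obtain ⟨H, hH⟩ := exists_fixedPoint (fun H => p 1 * pleth expandHom
    (suspension Polynomial.X (withParam Assoc))
      (pleth expandHom (withParam Comm) (p 1 + (-(Polynomial.X : Polynomial ℚ)) • H)))
    (fun f => constantCoeff_p_mul _)
    (fun f g hf hg N h => pleth_contraction _ _ hC _ hf hg N h)
  refine ⟨H, (isHALpa_iff H).2 hH, fun H' hH' => ?_⟩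
  exact fixedPoint_unique _ (fun f g hf hg N h => pleth_contraction _ _ hC _ hf hg N h)
    ((isHALpa_iff H').1 hH') hH hH'.constantCoeff ((isHALpa_iff H).2 hH).constantCoeff

theorem atOne_withParam (f : SymFun ℚ) : atOne (withParam f) = f := by
  ext m
  rw [atOne, withParam, coeff_map, coeff_map, Polynomial.coe_evalRingHom, Polynomial.eval_C]

theorem atOne_suspension (f : SymFun ℚ) :
    atOne (suspension Polynomial.X (withParam f)) = suspension 1 f := by
  ext m
  rw [atOne, coeff_map]
  change Polynomial.eval 1 (-((-1) ^ length m * Polynomial.X ^ (degree m - 1) *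
    coeff m (withParam f))) = -((-1) ^ length m * 1 ^ (degree m - 1) * coeff m f)
  rw [withParam, coeff_map]
  simp

theorem atOne_plethysm (f : SymFun (Polynomial ℚ)) {g : SymFun (Polynomial ℚ)}
    (hg : constantCoeff g = 0) : atOne (plethysm f g) = plethQ (atOne f) (atOne g) := by
  rw [plethysm_eq_pleth, ← pleth_id_eq_plethQ]
  refine map_pleth _ (fun k => ?_) f hg
  ext x
  · simp [expandHom]
  · simp [expandHom]

theorem atOne_p_mul (f : SymFun (Polynomial ℚ)) : atOne (p 1 * f) = p 1 * atOne f := by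
  rw [atOne, map_mul, map_p]
  rfl

theorem atOne_halArg (H : SymFun (Polynomial ℚ)) : atOne (halArg H) = p 1 - atOne H := by
  rw [halArg, atOne, map_add, map_p, smul_eq_C_mul, map_mul, map_C]
  simp [sub_eq_add_neg, atOne]

end FixedPoint

/-! ### The identities at `t = 1` -/

section AtOne

/-- The formula `ΣAssoc = p₁ / (1 + p₁)` is kept without denominators, so that a substitution
homomorphism can be applied to it. -/
theorem suspension_Assoc_mul : (1 + p 1) * suspension 1 Assoc = p 1 := by
  have h : Assoc * (1 - p 1) = p 1 := by
    rw [Assoc, mul_assoc, MvPowerSeries.inv_mul_cancel, mul_one]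
    rw [map_sub, p, constantCoeff_X, map_one, sub_zero]
    exact one_ne_zero
  have h2 := congrArg signHom h
  rw [map_mul, map_sub, map_one, signHom_p, sub_neg_eq_add] at h2
  rw [suspension_one, mul_neg, mul_comm, h2, neg_neg]

theorem plethQ_suspension_Assoc {C : SymFun ℚ} (hC : constantCoeff C = 0) :
    (1 + C) * plethQ (suspension 1 Assoc) C = C := by
  have hs := plethQ_hasSubst hC
  have := congrArg (substAlgHom hs) suspension_Assoc_mul
  rw [map_mul, map_add, map_one, p, substAlgHom_X, frob_one, coe_substAlgHom] at this
  exact this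

/-- `signHom` commutes with `p_k ∘ -` and with `exp`, so the second factor is the exponential of
`logSum (signHom P)`, and the first has the opposite exponent. -/
theorem logSum_expOf_unit {P : SymFun ℚ} (hP0 : constantCoeff P = 0) :
    expOf (logSum (-signHom P)) * signHom (expOf (logSum P)) = 1 := by
  have h0 : constantCoeff (signHom P) = 0 := by rw [constantCoeff_signHom, hP0]
  rw [logSum_neg h0, signHom_expOf (constantCoeff_logSum hP0), signHom_logSum hP0]
  exact expOf_neg_mul (constantCoeff_logSum h0)

/-- Both sides are fixed points of the specialised contraction. For `p₁ - ΣP` put `C = Comm ∘ ΣP`: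
then `ΣAssoc ∘ C = C / (1 + C) = 1 - 1 / (1 + C) = 1 - s (Exp P)`, and multiplication by `p₁` gives
`p₁ + s P` by the functional equation of `P`. -/
theorem atOne_isHALpa {P : SymFun ℚ} (hP : P = p 1 * expOf (logSum P))
    {H : SymFun (Polynomial ℚ)} (hH : IsHALpa H) :
    atOne H = p 1 - suspension 1 P := by
  have hP0 : constantCoeff P = 0 := by rw [hP]; exact constantCoeff_p_mul _
  have h0 : constantCoeff (signHom P) = 0 := by rw [constantCoeff_signHom, hP0]
  have h0' : constantCoeff (-signHom P) = 0 := by rw [map_neg, h0, neg_zero]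
  have hH0 : constantCoeff (atOne H) = 0 := by
    rw [atOne, constantCoeff_map, hH.constantCoeff, map_zero]
  have hA0 : constantCoeff (halArg H) = 0 := constantCoeff_p_add_smul hH.constantCoeff _
  have hC0 := constantCoeff_withParam constantCoeff_Comm
  have hC1 : constantCoeff (plethysm (withParam Comm) (halArg H)) = 0 := by
    rw [plethysm_eq_pleth]; exact constantCoeff_pleth _ hC0 hA0
  have hsub : ∀ f : SymFun ℚ, p 1 - f = p 1 + (-1 : ℚ) • f := fun f => by
    rw [neg_one_smul, sub_eq_add_neg]
  refine fixedPoint_unique (fun f => p 1 * pleth (fun _ => RingHom.id ℚ) (suspension 1 Assoc)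
      (pleth (fun _ => RingHom.id ℚ) Comm (p 1 + (-1 : ℚ) • f)))
    (fun f g hf hg N h => pleth_contraction _ _ constantCoeff_Comm _ hf hg N h) ?_ ?_ hH0 ?_
  · have h := congrArg atOne hH
    rw [atOne_p_mul, atOne_plethysm _ hC1, atOne_plethysm _ hA0,
      atOne_suspension, atOne_withParam, atOne_halArg, hsub] at h
    simpa only [pleth_id_eq_plethQ] using h
  · simp only [pleth_id_eq_plethQ]
    rw [suspension_one, sub_neg_eq_add, ← hsub, sub_add_cancel_left]
    have hC2 := constantCoeff_plethQ constantCoeff_Comm h0'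
    have h1 := plethQ_suspension_Assoc hC2
    have hU := logSum_expOf_unit hP0
    set W := plethQ (suspension 1 Assoc) (plethQ Comm (-signHom P))
    rw [plethQ_Comm h0', add_sub_cancel] at h1
    have hW : W = 1 - signHom (expOf (logSum P)) := by
      calc W = expOf (logSum (-signHom P)) * W * signHom (expOf (logSum P)) := by
            rw [mul_right_comm, hU, one_mul]
        _ = 1 - signHom (expOf (logSum P)) := by rw [h1, sub_mul, hU, one_mul]
    rw [hW]
    nth_rw 1 [hP]
    rw [map_mul, signHom_p]
    ring
  · rw [suspension_one, sub_neg_eq_add, map_add, h0, p, constantCoeff_X, add_zero]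

/-- The argument of the plethysms is now `p₁ - (p₁ - ΣP) = ΣP`, and Koszul duality makes `ΣLie ∘
Comm` act on it as the identity. -/
theorem atOne_HALp {P L : SymFun ℚ} {H : SymFun (Polynomial ℚ)} (hL : L = Lie)
    (hK : ∀ g, constantCoeff g = 0 → plethQ (suspension 1 L) (plethQ Comm g) = g)
    (hH : IsHALpa H) (h : atOne H = p 1 - suspension 1 P) :
    atOne (HALp H) = p 1 * suspension 1 P := by
  have hA0 : constantCoeff (halArg H) = 0 := constantCoeff_p_add_smul hH.constantCoeff _
  have hC1 : constantCoeff (plethysm (withParam Comm) (halArg H)) = 0 := by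
    rw [plethysm_eq_pleth]
    exact constantCoeff_pleth _ (constantCoeff_withParam constantCoeff_Comm) hA0
  have hA1 : constantCoeff (atOne (halArg H)) = 0 := by
    rw [atOne, constantCoeff_map, hA0, map_zero]
  rw [HALp, atOne_p_mul, atOne_plethysm _ hC1, atOne_plethysm _ hA0,
    atOne_suspension, atOne_withParam, ← hL, hK _ hA1, atOne_halArg, h, sub_sub_cancel]

theorem atOne_HALa {P : SymFun ℚ} (hP0 : constantCoeff P = 0) {H : SymFun (Polynomial ℚ)}
    (hH : IsHALpa H) (h : atOne H = p 1 - suspension 1 P) :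
    atOne (HALa H) = expOf (logSum (-signHom P)) - 1 + signHom P := by
  have hA0 : constantCoeff (halArg H) = 0 := constantCoeff_p_add_smul hH.constantCoeff _
  have h0 : constantCoeff (-signHom P) = 0 := by
    rw [map_neg, constantCoeff_signHom, hP0, neg_zero]
  have hs := plethQ_hasSubst h0
  rw [HALa, atOne_plethysm _ hA0, atOne_halArg, h, sub_sub_cancel, atOne, map_sub, map_p, ← atOne,
    atOne_withParam, suspension_one, plethQ, subst_sub hs, p, subst_X hs, frob_one, ← plethQ,
    plethQ_Comm h0, sub_neg_eq_add]

/-- By the functional equation the quotient `p₁ / PreLie` is `exp (-logSum PreLie)`; it is unique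
because `p₁` can be cancelled. -/
theorem isAnticyclic_iff {M : SymFun ℚ} (hP : PreLie = p 1 * expOf (logSum PreLie)) :
    IsAnticyclicPreLie M ↔
      M = p 1 + p 1 * PreLie + expOf (-logSum PreLie) - 1 := by
  have hP0 : constantCoeff PreLie = 0 := by rw [hP]; exact constantCoeff_p_mul _
  have hu := expOf_neg_mul (constantCoeff_logSum hP0)
  have hp : (p 1 : SymFun ℚ) ≠ 0 := by
    intro h
    simpa [p] using congrArg (coeff (Finsupp.single 1 1)) h
  constructor
  · rintro ⟨Q, hQ, hM⟩
    have h1 : Q * expOf (logSum PreLie) = 1 := by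
      refine mul_left_cancel₀ hp ?_
      rw [mul_one]
      nth_rw 2 [← hQ]
      nth_rw 2 [hP]
      ring
    have h2 : Q = expOf (-logSum PreLie) := by
      calc Q = Q * expOf (logSum PreLie) * expOf (-logSum PreLie) := by
            rw [mul_assoc, mul_comm (expOf (logSum PreLie)), hu, mul_one]
        _ = _ := by rw [h1, one_mul]
    rw [← h2, ← hM, add_sub_cancel_right]
  · rintro rfl
    refine ⟨expOf (-logSum PreLie), ?_, by ring⟩
    nth_rw 2 [hP]
    rw [mul_left_comm, hu, mul_one]

/-- Only the term `k = 1` of `∑ (p_k ∘ g) / k` involves `p₁`. -/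
theorem pderiv_logSum {g : SymFun ℚ} (hg : constantCoeff g = 0) :
    pderiv ℚ 1 (logSum g) = pderiv ℚ 1 g := by
  ext m
  have h1 := logSum_sub_mem hg (degree m).succPNat
  rw [coeff_pderiv, coeff_pderiv]
  congr 1
  have h2 := h1 (m + Finsupp.single 1 1) (by
    rw [degree_add, degree_single, Nat.succPNat_coe, PNat.one_coe]
    omega)
  rw [map_sub, sub_eq_zero, map_sum] at h2
  rw [h2, Finset.sum_eq_single 1]
  · rw [frob_one]; simp
  · intro k _ hk
    rw [map_smul, coeff_frob_eq_zero, smul_zero]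
    intro n hn
    have h3 := congrArg (fun f => f 1) hn
    simp only [Finsupp.add_apply, Finsupp.single_eq_same] at h3
    rw [Finsupp.embDomain_of_notMem_range] at h3
    · omega
    · rintro ⟨j, hj⟩
      exact hk ((PNat.dvd_one_iff k).1 ⟨j, hj.symm⟩)
  · intro h
    exact absurd (Finset.mem_Icc.2 ⟨le_rfl, one_le⟩) h

theorem pderiv_signHom (f : SymFun ℚ) : pderiv ℚ 1 (signHom f) = -signHom (pderiv ℚ 1 f) := by
  ext m
  rw [coeff_pderiv, map_neg, coeff_signHom, coeff_signHom, coeff_pderiv, length_add, length_single]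
  ring

/-- With `L = logSum P` one has `L' = P'`, so `P = p₁ exp L` gives `exp (-L) P' = 1 + p₁ P'`; the
terms with `P'` in the derivative therefore add up to `-1`. -/
theorem pderiv_of_tree_eq {P : SymFun ℚ} (hP : P = p 1 * expOf (logSum P)) :
    pderiv ℚ 1 (p 1 + p 1 * P + expOf (-logSum P) - 1) = P := by
  have hP0 : constantCoeff P = 0 := by rw [hP]; exact constantCoeff_p_mul _
  have hl := constantCoeff_logSum hP0
  have hl' : constantCoeff (-logSum P) = 0 := by rw [map_neg, hl, neg_zero]
  have hu := expOf_neg_mul hl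
  have hd := congrArg (pderiv ℚ 1) hP
  have hp : pderiv ℚ 1 (p 1 : SymFun ℚ) = 1 := pderiv_X_self
  rw [Derivation.leibniz, derivation_expOf _ hl, pderiv_logSum hP0, hp, smul_eq_mul, smul_eq_mul,
    mul_one] at hd
  rw [map_sub, map_add, map_add, Derivation.leibniz, derivation_expOf _ hl', map_neg,
    pderiv_logSum hP0, hp, pderiv_one, smul_eq_mul, smul_eq_mul]
  have h2 : expOf (-logSum P) * pderiv ℚ 1 P = 1 + p 1 * pderiv ℚ 1 P := by
    conv_lhs => rw [hd]
    linear_combination (1 + p 1 * pderiv ℚ 1 P) * hu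
  linear_combination -h2

/-- All of the algebra ends here; the hypotheses `hP` and `hK` are the two combinatorial inputs that
remain. -/
theorem main_of_series (hP : PreLie = p 1 * expOf (logSum PreLie))
    (hK : ∀ g, constantCoeff g = 0 → plethQ (suspension 1 Lie) (plethQ Comm g) = g) :
    (∃! H : SymFun (Polynomial ℚ), IsHALpa H) ∧
    (∃! M : SymFun ℚ, IsAnticyclicPreLie M) ∧
    ∀ (H : SymFun (Polynomial ℚ)) (M : SymFun ℚ),
      IsHALpa H → IsAnticyclicPreLie M →
        atOne (HAL H) = -suspension 1 M ∧
        atOne H = p 1 - suspension 1 PreLie ∧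
        atOne (HALp H) = p 1 * suspension 1 PreLie ∧
        pderiv ℚ 1 (atOne (HAL H)) = suspension 1 PreLie := by
  have hP0 : constantCoeff PreLie = 0 := by rw [hP]; exact constantCoeff_p_mul _
  have hs0 : constantCoeff (signHom PreLie) = 0 := by rw [constantCoeff_signHom, hP0]
  have hl := constantCoeff_logSum hP0
  refine ⟨existsUnique_isHALpa, ⟨_, (isAnticyclic_iff hP).2 rfl,
    fun M hM => (isAnticyclic_iff hP).1 hM⟩, fun H M hH hM => ?_⟩
  have h1 := atOne_isHALpa hP hH
  have h2 := atOne_HALp rfl hK hH h1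
  have h3 : atOne (HAL H) = -suspension 1 M := by
    rw [HAL, atOne, map_sub, map_add, ← atOne, ← atOne, ← atOne, atOne_HALa hP0 hH h1, h2, h1,
      (isAnticyclic_iff hP).1 hM, suspension_one, suspension_one, map_sub, map_add, map_add,
      map_mul, signHom_p, map_one, signHom_expOf (by rw [map_neg, hl, neg_zero]), map_neg,
      signHom_logSum hP0, logSum_neg hs0]
    ring
  refine ⟨h3, h1, h2, ?_⟩
  rw [h3, suspension_one, neg_neg, pderiv_signHom, (isAnticyclic_iff hP).1 hM,
    pderiv_of_tree_eq hP, suspension_one]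

end AtOne

end SymFun

/-! ### Cycle lengths of permutations of finite types -/

open Function

theorem Function.Semiconj.minimalPeriod_eq {α β : Type} {f : α → α} {f' : β → β} {g : α → β}
    (h : Semiconj g f f') (hg : Injective g) (x : α) :
    minimalPeriod f' (g x) = minimalPeriod f x := by
  refine minimalPeriod_eq_minimalPeriod_iff.2 fun n => ?_
  rw [IsPeriodicPt, IsFixedPt, IsPeriodicPt, IsFixedPt, ← (h.iterate_right n).eq, hg.eq_iff]

namespace Equiv.Perm

variable {α β : Type}

theorem minimalPeriod_permCongr (e : α ≃ β) (σ : Perm α) (a : α) :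
    minimalPeriod (e.permCongr σ) (e a) = minimalPeriod σ a := by
  refine Function.Semiconj.minimalPeriod_eq (fun x => ?_) e.injective a
  rw [permCongr_apply, symm_apply_apply]

theorem card_sameCycle [Finite α] (σ : Perm α) (a : α) :
    Nat.card {b // SameCycle σ b a} = minimalPeriod σ a := by
  classical
  have := Fintype.ofFinite α
  have h := MulAction.minimalPeriod_eq_card (a := σ) (b := a)
  rw [← Nat.card_eq_fintype_card] at h
  refine Eq.trans (Nat.card_congr (Equiv.subtypeEquivRight fun b => ?_)) h.symm
  rw [sameCycle_comm]
  constructor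
  · rintro ⟨i, hi⟩
    exact ⟨⟨σ ^ i, i, rfl⟩, hi⟩
  · rintro ⟨⟨_, i, rfl⟩, hi⟩
    exact ⟨i, hi⟩

theorem SameCycle.minimalPeriod_eq {σ : Perm α} {a b : α} (h : SameCycle σ a b) :
    minimalPeriod σ a = minimalPeriod σ b := by
  obtain ⟨i, rfl⟩ := h
  have hc : Semiconj (σ ^ i : Perm α) σ σ := fun x => by
    rw [← mul_apply, ← mul_apply, ← zpow_add_one, ← zpow_one_add, add_comm]
  exact (hc.minimalPeriod_eq (σ ^ i).injective a).symm

variable [Finite α] [Finite β]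

/-- The length of the cycle of a point. -/
noncomputable def cycleLength (σ : Perm α) (a : α) : ℕ+ :=
  ⟨minimalPeriod σ a, minimalPeriod_pos_of_mem_periodicPts (σ.injective.mem_periodicPts a)⟩

theorem coe_cycleLength (σ : Perm α) (a : α) : (σ.cycleLength a : ℕ) = minimalPeriod σ a := rfl

theorem cycleLength_eq_iff {σ : Perm α} {τ : Perm β} {a : α} {b : β} :
    σ.cycleLength a = τ.cycleLength b ↔ minimalPeriod σ a = minimalPeriod τ b := by
  rw [← PNat.coe_inj]; rfl

/-- The set of cycles of a permutation, fixed points included. -/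
abbrev Cycles (σ : Perm α) : Type := Quotient (SameCycle.setoid σ)

noncomputable instance (σ : Perm α) : Fintype σ.Cycles := Fintype.ofFinite _

/-- The length of a cycle. -/
noncomputable def Cycles.length {σ : Perm α} : σ.Cycles → ℕ+ :=
  Quotient.lift σ.cycleLength fun _ _ h => cycleLength_eq_iff.2 (SameCycle.minimalPeriod_eq h)

theorem Cycles.length_mk {σ : Perm α} (a : α) :
    Cycles.length (Quotient.mk (SameCycle.setoid σ) a) = σ.cycleLength a := rfl

theorem Cycles.card_fiber {σ : Perm α} (o : σ.Cycles) :
    Nat.card {a // Quotient.mk (SameCycle.setoid σ) a = o} = (Cycles.length o : ℕ) := by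
  induction o using Quotient.inductionOn with
  | h a =>
    rw [length_mk, coe_cycleLength, ← card_sameCycle]
    exact Nat.card_congr (Equiv.subtypeEquivRight fun b => Quotient.eq)

/-- The exponents of the monomial of a permutation. -/
noncomputable def cycleTypeExp (σ : Perm α) : ℕ+ →₀ ℕ :=
  ∑ o : σ.Cycles, Finsupp.single (Cycles.length o) 1

theorem sum_single_apply {ι : Type} (s : Finset ι) (f : ι → ℕ+) (k : ℕ+) :
    (∑ i ∈ s, Finsupp.single (f i) 1) k = (s.filter fun i => f i = k).card := by
  classical
  rw [Finsupp.finsetSum_apply, Finset.card_filter]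
  exact Finset.sum_congr rfl fun i _ => Finsupp.single_apply

/-- The points are counted cycle by cycle, each cycle of length `k` contributing `k` points. -/
theorem mul_sum_single_apply (σ : Perm α) (t : Finset σ.Cycles) (k : ℕ+) :
    (k : ℕ) * (∑ o ∈ t, Finsupp.single (Cycles.length o) 1 : ℕ+ →₀ ℕ) k =
      Nat.card {a // Quotient.mk (SameCycle.setoid σ) a ∈ t ∧ minimalPeriod σ a = k} := by
  classical
  have := Fintype.ofFinite α
  rw [sum_single_apply, Nat.card_eq_fintype_card, Fintype.card_subtype,
    Finset.card_eq_sum_card_fiberwise (f := Quotient.mk (SameCycle.setoid σ))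
      (t := t.filter fun o => Cycles.length o = k)]
  · rw [mul_comm, ← smul_eq_mul, ← Finset.sum_const]
    refine Finset.sum_congr rfl fun o ho => ?_
    rw [Finset.mem_filter] at ho
    have h := Cycles.card_fiber o
    rw [ho.2, Nat.card_eq_fintype_card, Fintype.card_subtype] at h
    rw [← h, Finset.filter_filter]
    congr 1
    ext a
    simp only [Finset.mem_filter, Finset.mem_univ, true_and]
    refine ⟨fun ha => ⟨⟨ha ▸ ho.1, ?_⟩, ha⟩, fun h => h.2⟩
    have h3 := ho.2
    rw [← ha, Cycles.length_mk] at h3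
    rw [h, ← h3, coe_cycleLength]
  · intro a ha
    simp only [Finset.coe_filter, Finset.mem_univ, true_and, Set.mem_ofPred_eq] at ha ⊢
    exact ⟨ha.1, by rw [Cycles.length_mk, ← PNat.coe_inj, coe_cycleLength, ha.2]⟩

theorem mul_cycleTypeExp (σ : Perm α) (k : ℕ+) :
    (k : ℕ) * σ.cycleTypeExp k = Nat.card {a // minimalPeriod σ a = k} := by
  rw [cycleTypeExp, mul_sum_single_apply]
  exact Nat.card_congr (Equiv.subtypeEquivRight fun a => by simp)

/-- The working criterion for computing cycle exponents: points of a given period are counted, so no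
list of cycles is needed. -/
theorem eq_cycleTypeExp {σ : Perm α} {m : ℕ+ →₀ ℕ}
    (h : ∀ k : ℕ+, (k : ℕ) * m k = Nat.card {a // minimalPeriod σ a = k}) : m = σ.cycleTypeExp := by
  ext k
  have h1 := h k
  rw [← mul_cycleTypeExp] at h1
  exact Nat.eq_of_mul_eq_mul_left k.pos h1

theorem cycleTypeExp_permCongr (e : α ≃ β) (σ : Perm α) :
    (e.permCongr σ).cycleTypeExp = σ.cycleTypeExp := by
  refine eq_cycleTypeExp fun k => ?_
  rw [mul_cycleTypeExp]
  exact (Nat.card_congr (e.subtypeEquiv fun a => by rw [minimalPeriod_permCongr])).symm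

theorem minimalPeriod_eq_card_support_cycleOf [Fintype α] [DecidableEq α] {σ : Perm α} {a : α}
    (h : a ∈ σ.support) : minimalPeriod σ a = (σ.cycleOf a).support.card := by
  rw [← card_sameCycle, Nat.card_eq_fintype_card, Fintype.card_subtype]
  congr 1
  ext b
  rw [Finset.mem_filter, mem_support_cycleOf_iff, sameCycle_comm]
  simp [h]

/-- `cycleType` omits fixed points, so `k = 1` is counted on the complement of the support, and
every other `k` by the disjoint supports of the cycle factors. -/
theorem cycleExponent_eq {n : ℕ} (σ : Perm (Fin n)) : SymFun.cycleExponent σ = σ.cycleTypeExp := by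
  classical
  refine eq_cycleTypeExp fun k => ?_
  have hk : SymFun.cycleExponent σ k = σ.partition.parts.count (k : ℕ) := by
    rw [SymFun.cycleExponent, Finsupp.comapDomain_apply, Multiset.toFinsupp_apply]
  rw [hk, parts_partition, Multiset.count_add, Multiset.count_replicate,
    Nat.card_eq_fintype_card, Fintype.card_subtype]
  rcases eq_or_ne k 1 with rfl | hk1
  · have h1 : σ.cycleType.count 1 = 0 :=
      Multiset.count_eq_zero.2 fun h => absurd (one_lt_of_mem_cycleType h) (lt_irrefl _)
    rw [PNat.one_coe, h1, zero_add, if_pos rfl, one_mul, ← Finset.card_compl]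
    congr 1
    ext a
    simp [minimalPeriod_eq_one_iff_isFixedPt, IsFixedPt]
  · have hk2 : (k : ℕ) ≠ 1 := fun h => hk1 (PNat.coe_eq_one_iff.1 h)
    rw [if_neg hk2.symm, add_zero, cycleType_def, Multiset.count_map]
    have h2 : (Finset.univ.filter fun a => minimalPeriod σ a = k) =
        (σ.cycleFactorsFinset.filter fun c => (k : ℕ) = c.support.card).biUnion support := by
      ext a
      simp only [Finset.mem_filter, Finset.mem_univ, true_and, Finset.mem_biUnion]
      constructor
      · intro h
        have ha : a ∈ σ.support := by
          rw [mem_support]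
          intro h3
          have : minimalPeriod σ a = 1 := minimalPeriod_eq_one_iff_isFixedPt.2 h3
          omega
        refine ⟨σ.cycleOf a, ⟨cycleOf_mem_cycleFactorsFinset_iff.2 ha, ?_⟩, ?_⟩
        · rw [← minimalPeriod_eq_card_support_cycleOf ha, h]
        · rw [mem_support_cycleOf_iff]; exact ⟨SameCycle.refl _ _, ha⟩
      · rintro ⟨c, ⟨hc, hck⟩, ha⟩
        have h3 : c = σ.cycleOf a := cycle_is_cycleOf ha hc
        have h4 : a ∈ σ.support := mem_cycleFactorsFinset_support_le hc ha
        rw [minimalPeriod_eq_card_support_cycleOf h4, ← h3, hck]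
    rw [h2, Finset.card_biUnion]
    · rw [Finset.sum_congr rfl fun c hc => ((Finset.mem_filter.1 hc).2).symm, Finset.sum_const,
        smul_eq_mul, mul_comm]
      congr 1
    · intro c hc d hd hcd
      exact (cycleFactorsFinset_pairwise_disjoint σ (Finset.mem_filter.1 hc).1
        (Finset.mem_filter.1 hd).1 hcd).disjoint_support

theorem degree_cycleTypeExp (σ : Perm α) : SymFun.degree σ.cycleTypeExp = Nat.card α := by
  classical
  have := Fintype.ofFinite α
  rw [cycleTypeExp]
  have h : ∀ s : Finset σ.Cycles, SymFun.degree (∑ o ∈ s, Finsupp.single (Cycles.length o) 1) =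
      ∑ o ∈ s, (Cycles.length o : ℕ) := by
    intro s
    induction s using Finset.induction_on with
    | empty => exact SymFun.degree_zero
    | insert a s ha ih =>
      rw [Finset.sum_insert ha, Finset.sum_insert ha, SymFun.degree_add, SymFun.degree_single, ih,
        mul_one]
  rw [h, Nat.card_congr (Equiv.sigmaFiberEquiv (Quotient.mk (SameCycle.setoid σ))).symm,
    Nat.card_sigma]
  exact Finset.sum_congr rfl fun o _ => (Cycles.card_fiber o).symm

end Equiv.Perm

/-! ### Coefficients on the basis `p_m / z_m` -/

namespace SymFun

open MvPowerSeries

/-- The order of the centralizer of a permutation with `m k` cycles of length `k`. -/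
def zee (m : ℕ+ →₀ ℕ) : ℚ := m.prod fun k e => (k : ℚ) ^ e * (e.factorial : ℚ)

theorem zee_zero : zee 0 = 1 := Finsupp.prod_zero_index

theorem zee_ne_zero (m : ℕ+ →₀ ℕ) : zee m ≠ 0 :=
  Finset.prod_ne_zero_iff.2 fun k _ => mul_ne_zero
    (pow_ne_zero _ (Nat.cast_ne_zero.2 k.ne_zero)) (Nat.cast_ne_zero.2 (Nat.factorial_ne_zero _))

theorem zee_add_single (m : ℕ+ →₀ ℕ) (k : ℕ+) :
    zee (m + Finsupp.single k 1) = zee m * ((k : ℚ) * (m k + 1)) := by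
  classical
  have h : ∀ (n : ℕ+ →₀ ℕ) (s : Finset ℕ+), n.support ⊆ s →
      zee n = ∏ j ∈ s, ((j : ℚ) ^ n j * ((n j).factorial : ℚ)) := by
    intro n s hs
    refine Finset.prod_subset hs fun j _ hj => ?_
    rw [Finsupp.notMem_support_iff.1 hj]
    simp
  have h1 := h m (insert k m.support) (Finset.subset_insert _ _)
  have h2 := h (m + Finsupp.single k 1) (insert k m.support) (by
    refine Finsupp.support_add.trans (Finset.union_subset (Finset.subset_insert _ _) ?_)
    exact Finsupp.support_single_subset.trans
      (Finset.singleton_subset_iff.2 (Finset.mem_insert_self _ _)))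
  rw [h1, h2, ← Finset.mul_prod_erase _ _ (Finset.mem_insert_self k _),
    ← Finset.mul_prod_erase (insert k m.support) _ (Finset.mem_insert_self k _)]
  rw [Finset.prod_congr rfl (g := fun j : ℕ+ => ((j : ℚ) ^ m j * ((m j).factorial : ℚ)))]
  · rw [Finsupp.add_apply, Finsupp.single_eq_same, pow_succ, Nat.factorial_succ]
    push_cast
    ring
  · intro j hj
    rw [Finsupp.add_apply, Finsupp.single_eq_of_ne (Finset.ne_of_mem_erase hj), add_zero]

/-- The coefficients of a symmetric function on the basis `p_m / z_m`. -/
noncomputable def ghost (f : SymFun ℚ) (m : ℕ+ →₀ ℕ) : ℚ := zee m * coeff m f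

theorem ext_ghost {f g : SymFun ℚ} (h : ∀ m, ghost f m = ghost g m) : f = g := by
  ext m
  exact mul_left_cancel₀ (zee_ne_zero m) (h m)

theorem coeff_eq_ghost_div (f : SymFun ℚ) (m : ℕ+ →₀ ℕ) : coeff m f = ghost f m / zee m := by
  rw [ghost, mul_div_cancel_left₀ _ (zee_ne_zero m)]

/-- The derivation `k ∂ / ∂ p_k`. -/
noncomputable def skew (k : ℕ+) : Derivation ℚ (SymFun ℚ) (SymFun ℚ) := (k : ℚ) • pderiv ℚ k

/-- The factor `k (m_k + 1)` by which `z` grows absorbs both the factor `k` of the derivation and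
the exponent brought down by differentiation. -/
theorem ghost_skew (k : ℕ+) (f : SymFun ℚ) (m : ℕ+ →₀ ℕ) :
    ghost (skew k f) m = ghost f (m + Finsupp.single k 1) := by
  rw [ghost, ghost, zee_add_single, skew, Derivation.smul_apply, map_smul, coeff_pderiv,
    smul_eq_mul]
  ring

theorem ghost_add (f g : SymFun ℚ) (m : ℕ+ →₀ ℕ) : ghost (f + g) m = ghost f m + ghost g m := by
  rw [ghost, map_add, mul_add]; rfl

theorem ghost_zero (f : SymFun ℚ) : ghost f 0 = constantCoeff f := by
  rw [ghost, zee_zero, one_mul]; rfl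

/-- The product in terms of subsets of the set of cycles. -/
theorem ghost_mul {ι : Type} [DecidableEq ι] (s : Finset ι) (l : ι → ℕ+) (f g : SymFun ℚ) :
    ghost (f * g) (∑ i ∈ s, Finsupp.single (l i) 1) =
      ∑ t ∈ s.powerset, ghost f (∑ i ∈ t, Finsupp.single (l i) 1) *
        ghost g (∑ i ∈ s \ t, Finsupp.single (l i) 1) := by
  induction s using Finset.induction_on generalizing f g with
  | empty => simp [ghost_zero]
  | insert a s ha ih =>
    -- `ghost_skew` removes the cycle `a`, and the Leibniz rule assigns it to one of the two
    -- factors: the subsets without `a` and those with `a`.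
    rw [Finset.sum_insert ha, add_comm, ← ghost_skew, Derivation.leibniz, ghost_add, smul_eq_mul,
      smul_eq_mul, ih, mul_comm g, ih, Finset.sum_powerset_insert ha]
    congr 1
    · refine Finset.sum_congr rfl fun t ht => ?_
      have hat : a ∉ t := fun h => ha (Finset.mem_powerset.1 ht h)
      rw [ghost_skew, Finset.insert_sdiff_of_notMem _ hat, Finset.sum_insert
        (fun h => ha (Finset.mem_sdiff.1 h).1), add_comm (Finsupp.single _ _)]
    · refine Finset.sum_congr rfl fun t ht => ?_
      have hat : a ∉ t := fun h => ha (Finset.mem_powerset.1 ht h)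
      rw [ghost_skew, Finset.sum_insert hat, add_comm (Finsupp.single _ _)]
      congr 3
      ext i
      simp only [Finset.mem_sdiff, Finset.mem_insert, not_or]
      constructor
      · exact fun h => ⟨Or.inr h.1, fun hi => ha (hi ▸ h.1), h.2⟩
      · exact fun h => ⟨h.1.resolve_left h.2.1, h.2.2⟩

end SymFun

/-! ### Conjugacy classes and orders of centralizers -/

namespace Equiv.Perm

variable {α : Type}

theorem minimalPeriod_addRight_one (k : ℕ) (x : ZMod k) :
    minimalPeriod (Equiv.addRight (1 : ZMod k)) x = k := by
  have h : ∀ n : ℕ, (Equiv.addRight (1 : ZMod k))^[n] x = x + n := by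
    intro n
    induction n with
    | zero => simp
    | succ n ih => rw [iterate_succ_apply', ih, coe_addRight, Nat.cast_succ, ← add_assoc]
  have h2 : ∀ n, IsPeriodicPt (Equiv.addRight (1 : ZMod k)) n x ↔ k ∣ n := by
    intro n
    rw [IsPeriodicPt, IsFixedPt, h, add_eq_left, ZMod.natCast_eq_zero_iff]
  refine Nat.dvd_antisymm ?_ ?_
  · exact ((h2 k).2 dvd_rfl).minimalPeriod_dvd
  · exact (h2 _).1 (isPeriodicPt_minimalPeriod _ _)

/-- The model is the disjoint union of `m k` copies of translation by one on `ℤ/k`. -/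
theorem exists_cycleTypeExp_eq (m : ℕ+ →₀ ℕ) :
    ∃ (n : ℕ) (σ : Perm (Fin n)), σ.cycleTypeExp = m := by
  have : ∀ k : ℕ+, NeZero (k : ℕ) := fun k => ⟨k.ne_zero⟩
  let α : Type := Σ k : m.support, Fin (m k) × ZMod (k : ℕ+)
  let σ : Perm α := Equiv.sigmaCongrRight fun k =>
    Equiv.prodCongr (Equiv.refl (Fin (m k))) (Equiv.addRight (1 : ZMod (k : ℕ+)))
  have hσ : ∀ a : α, minimalPeriod σ a = (a.1 : ℕ+) := by
    rintro ⟨k, i, x⟩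
    have hs : Semiconj (fun x => (⟨k, i, x⟩ : α)) (Equiv.addRight (1 : ZMod (k : ℕ+))) σ :=
      fun _ => rfl
    have := hs.minimalPeriod_eq (fun x y h => by simpa using h) x
    rw [minimalPeriod_addRight_one] at this
    exact this
  refine ⟨Nat.card α, (Finite.equivFin α).permCongr σ, ?_⟩
  rw [cycleTypeExp_permCongr]
  refine (eq_cycleTypeExp fun k => ?_).symm
  by_cases hk : k ∈ m.support
  · have e : {a : α // minimalPeriod σ a = k} ≃ Fin (m k) × ZMod k :=
      { toFun := fun a => by
          have h : (a.1.1 : ℕ+) = k := PNat.coe_injective ((hσ a.1).symm.trans a.2)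
          exact h ▸ a.1.2
        invFun := fun x => ⟨⟨⟨k, hk⟩, x⟩, hσ _⟩
        left_inv := by
          rintro ⟨⟨⟨j, hj⟩, x⟩, ha⟩
          have h : j = k := PNat.coe_injective ((hσ _).symm.trans ha)
          subst h
          rfl
        right_inv := fun x => rfl }
    rw [Nat.card_congr e, Nat.card_prod, Nat.card_zmod, Nat.card_eq_fintype_card, Fintype.card_fin,
      mul_comm]
  · have : IsEmpty {a : α // minimalPeriod σ a = k} := ⟨fun a => hk (by
      have h : (a.1.1 : ℕ+) = k := PNat.coe_injective ((hσ a.1).symm.trans a.2)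
      rw [← h]
      exact a.1.1.2)⟩
    rw [Nat.card_of_isEmpty, Finsupp.notMem_support_iff.1 hk, mul_zero]

theorem cycleExponent_apply {n : ℕ} (σ : Perm (Fin n)) (k : ℕ+) :
    σ.cycleTypeExp k = σ.partition.parts.count (k : ℕ) := by
  rw [← cycleExponent_eq, SymFun.cycleExponent, Finsupp.comapDomain_apply,
    Multiset.toFinsupp_apply]

theorem isConj_iff_cycleTypeExp {n : ℕ} {σ τ : Perm (Fin n)} :
    IsConj σ τ ↔ σ.cycleTypeExp = τ.cycleTypeExp := by
  rw [partition_eq_of_isConj, Nat.Partition.ext_iff]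
  constructor
  · intro h
    ext k
    rw [cycleExponent_apply, cycleExponent_apply, h]
  · intro h
    ext k
    rcases Nat.eq_zero_or_pos k with rfl | hk
    · rw [Multiset.count_eq_zero.2 fun h => absurd (σ.partition.parts_pos h) (lt_irrefl 0),
        Multiset.count_eq_zero.2 fun h => absurd (τ.partition.parts_pos h) (lt_irrefl 0)]
    · lift k to ℕ+ using hk
      have := DFunLike.congr_fun h k
      rw [cycleExponent_apply, cycleExponent_apply] at this
      exact this

theorem zee_cycleTypeExp {n : ℕ} (σ : Perm (Fin n)) : SymFun.zee σ.cycleTypeExp =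
    (((Fintype.card (Fin n) - σ.cycleType.sum).factorial * σ.cycleType.prod *
      ∏ k ∈ σ.cycleType.toFinset, (σ.cycleType.count k).factorial : ℕ) : ℚ) := by
  classical
  set P := σ.partition.parts with hP
  have h1 : SymFun.zee σ.cycleTypeExp =
      ∏ j ∈ P.toFinset, ((j : ℚ) ^ P.count j * ((P.count j).factorial : ℚ)) := by
    refine Finset.prod_bij (fun k _ => (k : ℕ)) ?_ ?_ ?_ ?_
    · intro k hk
      rw [Finsupp.mem_support_iff, cycleExponent_apply, Multiset.count_ne_zero] at hk
      exact Multiset.mem_toFinset.2 hk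
    · exact fun _ _ _ _ h => PNat.coe_injective h
    · intro j hj
      rw [Multiset.mem_toFinset] at hj
      let k : ℕ+ := ⟨j, σ.partition.parts_pos hj⟩
      refine ⟨k, ?_, rfl⟩
      rw [Finsupp.mem_support_iff, cycleExponent_apply, Multiset.count_ne_zero]
      exact hj
    · intro k _
      rw [cycleExponent_apply]
  have hparts : P = σ.cycleType + Multiset.replicate (Fintype.card (Fin n) - σ.cycleType.sum) 1 := by
    rw [hP, parts_partition, sum_cycleType]
  set f := Fintype.card (Fin n) - σ.cycleType.sum
  have h2 : P.prod = σ.cycleType.prod := by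
    rw [hparts, Multiset.prod_add, Multiset.prod_replicate, one_pow, mul_one]
  have h11 : (1 : ℕ) ∉ σ.cycleType := fun h => absurd (one_lt_of_mem_cycleType h) (lt_irrefl _)
  have h3 : ∏ j ∈ P.toFinset, (P.count j).factorial =
      f.factorial * ∏ k ∈ σ.cycleType.toFinset, (σ.cycleType.count k).factorial := by
    have h4 : ∏ j ∈ P.toFinset, (P.count j).factorial =
        ∏ j ∈ insert 1 σ.cycleType.toFinset, (P.count j).factorial := by
      refine Finset.prod_subset (fun j hj => ?_) fun j _ hj => ?_
      · rw [Multiset.mem_toFinset, hparts, Multiset.mem_add] at hj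
        rw [Finset.mem_insert, Multiset.mem_toFinset]
        rcases hj with hj | hj
        · exact Or.inr hj
        · exact Or.inl (Multiset.eq_of_mem_replicate hj)
      · rw [Multiset.mem_toFinset] at hj
        rw [Multiset.count_eq_zero.2 hj, Nat.factorial_zero]
    rw [h4, Finset.prod_insert (by rwa [Multiset.mem_toFinset])]
    congr 1
    · rw [hparts, Multiset.count_add, Multiset.count_eq_zero.2 h11, Multiset.count_replicate_self,
        zero_add]
    · refine Finset.prod_congr rfl fun j hj => ?_
      rw [Multiset.mem_toFinset] at hj
      rw [hparts, Multiset.count_add, Multiset.count_replicate,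
        if_neg (fun h : 1 = j => h11 (h ▸ hj)), add_zero]
  rw [h1, Finset.prod_mul_distrib, ← Nat.cast_prod, h3]
  have h5 : ∏ j ∈ P.toFinset, (j : ℚ) ^ P.count j = (P.prod : ℚ) := by
    rw [Finset.prod_multiset_count P]
    push_cast
    rfl
  rw [h5, h2]
  push_cast
  ring

theorem zee_mul_card {n : ℕ} (σ : Perm (Fin n)) :
    SymFun.zee σ.cycleTypeExp *
      ((Finset.univ.filter fun τ : Perm (Fin n) => τ.cycleTypeExp = σ.cycleTypeExp).card : ℚ) =
      (n.factorial : ℚ) := by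
  classical
  have h := card_isConj_mul_eq σ
  have h2 : Nat.card {h : Perm (Fin n) | IsConj σ h} =
      (Finset.univ.filter fun τ : Perm (Fin n) => τ.cycleTypeExp = σ.cycleTypeExp).card := by
    rw [Nat.card_eq_fintype_card, Fintype.card_subtype]
    congr 1
    ext τ
    simp only [Finset.mem_filter, Finset.mem_univ, true_and]
    exact isConj_iff_cycleTypeExp.trans eq_comm
  rw [h2] at h
  rw [zee_cycleTypeExp, mul_comm]
  have h3 := congrArg (fun k : ℕ => (k : ℚ)) h
  simp only [Fintype.card_fin] at h3 ⊢
  exact_mod_cast h3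

end Equiv.Perm

/-! ### Frobenius characteristics through values of characters -/

namespace SymFun

open MvPowerSeries Equiv.Perm

/-- A conjugacy class has `n! / z` elements, so the factors `1 / n!` and `z` cancel its size. -/
theorem ghost_frobeniusSeries (χ : (n : ℕ) → Equiv.Perm (Fin n) → ℚ) {n : ℕ}
    (hχ : ∀ σ τ : Equiv.Perm (Fin n), χ n (τ * σ * τ⁻¹) = χ n σ) (σ : Equiv.Perm (Fin n)) :
    ghost (frobeniusSeries χ) σ.cycleTypeExp = χ n σ := by
  classical
  have hdeg : degree σ.cycleTypeExp = n := by rw [degree_cycleTypeExp, Nat.card_fin]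
  have h1 : coeff σ.cycleTypeExp (frobeniusSeries χ) =
      coeff σ.cycleTypeExp (frobenius n (χ n)) := by
    change coeff σ.cycleTypeExp (frobenius (degree σ.cycleTypeExp) (χ (degree σ.cycleTypeExp))) = _
    rw [hdeg]
  have hconj : ∀ τ : Equiv.Perm (Fin n), τ.cycleTypeExp = σ.cycleTypeExp → χ n τ = χ n σ := by
    intro τ h
    obtain ⟨c, rfl⟩ := isConj_iff.1 (isConj_iff_cycleTypeExp.2 h.symm)
    exact hχ σ c
  rw [ghost, h1, frobenius, coeff_C_mul, map_sum]
  simp_rw [coeff_monomial, cycleExponent_eq, eq_comm (a := σ.cycleTypeExp)]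
  rw [← Finset.sum_filter, Finset.sum_congr rfl fun τ hτ => hconj τ (Finset.mem_filter.1 hτ).2,
    Finset.sum_const, nsmul_eq_mul]
  have h2 := zee_mul_card σ
  have h3 : (n.factorial : ℚ) ≠ 0 := Nat.cast_ne_zero.2 (Nat.factorial_ne_zero n)
  calc _ = (zee σ.cycleTypeExp * ((Finset.univ.filter fun τ : Equiv.Perm (Fin n) =>
        τ.cycleTypeExp = σ.cycleTypeExp).card : ℚ)) * (1 / n.factorial) * χ n σ := by ring
    _ = χ n σ := by rw [h2, mul_one_div_cancel h3, one_mul]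

/-- The symmetric function of a family of class functions defined on all finite types. -/
theorem ghost_frobeniusSeries_of_equiv (X : (α : Type) → Equiv.Perm α → ℚ)
    (hX : ∀ (α β : Type) (e : α ≃ β) (σ : Equiv.Perm α), X β (e.permCongr σ) = X α σ)
    {α : Type} [Finite α] (σ : Equiv.Perm α) :
    ghost (frobeniusSeries fun n => X (Fin n)) σ.cycleTypeExp = X α σ := by
  rw [← cycleTypeExp_permCongr (Finite.equivFin α) σ, ghost_frobeniusSeries, hX]
  intro σ τ
  exact hX _ _ τ σ

end SymFun

/-- A rooted forest, given by the map from vertices to their parents; the roots are the fixed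
points. -/
def IsForest {α : Type} (p : α → α) : Prop := ∀ a, ∃ n, p (p^[n] a) = p^[n] a

/-- Rooted forests fixed by a permutation. -/
def EquivForest {α : Type} (σ : Equiv.Perm α) (p : α → α) : Prop :=
  IsForest p ∧ ∀ a, p (σ a) = σ (p a)

/-- Rooted trees fixed by a permutation. -/
def EquivTree {α : Type} (σ : Equiv.Perm α) (p : α → α) : Prop :=
  EquivForest σ p ∧ ∃! r, p r = r

/-! ### Rooted trees as graphs and as parent maps -/

section ParentGraph

variable {α : Type}

/-- The graph of a map to parents. -/
def parentGraph (p : α → α) : SimpleGraph α := SimpleGraph.fromRel fun a b => p a = b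

theorem parentGraph_adj {p : α → α} {a b : α} :
    (parentGraph p).Adj a b ↔ a ≠ b ∧ (p a = b ∨ p b = a) := Iff.rfl

theorem parentGraph_reachable (p : α → α) (a : α) (n : ℕ) :
    (parentGraph p).Reachable a (p^[n] a) := by
  induction n with
  | zero => exact SimpleGraph.Reachable.refl _
  | succ n ih =>
    refine ih.trans ?_
    rw [iterate_succ_apply']
    by_cases h : p^[n] a = p (p^[n] a)
    · rw [← h]
    · exact SimpleGraph.Adj.reachable (parentGraph_adj.2 ⟨h, Or.inl rfl⟩)

theorem parentGraph_connected {p : α → α} {r : α} (h : ∀ a, ∃ n, p^[n] a = r) :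
    (parentGraph p).Connected := by
  have : Nonempty α := ⟨r⟩
  refine SimpleGraph.Connected.mk fun a b => ?_
  obtain ⟨n, hn⟩ := h a
  obtain ⟨m, hm⟩ := h b
  have h1 := parentGraph_reachable p a n
  have h2 := parentGraph_reachable p b m
  rw [hn] at h1
  rw [hm] at h2
  exact h1.trans h2.symm

/-- Every edge is `{a, p a}` for some `a` other than the root, so the connected graph has at most
one edge less than vertices. -/
theorem parentGraph_isTree [Finite α] {p : α → α} {r : α} (hr : p r = r)
    (h : ∀ a, ∃ n, p^[n] a = r) : (parentGraph p).IsTree := by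
  classical
  have := Fintype.ofFinite α
  have hc := parentGraph_connected h
  refine SimpleGraph.isTree_iff_connected_and_card.2 ⟨hc, le_antisymm ?_
    hc.card_vert_le_card_edgeSet_add_one⟩
  have hsub : (parentGraph p).edgeSet ⊆
      ((Finset.univ.erase r).image fun a => s(a, p a) : Finset (Sym2 α)) := by
    intro e
    induction e using Sym2.ind with
    | _ a b =>
      intro he
      rw [SimpleGraph.mem_edgeSet, parentGraph_adj] at he
      simp only [Finset.coe_image, Set.mem_image, Finset.mem_coe, Finset.mem_erase,
        Finset.mem_univ, and_true]
      rcases he with ⟨hne, he | he⟩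
      · refine ⟨a, ?_, by rw [he]⟩
        rintro rfl
        exact hne (hr.symm.trans he)
      · refine ⟨b, ?_, by rw [he, Sym2.eq_swap]⟩
        rintro rfl
        exact hne (he.symm.trans hr)
  have h1 : Nat.card (parentGraph p).edgeSet ≤ (Finset.univ.erase r).card := by
    refine le_trans (Nat.card_mono (Finset.finite_toSet _) hsub) ?_
    rw [Nat.card_eq_card_toFinset, Finset.toFinset_coe]
    exact Finset.card_image_le
  rw [Finset.card_erase_of_mem (Finset.mem_univ r), Finset.card_univ,
    ← Nat.card_eq_fintype_card] at h1
  have : 0 < Nat.card α := Nat.card_pos_iff.2 ⟨⟨r⟩, inferInstance⟩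
  omega

theorem iterate_of_apply_apply {p : α → α} {a : α} (h : p (p a) = a) (n : ℕ) :
    p^[n] a = a ∨ p^[n] a = p a := by
  induction n with
  | zero => exact Or.inl rfl
  | succ n ih =>
    rw [iterate_succ_apply']
    rcases ih with ih | ih
    · rw [ih]; exact Or.inr rfl
    · rw [ih, h]; exact Or.inl rfl

/-- Induction on the number of steps of `p` to the root: the edge from `a` to `p a` is also an edge
for `q`, and it has to point upwards there too. -/
theorem parentGraph_injective {p q : α → α} {r : α} (hp : p r = r) (hq : q r = r)
    (h : ∀ a, ∃ n, p^[n] a = r) (hG : parentGraph p = parentGraph q) : p = q := by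
  have key : ∀ n a, p^[n] a = r → q a = p a := by
    intro n
    induction n with
    | zero =>
      intro a ha
      rw [iterate_zero, id] at ha
      rw [ha, hp, hq]
    | succ n ih =>
      intro a ha
      rw [iterate_succ_apply] at ha
      by_cases har : a = r
      · rw [har, hp, hq]
      by_cases hfix : p a = a
      · rw [hfix, iterate_fixed hfix] at ha
        exact absurd ha har
      have hadj : (parentGraph q).Adj a (p a) := hG ▸ parentGraph_adj.2 ⟨Ne.symm hfix, Or.inl rfl⟩
      rcases hadj.2 with hqa | hqb
      · exact hqa
      -- If the edge pointed downwards, then `p (p a) = a` by induction, and from such a pair the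
      -- root is not reached.
      · rw [ih _ ha] at hqb
        obtain ⟨m, hm⟩ := h a
        rcases iterate_of_apply_apply hqb m with h1 | h1
        · exact absurd (h1.symm.trans hm) har
        · have h2 : p a = r := h1.symm.trans hm
          rw [h2, hp] at hqb
          exact absurd hqb.symm har
  funext a
  obtain ⟨n, hn⟩ := h a
  exact (key n a hn).symm

theorem parentGraph_map (σ : Equiv.Perm α) (p : α → α) :
    (parentGraph p).map σ.toEmbedding = parentGraph (fun a => σ (p (σ.symm a))) := by
  ext a b
  rw [SimpleGraph.map_adj, parentGraph_adj]
  constructor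
  · rintro ⟨x, y, h, rfl, rfl⟩
    rw [parentGraph_adj] at h
    simpa using h
  · intro h
    refine ⟨σ.symm a, σ.symm b, parentGraph_adj.2 ?_, by simp, by simp⟩
    rw [σ.symm.injective.ne_iff, Equiv.eq_symm_apply, Equiv.eq_symm_apply]
    exact h

/-- A parent is a neighbour closer to the root, taken from a shortest walk. The graph obtained is a
connected subgraph of `G`, hence all of it, as a tree is minimal among connected graphs. -/
theorem exists_parentGraph_eq {G : SimpleGraph α} (hG : G.IsTree) (r : α) :
    ∃ p : α → α, p r = r ∧ (∀ a, p a = a → a = r) ∧ (∀ a, ∃ n, p^[n] a = r) ∧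
      parentGraph p = G := by
  classical
  have h1 : ∀ a, a ≠ r → ∃ b, G.Adj a b ∧ G.dist b r < G.dist a r := by
    intro a ha
    obtain ⟨w, hw⟩ := hG.1.exists_walk_length_eq_dist a r
    cases w with
    | nil => exact absurd rfl ha
    | cons h w' =>
      refine ⟨_, h, ?_⟩
      rw [← hw, SimpleGraph.Walk.length_cons]
      exact Nat.lt_succ_of_le (SimpleGraph.dist_le w')
  choose! f hf hd using h1
  let p : α → α := fun a => if a = r then r else f a
  have hpr : p r = r := if_pos rfl
  have hpa : ∀ a, a ≠ r → p a = f a := fun a ha => if_neg ha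
  have hit : ∀ n a, G.dist a r ≤ n → ∃ k, p^[k] a = r := by
    intro n
    induction n with
    | zero =>
      intro a ha
      exact ⟨0, (hG.1.dist_eq_zero_iff).1 (Nat.le_zero.1 ha)⟩
    | succ n ih =>
      intro a ha
      by_cases har : a = r
      · exact ⟨0, har⟩
      · obtain ⟨k, hk⟩ := ih (f a) (by have := hd a har; omega)
        exact ⟨k + 1, by rw [iterate_succ_apply, hpa a har, hk]⟩
  have hit' : ∀ a, ∃ n, p^[n] a = r := fun a => hit _ a le_rfl
  refine ⟨p, hpr, fun a ha => ?_, hit', ?_⟩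
  · by_contra har
    rw [hpa a har] at ha
    have := hf a har
    rw [ha] at this
    exact G.irrefl this
  · have hle : parentGraph p ≤ G := by
      intro a b hab
      obtain ⟨hne, h | h⟩ := parentGraph_adj.1 hab
      · by_cases har : a = r
        · exact absurd ((congrArg p har).trans hpr |>.symm.trans h |> fun h => har.trans h) hne
        · rw [← h, hpa a har]; exact hf a har
      · by_cases hbr : b = r
        · exact absurd ((congrArg p hbr).trans hpr |>.symm.trans h |> fun h => hbr.trans h) hne.symm
        · rw [← h, hpa b hbr]; exact (hf b hbr).symm
    exact le_antisymm hle ((SimpleGraph.isTree_iff_minimal_connected.1 hG).2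
      (parentGraph_connected hit') hle)

theorem IsForest.exists_iterate_eq {p : α → α} (h : IsForest p) {r : α}
    (hr : ∀ a, p a = a → a = r) (a : α) : ∃ n, p^[n] a = r := by
  obtain ⟨n, hn⟩ := h a
  exact ⟨n, hr _ hn⟩

/-- Rooted trees as pairs of a tree and a vertex and as maps from vertices to their parents. -/
theorem card_rootedTree_eq [Finite α] (σ : Equiv.Perm α) :
    Nat.card {T : SimpleGraph α × α // T.1.IsTree ∧ T.1.map σ.toEmbedding = T.1 ∧ σ T.2 = T.2} =
      Nat.card {p : α → α // EquivTree σ p} := by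
  classical
  have hroot : ∀ p : {p : α → α // EquivTree σ p}, ∃ r, p.1 r = r ∧ (∀ a, p.1 a = a → a = r) ∧
      ∀ a, ∃ n, p.1^[n] a = r := by
    rintro ⟨p, ⟨hp, _⟩, r, hr, hu⟩
    exact ⟨r, hr, hu, hp.exists_iterate_eq hu⟩
  choose r hr hu hit using hroot
  have hmap : ∀ p : {p : α → α // EquivTree σ p},
      (parentGraph p.1).map σ.toEmbedding = parentGraph p.1 := by
    intro p
    rw [parentGraph_map]
    congr 1
    funext a
    rw [← p.2.1.2, Equiv.apply_symm_apply]
  refine (Nat.card_congr (Equiv.ofBijective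
    (fun p => ⟨(parentGraph p.1, r p), parentGraph_isTree (hr p) (hit p), hmap p,
      hu p _ (by rw [p.2.1.2, hr])⟩) ⟨?_, ?_⟩)).symm
  · intro p q hpq
    have h := Subtype.ext_iff.1 hpq
    have h1 : parentGraph p.1 = parentGraph q.1 := congrArg Prod.fst h
    have h2 : r p = r q := congrArg Prod.snd h
    exact Subtype.ext (parentGraph_injective (hr p) (h2 ▸ hr q) (hit p) h1)
  · rintro ⟨⟨G, ρ⟩, hG, hσ, hρ⟩
    simp only at hG hσ hρ
    obtain ⟨p, hp1, hp2, hp3, rfl⟩ := exists_parentGraph_eq hG ρ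
    have hcomm : p = fun a => σ (p (σ.symm a)) := by
      refine parentGraph_injective hp1 ?_ hp3 ?_
      · rw [← hρ, Equiv.symm_apply_apply, hp1]
      · rw [← parentGraph_map, hσ]
    have hpT : EquivTree σ p := by
      refine ⟨⟨fun a => ?_, fun a => ?_⟩, ρ, hp1, hp2⟩
      · obtain ⟨n, hn⟩ := hp3 a
        exact ⟨n, by rw [hn, hp1]⟩
      · have := congrFun hcomm (σ a)
        rwa [Equiv.symm_apply_apply] at this
    refine ⟨⟨p, hpT⟩, Subtype.ext (Prod.ext rfl ?_)⟩
    exact hp2 _ (hr ⟨p, hpT⟩)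

end ParentGraph

/-! ### Counts of invariant forests; removal of the root -/

section Forests

variable {α β : Type}

/-- The number of rooted forests fixed by a permutation. -/
noncomputable def forestCount (α : Type) (σ : Equiv.Perm α) : ℚ :=
  Nat.card {p : α → α // EquivForest σ p}

/-- The number of rooted trees fixed by a permutation. -/
noncomputable def treeCount (α : Type) (σ : Equiv.Perm α) : ℚ :=
  Nat.card {p : α → α // EquivTree σ p}

/-- Rooted forests fixed by a permutation that permutes the roots transitively. -/
def TransForest (σ : Equiv.Perm α) (p : α → α) : Prop :=
  EquivForest σ p ∧ ∀ r s, p r = r → p s = s → σ.SameCycle r s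

/-- The number of rooted forests fixed by a permutation that permutes the roots transitively. -/
noncomputable def transForestCount (α : Type) (σ : Equiv.Perm α) : ℚ :=
  Nat.card {p : α → α // TransForest σ p}

theorem exists_fixed_iterate_iff {g : β → α} (hg : Injective g) {p : α → α} {q : β → β}
    (h : Semiconj g q p) (b : β) :
    (∃ n, q (q^[n] b) = q^[n] b) ↔ ∃ n, p (p^[n] (g b)) = p^[n] (g b) := by
  refine exists_congr fun n => ?_
  rw [← (h.iterate_right n).eq, ← h.eq, hg.eq_iff]

theorem EquivForest.conj (e : α ≃ β) {σ : Equiv.Perm α} {p : α → α} (h : EquivForest σ p) :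
    EquivForest (e.permCongr σ) (fun b => e (p (e.symm b))) := by
  constructor
  · intro b
    have hs : Semiconj e p (fun b => e (p (e.symm b))) := fun a => by simp
    have := (exists_fixed_iterate_iff e.injective hs (e.symm b)).1 (h.1 _)
    rwa [e.apply_symm_apply] at this
  · intro b
    simp [Equiv.permCongr_apply, h.2]

theorem EquivTree.conj (e : α ≃ β) {σ : Equiv.Perm α} {p : α → α} (h : EquivTree σ p) :
    EquivTree (e.permCongr σ) (fun b => e (p (e.symm b))) := by
  obtain ⟨hf, r, hr, hu⟩ := h
  refine ⟨hf.conj e, e r, by simp [hr], fun s hs => ?_⟩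
  have hs' : e (p (e.symm s)) = s := hs
  rw [← e.eq_symm_apply] at hs'
  rw [← hu _ hs', e.apply_symm_apply]

theorem permCongr_symm_permCongr (e : α ≃ β) (σ : Equiv.Perm α) :
    e.symm.permCongr (e.permCongr σ) = σ := by
  ext a
  simp [Equiv.permCongr_apply]

theorem forestCount_permCongr (α β : Type) (e : α ≃ β) (σ : Equiv.Perm α) :
    forestCount β (e.permCongr σ) = forestCount α σ := by
  have h : ∀ p, EquivForest (e.permCongr σ) p → EquivForest σ (fun a => e.symm (p (e a))) := by
    intro p hp
    have := hp.conj e.symm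
    rwa [permCongr_symm_permCongr] at this
  exact congrArg _ (Nat.card_congr ⟨fun p => ⟨_, h p.1 p.2⟩,
    fun p => ⟨_, p.2.conj e⟩, fun p => by ext; simp, fun p => by ext; simp⟩)

theorem treeCount_permCongr (α β : Type) (e : α ≃ β) (σ : Equiv.Perm α) :
    treeCount β (e.permCongr σ) = treeCount α σ := by
  have h : ∀ p, EquivTree (e.permCongr σ) p → EquivTree σ (fun a => e.symm (p (e a))) := by
    intro p hp
    have := hp.conj e.symm
    rwa [permCongr_symm_permCongr] at this
  exact congrArg _ (Nat.card_congr ⟨fun p => ⟨_, h p.1 p.2⟩,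
    fun p => ⟨_, p.2.conj e⟩, fun p => by ext; simp, fun p => by ext; simp⟩)

/-- The symmetric function of rooted forests. -/
noncomputable def forestSeries : SymFun ℚ := SymFun.frobeniusSeries fun n => forestCount (Fin n)

theorem ghost_forestSeries [Finite α] (σ : Equiv.Perm α) :
    SymFun.ghost forestSeries σ.cycleTypeExp = forestCount α σ :=
  SymFun.ghost_frobeniusSeries_of_equiv _ forestCount_permCongr σ

theorem ghost_PreLie [Finite α] (σ : Equiv.Perm α) :
    SymFun.ghost SymFun.PreLie σ.cycleTypeExp = treeCount α σ := by
  rw [← SymFun.ghost_frobeniusSeries_of_equiv _ treeCount_permCongr σ, SymFun.PreLie]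
  congr 2
  funext n τ
  rw [rootedTreeCharacter, card_rootedTree_eq]
  rfl

section RemoveRoot

/-- Removal of the root of a tree with root `v`. -/
theorem card_tree_eq_forest (σ : Equiv.Perm α) (v : α) (hv : σ v = v)
    (h : ∀ a, σ a ≠ v ↔ a ≠ v) :
    Nat.card {p : α → α // EquivTree σ p ∧ p v = v} =
      Nat.card {q : {a // a ≠ v} → {a // a ≠ v} // EquivForest (σ.subtypePerm h) q} := by
  classical
  -- Roots are fixed points: without `v` its children become their own parents, and `G` attaches the
  -- roots to `v` again.
  let F : (α → α) → {a // a ≠ v} → {a // a ≠ v} := fun p a =>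
    if hp : p a = v then a else ⟨p a, hp⟩
  let G : ({a // a ≠ v} → {a // a ≠ v}) → α → α := fun q a =>
    if ha : a = v then v else if q ⟨a, ha⟩ = ⟨a, ha⟩ then v else q ⟨a, ha⟩
  have hG : ∀ q a (ha : a ≠ v), G q a = if q ⟨a, ha⟩ = ⟨a, ha⟩ then v else (q ⟨a, ha⟩ : α) :=
    fun q a ha => dif_neg ha
  have hGv : ∀ q, G q v = v := fun q => dif_pos rfl
  have hGF : ∀ p, EquivTree σ p → p v = v → G (F p) = p := by
    rintro p ⟨⟨hp, _⟩, r, hr, hu⟩ hpv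
    funext a
    by_cases ha : a = v
    · rw [ha, hGv, hpv]
    · rw [hG _ _ ha]
      by_cases hpa : p a = v
      · rw [if_pos, hpa]
        exact dif_pos hpa
      · have h1 : F p ⟨a, ha⟩ = ⟨p a, hpa⟩ := dif_neg hpa
        rw [h1, if_neg]
        intro h2
        exact ha ((hu _ (Subtype.ext_iff.1 h2)).trans (hu _ hpv).symm)
  have hFG : ∀ q, F (G q) = q := by
    intro q
    funext a
    by_cases hq : q a = a
    · have h1 : G q a = v := by rw [hG _ _ a.2]; exact if_pos hq
      exact (dif_pos h1).trans hq.symm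
    · have h1 : G q a = q a := by rw [hG _ _ a.2]; exact if_neg hq
      have h2 : G q a ≠ v := by rw [h1]; exact (q a).2
      exact (dif_neg h2).trans (Subtype.ext h1)
  have hF : ∀ p, EquivTree σ p → p v = v → EquivForest (σ.subtypePerm h) (F p) := by
    rintro p ⟨⟨hp, hc⟩, r, hr, hu⟩ hpv
    obtain rfl : v = r := hu v hpv
    constructor
    · have key : ∀ n (a : {a // a ≠ v}), p^[n] a = v → ∃ k, F p ((F p)^[k] a) = (F p)^[k] a := by
        intro n
        induction n with
        | zero => exact fun a ha => absurd ha a.2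
        | succ n ih =>
          intro a ha
          by_cases hpa : p a = v
          · exact ⟨0, dif_pos hpa⟩
          · have h1 : F p a = ⟨p a, hpa⟩ := dif_neg hpa
            obtain ⟨k, hk⟩ := ih ⟨p a, hpa⟩ ha
            rw [← h1] at hk
            exact ⟨k + 1, hk⟩
      intro a
      obtain ⟨n, hn⟩ := hp.exists_iterate_eq hu a
      exact key n a hn
    · intro a
      by_cases hpa : p a = v
      · have h1 : p (σ a) = v := by rw [hc, hpa, hv]
        have h2 : F p a = a := dif_pos hpa
        rw [h2]
        exact dif_pos h1
      · have h1 : p (σ a) ≠ v := by rw [hc]; exact (h _).2 hpa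
        have h2 : F p a = ⟨p a, hpa⟩ := dif_neg hpa
        rw [h2]
        exact (dif_neg h1).trans (Subtype.ext (hc a))
  have hG' : ∀ q, EquivForest (σ.subtypePerm h) q → EquivTree σ (G q) := by
    rintro q ⟨hq, hc⟩
    have hfix : ∀ a, G q a = a → a = v := by
      intro a ha
      by_contra hav
      rw [hG _ _ hav] at ha
      split_ifs at ha with h1
      · exact hav ha.symm
      · exact h1 (Subtype.ext ha)
    have key : ∀ n (a : {a // a ≠ v}), q (q^[n] a) = q^[n] a → ∃ k, (G q)^[k] a = v := by
      intro n
      induction n with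
      | zero => exact fun a ha => ⟨1, by rw [iterate_one, hG _ _ a.2]; exact if_pos ha⟩
      | succ n ih =>
        intro a ha
        by_cases hqa : q a = a
        · exact ⟨1, by rw [iterate_one, hG _ _ a.2]; exact if_pos hqa⟩
        · obtain ⟨k, hk⟩ := ih (q a) ha
          have h1 : G q a = q a := by rw [hG _ _ a.2]; exact if_neg hqa
          exact ⟨k + 1, by rw [iterate_succ_apply, h1, hk]⟩
    refine ⟨⟨fun a => ?_, fun a => ?_⟩, v, hGv q, hfix⟩
    · by_cases ha : a = v
      · exact ⟨0, by rw [ha]; exact hGv q⟩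
      · obtain ⟨n, hn⟩ := hq ⟨a, ha⟩
        obtain ⟨k, hk⟩ := key n ⟨a, ha⟩ hn
        exact ⟨k, by rw [hk, hGv]⟩
    · by_cases ha : a = v
      · rw [ha, hv, hGv, hv]
      · have hσa : σ a ≠ v := (h a).2 ha
        have h1 : q ⟨σ a, hσa⟩ = (σ.subtypePerm h) (q ⟨a, ha⟩) := hc ⟨a, ha⟩
        rw [hG _ _ ha, hG _ _ hσa, h1]
        by_cases hqa : q ⟨a, ha⟩ = ⟨a, ha⟩
        · rw [if_pos hqa, hqa, hv]
          exact if_pos rfl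
        · rw [if_neg hqa, if_neg]
          · rfl
          · intro h2
            exact hqa (Subtype.ext (σ.injective (Subtype.ext_iff.1 h2)))
  exact Nat.card_congr ⟨fun p => ⟨F p.1, hF _ p.2.1 p.2.2⟩, fun q => ⟨G q.1, hG' _ q.2, hGv _⟩,
    fun p => Subtype.ext (hGF _ p.2.1 p.2.2), fun q => Subtype.ext (hFG _)⟩

theorem subtypePerm_ne_cycleTypeExp [Finite α] (σ : Equiv.Perm α) (v : α) (hv : σ v = v)
    (h : ∀ a, σ a ≠ v ↔ a ≠ v) :
    (σ.subtypePerm (p := fun a => a ≠ v) h).cycleTypeExp + Finsupp.single 1 1 = σ.cycleTypeExp := by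
  classical
  have := Fintype.ofFinite α
  refine Equiv.Perm.eq_cycleTypeExp fun k => ?_
  have hper : ∀ b : {a // a ≠ v}, minimalPeriod (σ.subtypePerm (p := fun a => a ≠ v) h) b = minimalPeriod σ b := by
    intro b
    exact (Semiconj.minimalPeriod_eq (g := Subtype.val) (fun _ => rfl) Subtype.val_injective b).symm
  have hv1 : minimalPeriod σ v = 1 := minimalPeriod_eq_one_iff_isFixedPt.2 hv
  rw [Finsupp.add_apply, mul_add, Equiv.Perm.mul_cycleTypeExp]
  simp_rw [hper]
  rw [Nat.card_eq_fintype_card, Nat.card_eq_fintype_card, Fintype.card_subtype,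
    Fintype.card_subtype]
  have h1 : (Finset.univ.filter fun a => minimalPeriod σ a = k) =
      ((Finset.univ.filter fun a : {a // a ≠ v} => minimalPeriod σ a = k).map
        (Embedding.subtype _)) ∪ (if k = 1 then {v} else ∅) := by
    ext a
    simp only [Finset.mem_filter, Finset.mem_univ, true_and, Finset.mem_union, Finset.mem_map,
      Embedding.subtype_apply, Subtype.exists, exists_and_right, exists_eq_right]
    by_cases ha : a = v
    · subst ha
      rw [hv1]
      by_cases hk : k = 1
      · simp [hk]
      · simp [hk, eq_comm (a := 1), PNat.coe_eq_one_iff]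
    · split_ifs <;> simp [ha]
  rw [h1, Finset.card_union_of_disjoint, Finset.card_map]
  · congr 1
    split_ifs with hk
    · subst hk; simp
    · rw [Finsupp.single_eq_of_ne hk]; simp
  · rw [Finset.disjoint_left]
    intro a ha
    simp only [Finset.mem_map, Embedding.subtype_apply, Subtype.exists] at ha
    obtain ⟨b, hb, _, rfl⟩ := ha
    split_ifs <;> simp [hb]

/-- The root of an invariant tree is unique, hence itself fixed by `σ`. -/
theorem treeCount_eq_sum [Fintype α] [DecidableEq α] (σ : Equiv.Perm α) :
    treeCount α σ = ∑ v : {v // σ v = v},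
      (Nat.card {p : α → α // EquivTree σ p ∧ p v = v} : ℚ) := by
  rw [treeCount, ← Nat.cast_sum, ← Nat.card_sigma]
  congr 1
  have h : ∀ p : {p : α → α // EquivTree σ p}, ∃ r : {v // σ v = v}, p.1 r = r := by
    rintro ⟨p, ⟨_, hc⟩, r, hr, hu⟩
    exact ⟨⟨r, hu _ (by simp only; rw [hc, hr])⟩, hr⟩
  choose r hr using h
  exact Nat.card_congr ⟨fun p => ⟨r p, p.1, p.2, hr p⟩, fun x => ⟨x.2.1, x.2.2.1⟩, fun p => rfl, by
    rintro ⟨v, p, hp, hv⟩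
    obtain rfl : r ⟨p, hp⟩ = v := Subtype.ext (hp.2.unique (hr ⟨p, hp⟩) hv)
    rfl⟩

/-- Each fixed point of `σ` is the root of equally many invariant trees, namely the number of
invariant forests on the other points. Their number is the exponent `m₁`, which is also the factor
by which `z` decreases when a fixed point is removed. -/
theorem PreLie_eq_p_mul : SymFun.PreLie = SymFun.p 1 * forestSeries := by
  classical
  refine SymFun.ext_ghost fun m => ?_
  obtain ⟨n, σ, rfl⟩ := Equiv.Perm.exists_cycleTypeExp_eq m
  rw [ghost_PreLie, treeCount_eq_sum]
  have hne : ∀ v : {v // σ v = v}, ∀ a, σ a ≠ v ↔ a ≠ v := by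
    rintro ⟨v, hv⟩ a
    rw [Ne, Ne, not_iff_not]
    constructor
    · intro h; exact σ.injective (h.trans hv.symm)
    · rintro rfl; exact hv
  have hcard : ∀ v : {v // σ v = v}, (Nat.card {p : Fin n → Fin n // EquivTree σ p ∧ p v = v} : ℚ) *
      ((σ.cycleTypeExp 1 : ℕ) : ℚ) = SymFun.ghost (SymFun.p 1 * forestSeries) σ.cycleTypeExp := by
    intro v
    have h1 := subtypePerm_ne_cycleTypeExp σ v v.2 (hne v)
    rw [card_tree_eq_forest σ v v.2 (hne v), ← forestCount, ← ghost_forestSeries, ← h1,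
      SymFun.ghost, SymFun.ghost, SymFun.zee_add_single, add_comm _ (Finsupp.single 1 1),
      SymFun.p, MvPowerSeries.X, MvPowerSeries.coeff_add_monomial_mul, Finsupp.add_apply,
      Finsupp.single_eq_same]
    push_cast
    ring
  have hfix : ((σ.cycleTypeExp 1 : ℕ) : ℚ) = Fintype.card {v // σ v = v} := by
    have := σ.mul_cycleTypeExp 1
    rw [PNat.one_coe, one_mul, Nat.card_congr (Equiv.subtypeEquivRight fun a =>
      minimalPeriod_eq_one_iff_isFixedPt), Nat.card_eq_fintype_card] at this
    rw [this]
    congr 1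
  -- Without fixed points the sum is empty, and the monomial of `σ` is not divisible by `p₁`.
  rcases isEmpty_or_nonempty {v // σ v = v} with he | ⟨⟨v⟩⟩
  · have h0 : σ.cycleTypeExp 1 = 0 := by
      rw [Fintype.card_eq_zero] at hfix
      exact_mod_cast hfix
    rw [Finset.univ_eq_empty, Finset.sum_empty, SymFun.ghost, SymFun.p,
      MvPowerSeries.X_dvd_iff.1 (dvd_mul_right _ _) _ h0, mul_zero]
  · have : Nonempty {v // σ v = v} := ⟨v⟩
    have h0 : (Fintype.card {v // σ v = v} : ℚ) ≠ 0 := Nat.cast_ne_zero.2 Fintype.card_ne_zero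
    have h1 : ∀ w : {v // σ v = v}, (Nat.card {p : Fin n → Fin n // EquivTree σ p ∧ p w = w} : ℚ) =
        SymFun.ghost (SymFun.p 1 * forestSeries) σ.cycleTypeExp / Fintype.card {v // σ v = v} := by
      intro w
      rw [← hcard w, hfix, mul_div_cancel_right₀ _ h0]
    rw [Finset.sum_congr rfl fun w _ => h1 w, Finset.sum_const, Finset.card_univ, nsmul_eq_mul,
      mul_div_cancel₀ _ h0]

end RemoveRoot

end Forests

/-! ### The Euler derivation -/

namespace SymFun

open MvPowerSeries

/-- The Euler derivation, which multiplies a series of degree `d` by `d`. -/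
noncomputable def euler : Derivation ℚ (SymFun ℚ) (SymFun ℚ) where
  toFun f := fun m => degree m * coeff m f
  map_add' f g := by
    ext m
    exact mul_add _ _ _
  map_smul' c f := by
    ext m
    exact mul_left_comm _ _ _
  map_one_eq_zero' := by
    classical
    ext m
    change (degree m : ℚ) * coeff m 1 = 0
    rw [coeff_one]
    split_ifs with h
    · rw [h, degree_zero]; simp
    · simp
  leibniz' f g := by
    classical
    ext m
    change (degree m : ℚ) * coeff m (f * g) = coeff m (f * _ + g * _)
    rw [map_add, mul_comm g, coeff_mul, coeff_mul, coeff_mul, Finset.mul_sum,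
      ← Finset.sum_add_distrib]
    refine Finset.sum_congr rfl fun x hx => ?_
    rw [Finset.HasAntidiagonal.mem_antidiagonal] at hx
    change _ = coeff x.1 f * (degree x.2 * coeff x.2 g) + degree x.1 * coeff x.1 f * coeff x.2 g
    rw [← hx, degree_add]
    push_cast
    ring

theorem coeff_euler (f : SymFun ℚ) (m : ℕ+ →₀ ℕ) : coeff m (euler f) = degree m * coeff m f := rfl

theorem ghost_euler (f : SymFun ℚ) (m : ℕ+ →₀ ℕ) : ghost (euler f) m = degree m * ghost f m := by
  rw [ghost, coeff_euler, ghost, mul_left_comm]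

/-- A series is determined by its logarithmic Euler derivative. -/
theorem eq_expOf_of_euler {a f : SymFun ℚ} (ha : constantCoeff a = 0)
    (hf : euler f = f * euler a) (hc : constantCoeff f = 1) : f = expOf a := by
  have ha' : constantCoeff (-a) = 0 := by rw [map_neg, ha, neg_zero]
  have h0 : euler (expOf (-a) * f) = 0 := by
    rw [Derivation.leibniz, derivation_expOf _ ha', hf, map_neg, smul_eq_mul, smul_eq_mul]
    ring
  have h : expOf (-a) * f = 1 := by
    ext m
    by_cases hm : m = 0
    · rw [hm, coeff_zero_eq_constantCoeff_apply, coeff_zero_eq_constantCoeff_apply, map_mul, hc,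
        constantCoeff_expOf ha', map_one, mul_one]
    · have h1 := congrArg (coeff m) h0
      rw [coeff_euler, map_zero, mul_eq_zero, Nat.cast_eq_zero] at h1
      classical
      rw [h1.resolve_left fun h => hm (degree_eq_zero h), coeff_one, if_neg hm]
  calc f = expOf (-a) * expOf a * f := by rw [expOf_neg_mul ha, one_mul]
    _ = expOf a * (expOf (-a) * f) := by ring
    _ = expOf a := by rw [h, mul_one]

end SymFun

/-! ### Invariant forests with a marked point -/

section Splitting

variable {α : Type}

/-- The forest is the union of a forest on the points with `P` and one on the other points, and
the permutation is transitive on the roots with `P`. -/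
def Splits (σ : Equiv.Perm α) (p : α → α) (P : α → Prop) : Prop :=
  (∀ a, P (p a) ↔ P a) ∧ ∀ r s, P r → P s → p r = r → p s = s → σ.SameCycle r s

/-- The parent map preserves the points with `P` and the others, so it is a pair of restrictions;
the condition on roots concerns only the first of them. -/
theorem card_splits (σ : Equiv.Perm α) (P : α → Prop) (hP : ∀ a, P (σ a) ↔ P a)
    (hP' : ∀ a, ¬P (σ a) ↔ ¬P a) :
    Nat.card {p : α → α // EquivForest σ p ∧ Splits σ p P} =
      Nat.card {q : {a // P a} → {a // P a} // TransForest (σ.subtypePerm hP) q} *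
      Nat.card {q : {a // ¬P a} → {a // ¬P a} //
        EquivForest (σ.subtypePerm (p := fun a => ¬P a) hP') q} := by
  classical
  let F : ∀ (Q : α → Prop) (p : α → α), (∀ a, Q (p a) ↔ Q a) → {a // Q a} → {a // Q a} :=
    fun Q p h a => ⟨p a, (h a).2 a.2⟩
  have hF : ∀ (Q : α → Prop) (hQ : ∀ a, Q (σ a) ↔ Q a) (p : α → α) (h : ∀ a, Q (p a) ↔ Q a),
      EquivForest σ p → EquivForest (σ.subtypePerm hQ) (F Q p h) := by
    intro Q hQ p h hp
    exact ⟨fun a => (exists_fixed_iterate_iff Subtype.val_injective (fun _ => rfl) a).2 (hp.1 a),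
      fun a => Subtype.ext (hp.2 a)⟩
  let G : ({a // P a} → {a // P a}) → ({a // ¬P a} → {a // ¬P a}) → α → α := fun q r a =>
    if h : P a then q ⟨a, h⟩ else r ⟨a, h⟩
  have hG1 : ∀ q r (a : {a // P a}), G q r a = q a := fun q r a => dif_pos a.2
  have hG2 : ∀ q r (a : {a // ¬P a}), G q r a = r a := fun q r a => dif_neg a.2
  have hGP : ∀ q r a, P (G q r a) ↔ P a := by
    intro q r a
    by_cases h : P a
    · exact iff_of_true ((hG1 q r ⟨a, h⟩).symm ▸ (q ⟨a, h⟩).2) h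
    · exact iff_of_false ((hG2 q r ⟨a, h⟩).symm ▸ (r ⟨a, h⟩).2) h
  have hG : ∀ q r, TransForest (σ.subtypePerm hP) q →
      EquivForest (σ.subtypePerm (p := fun a => ¬P a) hP') r →
      EquivForest σ (G q r) ∧ Splits σ (G q r) P := by
    rintro q r ⟨hq, hq'⟩ hr
    refine ⟨⟨fun a => ?_, fun a => ?_⟩, hGP q r, fun a b ha hb h1 h2 => ?_⟩
    · by_cases h : P a
      · exact (exists_fixed_iterate_iff Subtype.val_injective
          (fun b => (hG1 q r b).symm) ⟨a, h⟩).1 (hq.1 _)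
      · exact (exists_fixed_iterate_iff Subtype.val_injective
          (fun b => (hG2 q r b).symm) ⟨a, h⟩).1 (hr.1 _)
    · by_cases h : P a
      · rw [hG1 q r ⟨a, h⟩]
        exact (hG1 q r ⟨σ a, (hP a).2 h⟩).trans (Subtype.ext_iff.1 (hq.2 ⟨a, h⟩))
      · rw [hG2 q r ⟨a, h⟩]
        exact (hG2 q r ⟨σ a, (hP' a).2 h⟩).trans (Subtype.ext_iff.1 (hr.2 ⟨a, h⟩))
    · have h3 := hq' ⟨a, ha⟩ ⟨b, hb⟩ (Subtype.ext ((hG1 q r ⟨a, ha⟩).symm.trans h1))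
        (Subtype.ext ((hG1 q r ⟨b, hb⟩).symm.trans h2))
      exact Equiv.Perm.sameCycle_subtypePerm.1 h3
  rw [← Nat.card_prod]
  refine Nat.card_congr ⟨fun p => (⟨F P p.1 p.2.2.1, hF _ hP _ p.2.2.1 p.2.1, fun r s hr hs => ?_⟩,
      ⟨F (fun a => ¬P a) p.1 fun a => not_congr (p.2.2.1 a), hF _ hP' _ (fun a => not_congr (p.2.2.1 a)) p.2.1⟩),
    fun x => ⟨G x.1.1 x.2.1, hG _ _ x.1.2 x.2.2⟩, fun p => ?_, fun x => ?_⟩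
  · exact Equiv.Perm.sameCycle_subtypePerm.2
      (p.2.2.2 r s r.2 s.2 (Subtype.ext_iff.1 hr) (Subtype.ext_iff.1 hs))
  · refine Subtype.ext (funext fun a => ?_)
    by_cases h : P a
    · exact hG1 _ _ ⟨a, h⟩
    · exact hG2 _ _ ⟨a, h⟩
  · refine Prod.ext (Subtype.ext (funext fun a => Subtype.ext ?_))
      (Subtype.ext (funext fun a => Subtype.ext ?_))
    · exact hG1 _ _ a
    · exact hG2 _ _ a

/-- All fixed iterates of a point coincide, which makes the root well defined and compatible with
`p` and `σ`. -/
theorem EquivForest.exists_root {σ : Equiv.Perm α} {p : α → α} (hp : EquivForest σ p) :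
    ∃ root : α → α, (∀ a, p (root a) = root a) ∧ (∀ a, root (p a) = root a) ∧
      (∀ a, p a = a → root a = a) ∧ (∀ a, root (σ a) = σ (root a)) ∧
      ∀ a, ∃ n, root a = p^[n] a := by
  obtain ⟨hf, hc⟩ := hp
  choose n hn using hf
  have hu : ∀ a k l, p (p^[k] a) = p^[k] a → p (p^[l] a) = p^[l] a → p^[k] a = p^[l] a := by
    intro a k l hk hl
    have h1 : p^[l + k] a = p^[k] a := by rw [iterate_add_apply]; exact iterate_fixed hk l
    have h2 : p^[k + l] a = p^[l] a := by rw [iterate_add_apply]; exact iterate_fixed hl k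
    rw [← h1, ← h2, add_comm]
  refine ⟨fun a => p^[n a] a, hn, fun a => hu a (n (p a) + 1) (n a) (hn (p a)) (hn a),
    fun a ha => iterate_fixed ha _, fun a => ?_, fun a => ⟨n a, rfl⟩⟩
  have hs : Semiconj σ p p := fun a => (hc a).symm
  have h1 : σ (p^[n a] a) = p^[n a] (σ a) := (hs.iterate_right (n a)).eq a
  rw [h1]
  refine hu (σ a) (n (σ a)) (n a) (hn _) ?_
  rw [← h1, hc, hn]

/-- The set consists of the cycles of the points whose root lies in the cycle of the root of `v`. It
is forced, since closure under parents reduces membership of a point to that of its root. -/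
theorem existsUnique_splits [Finite α] {σ : Equiv.Perm α} {p : α → α} (hp : EquivForest σ p)
    (v : α) : ∃! t : Finset σ.Cycles, Quotient.mk (Equiv.Perm.SameCycle.setoid σ) v ∈ t ∧
      Splits σ p fun a => Quotient.mk (Equiv.Perm.SameCycle.setoid σ) a ∈ t := by
  classical
  obtain ⟨root, hroot, hrp, hrfix, hcomm, hiter⟩ := hp.exists_root
  have hcycle : ∀ a b, σ.SameCycle a b → σ.SameCycle (root a) (root b) := by
    intro a b h
    obtain ⟨i, rfl⟩ := h.exists_nat_pow_eq
    have hs : Semiconj root σ σ := hcomm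
    rw [← Equiv.Perm.iterate_eq_pow, (hs.iterate_right i).eq, Equiv.Perm.iterate_eq_pow]
    exact Equiv.Perm.sameCycle_pow_right.2 (Equiv.Perm.SameCycle.refl _ _)
  refine ⟨Finset.univ.filter fun o => ∃ a, Quotient.mk (Equiv.Perm.SameCycle.setoid σ) a = o ∧
    σ.SameCycle (root a) (root v), ?_, ?_⟩
  · have hmem : ∀ a, (Quotient.mk (Equiv.Perm.SameCycle.setoid σ) a ∈
        Finset.univ.filter fun o => ∃ a, Quotient.mk (Equiv.Perm.SameCycle.setoid σ) a = o ∧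
        σ.SameCycle (root a) (root v)) ↔ σ.SameCycle (root a) (root v) := by
      intro a
      rw [Finset.mem_filter]
      constructor
      · rintro ⟨_, b, hb, h⟩
        exact (hcycle _ _ (Quotient.eq.1 hb).symm).trans h
      · exact fun h => ⟨Finset.mem_univ _, a, rfl, h⟩
    simp only [Splits, hmem]
    refine ⟨Equiv.Perm.SameCycle.refl _ _, fun a => by rw [hrp], fun r s hr hs h1 h2 => ?_⟩
    rw [hrfix r h1] at hr
    rw [hrfix s h2] at hs
    exact hr.trans hs.symm
  · rintro t ⟨hv, h1, h2⟩
    have hit : ∀ a, Quotient.mk (Equiv.Perm.SameCycle.setoid σ) (root a) ∈ t ↔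
        Quotient.mk (Equiv.Perm.SameCycle.setoid σ) a ∈ t := by
      intro a
      have h3 : ∀ k, Quotient.mk (Equiv.Perm.SameCycle.setoid σ) (p^[k] a) ∈ t ↔
          Quotient.mk (Equiv.Perm.SameCycle.setoid σ) a ∈ t := by
        intro k
        induction k with
        | zero => rfl
        | succ k ih => rw [iterate_succ_apply', ← ih]; exact h1 _
      obtain ⟨k, hk⟩ := hiter a
      rw [hk]
      exact h3 k
    ext o
    rw [Finset.mem_filter]
    constructor
    · induction o using Quotient.inductionOn with
      | h a =>
        intro ha
        exact ⟨Finset.mem_univ _, a, rfl, h2 _ _ ((hit a).2 ha) ((hit v).2 hv) (hroot a) (hroot v)⟩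
    · rintro ⟨_, a, rfl, h⟩
      rw [← hit, Quotient.sound (s := Equiv.Perm.SameCycle.setoid σ) h, hit]
      exact hv

theorem subtypePerm_cycleTypeExp [Finite α] (σ : Equiv.Perm α) (P : α → Prop)
    (hP : ∀ a, P (σ a) ↔ P a) (t : Finset σ.Cycles)
    (h : ∀ a, P a ↔ Quotient.mk (Equiv.Perm.SameCycle.setoid σ) a ∈ t) :
    (σ.subtypePerm hP).cycleTypeExp =
      ∑ o ∈ t, Finsupp.single (Equiv.Perm.Cycles.length o) 1 := by
  refine (Equiv.Perm.eq_cycleTypeExp fun k => ?_).symm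
  rw [Equiv.Perm.mul_sum_single_apply]
  refine Nat.card_congr ((Equiv.subtypeEquivRight fun a => ?_).trans
    (Equiv.subtypeSubtypeEquivSubtypeInter P fun a => minimalPeriod σ a = k).symm |>.trans
    (Equiv.subtypeEquivRight fun a => ?_))
  · rw [h]
  · rw [Function.Semiconj.minimalPeriod_eq (g := Subtype.val) (f := σ.subtypePerm hP) (f' := σ)
      (fun _ => rfl) Subtype.val_injective a]

/-- Double count of pairs of an invariant forest and a marked point. The point singles out the
`σ`-orbit of its tree, a forest with transitively permuted roots in which it is marked; the other
trees form any invariant forest. Summation over the set of cycles covered by that orbit is the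
product rule `ghost_mul`. -/
theorem degree_mul_forestCount [Fintype α] (σ : Equiv.Perm α) {T : SymFun ℚ}
    (hT : ∀ (β : Type) [Finite β] (τ : Equiv.Perm β),
      SymFun.ghost T τ.cycleTypeExp = Nat.card β * transForestCount β τ) :
    (Nat.card α : ℚ) * forestCount α σ = SymFun.ghost (T * forestSeries) σ.cycleTypeExp := by
  classical
  have hinv : ∀ (t : Finset σ.Cycles) a, Quotient.mk (Equiv.Perm.SameCycle.setoid σ) (σ a) ∈ t ↔
      Quotient.mk (Equiv.Perm.SameCycle.setoid σ) a ∈ t := by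
    intro t a
    rw [Quotient.sound (s := Equiv.Perm.SameCycle.setoid σ) (a := σ a) (b := a)]
    exact Equiv.Perm.sameCycle_apply_left.2 (Equiv.Perm.SameCycle.refl _ _)
  let N : Finset σ.Cycles → ℚ := fun t => Nat.card {p : α → α // EquivForest σ p ∧
    Splits σ p fun a => Quotient.mk (Equiv.Perm.SameCycle.setoid σ) a ∈ t}
  have hN : ∀ t, (Nat.card {a // Quotient.mk (Equiv.Perm.SameCycle.setoid σ) a ∈ t} : ℚ) * N t =
      SymFun.ghost T (∑ o ∈ t, Finsupp.single (Equiv.Perm.Cycles.length o) 1) *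
        SymFun.ghost forestSeries
          (∑ o ∈ Finset.univ \ t, Finsupp.single (Equiv.Perm.Cycles.length o) 1) := by
    intro t
    rw [← subtypePerm_cycleTypeExp σ _ (hinv t) t fun a => Iff.rfl,
      ← subtypePerm_cycleTypeExp σ (fun a => ¬ Quotient.mk (Equiv.Perm.SameCycle.setoid σ) a ∈ t)
        (fun a => not_congr (hinv t a)) (Finset.univ \ t) fun a => by simp,
      hT, ghost_forestSeries, mul_assoc]
    congr 1
    change ((Nat.card _ : ℕ) : ℚ) = _
    rw [card_splits σ _ (hinv t) fun a => not_congr (hinv t a), Nat.cast_mul]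
    rfl
  have hv : ∀ v, forestCount α σ =
      ∑ t : Finset σ.Cycles, if Quotient.mk (Equiv.Perm.SameCycle.setoid σ) v ∈ t then N t else 0 := by
    intro v
    rw [← Finset.sum_filter, Finset.sum_subtype _ (p := fun t : Finset σ.Cycles =>
      Quotient.mk (Equiv.Perm.SameCycle.setoid σ) v ∈ t) (fun t => by simp), ← Nat.cast_sum,
      ← Nat.card_sigma, forestCount]
    congr 1
    have h := fun p : {p : α → α // EquivForest σ p} => existsUnique_splits p.2 v
    choose t ht hu using h
    refine Nat.card_congr ⟨fun p => ⟨⟨t p, (ht p).1⟩, p.1, p.2, (ht p).2⟩,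
      fun x => ⟨x.2.1, x.2.2.1⟩, fun p => rfl, ?_⟩
    rintro ⟨⟨s, hs⟩, p, hp, hsp⟩
    obtain rfl := hu ⟨p, hp⟩ s ⟨hs, hsp⟩
    rfl
  rw [Nat.card_eq_fintype_card, ← nsmul_eq_mul, ← Finset.card_univ, ← Finset.sum_const,
    Finset.sum_congr rfl fun v _ => hv v, Finset.sum_comm, Equiv.Perm.cycleTypeExp,
    SymFun.ghost_mul, Finset.powerset_univ]
  refine Finset.sum_congr rfl fun t _ => ?_
  rw [← hN, ← Finset.sum_filter, Finset.sum_const, nsmul_eq_mul, Nat.card_eq_fintype_card,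
    Fintype.card_subtype]

end Splitting

/-! ### Gradings by `ℤ/d` and the plethysm by `p_d` -/

section Grading

variable {α : Type} {d : ℕ}

/-- A grading of the points by `ℤ/d` for which a permutation has degree one. -/
def IsGrading (σ : Equiv.Perm α) (φ : α → ZMod d) : Prop := ∀ a, φ (σ a) = φ a + 1

namespace IsGrading

variable {σ : Equiv.Perm α} {φ : α → ZMod d}

theorem apply_pow (h : IsGrading σ φ) (n : ℕ) (a : α) : φ ((σ ^ n) a) = φ a + n := by
  induction n with
  | zero => simp
  | succ n ih => rw [pow_succ', Equiv.Perm.mul_apply, h, ih]; push_cast; ring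

theorem zero_iff (h : IsGrading σ φ) (a : α) : φ ((σ ^ d) a) = 0 ↔ φ a = 0 := by
  rw [h.apply_pow, ZMod.natCast_self, add_zero]

/-- The power of the permutation on the points of degree zero. -/
abbrev zeroPerm (h : IsGrading σ φ) : Equiv.Perm {a // φ a = 0} := (σ ^ d).subtypePerm h.zero_iff

theorem exists_pow_eq [NeZero d] (h : IsGrading σ φ) (a : α) :
    ∃ b : {b // φ b = 0}, (σ ^ (φ a).val) b = a := by
  refine ⟨⟨(σ ^ (φ a).val)⁻¹ a, ?_⟩, by simp⟩
  have h1 := h.apply_pow (φ a).val ((σ ^ (φ a).val)⁻¹ a)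
  rw [← Equiv.Perm.mul_apply, mul_inv_cancel, Equiv.Perm.one_apply, ZMod.natCast_zmod_val] at h1
  exact left_eq_add.1 (h1.trans (add_comm _ _))

theorem dvd_minimalPeriod (h : IsGrading σ φ) (a : α) : d ∣ minimalPeriod σ a := by
  have h1 := h.apply_pow (minimalPeriod σ a) a
  rw [← Equiv.Perm.iterate_eq_pow, iterate_minimalPeriod] at h1
  exact (ZMod.natCast_eq_zero_iff _ _).1 (left_eq_add.1 h1)

/-- The difference of two gradings is constant on cycles, and any function of the cycles can be
added to a grading. -/
theorem card_eq [Finite α] (h : IsGrading σ φ) [NeZero d] :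
    Nat.card {ψ : α → ZMod d // IsGrading σ ψ} = d ^ Fintype.card σ.Cycles := by
  have hinv : ∀ ψ : {ψ : α → ZMod d // IsGrading σ ψ}, ∀ a b, σ.SameCycle a b →
      ψ.1 a - φ a = ψ.1 b - φ b := by
    intro ψ a b hab
    obtain ⟨i, rfl⟩ := hab.exists_nat_pow_eq
    rw [ψ.2.apply_pow, h.apply_pow]
    ring
  rw [Nat.card_congr (β := σ.Cycles → ZMod d)
    ⟨fun ψ => Quotient.lift (s := Equiv.Perm.SameCycle.setoid σ) (fun a => ψ.1 a - φ a) (hinv ψ),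
    fun f => ⟨fun a => φ a + f (Quotient.mk _ a), fun a => ?_⟩, fun ψ => ?_, fun f => ?_⟩]
  · rw [Nat.card_fun, Nat.card_zmod, Nat.card_eq_fintype_card]
  · simp only
    rw [h, Quotient.sound (s := Equiv.Perm.SameCycle.setoid σ) (a := σ a) (b := a)
      (Equiv.Perm.sameCycle_apply_left.2 (Equiv.Perm.SameCycle.refl _ _))]
    ring
  · refine Subtype.ext (funext fun a => ?_)
    exact add_sub_cancel _ _
  · funext o
    induction o using Quotient.inductionOn with
    | h a => exact add_sub_cancel_left _ _

end IsGrading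

theorem natCast_eq_of_pow_eq {σ : Equiv.Perm α} {x : α} (hx : d ∣ minimalPeriod σ x) {i j : ℕ}
    (h : (σ ^ i) x = (σ ^ j) x) : (i : ZMod d) = j := by
  wlog hij : i ≤ j generalizing i j
  · exact (this h.symm (le_of_not_ge hij)).symm
  obtain ⟨k, rfl⟩ := Nat.exists_eq_add_of_le hij
  rw [pow_add, Equiv.Perm.mul_apply, (σ ^ i).injective.eq_iff, ← Equiv.Perm.iterate_eq_pow] at h
  have hk : minimalPeriod σ x ∣ k := IsPeriodicPt.minimalPeriod_dvd h.symm
  rw [Nat.cast_add, (ZMod.natCast_eq_zero_iff _ _).2 (hx.trans hk), add_zero]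

/-- The degree is the number of steps from a chosen point of the cycle, well defined modulo `d`
because `d` divides the length. -/
theorem exists_isGrading [Finite α] {σ : Equiv.Perm α} (h : ∀ a, d ∣ minimalPeriod σ a) :
    ∃ φ : α → ZMod d, IsGrading σ φ := by
  have h1 : ∀ a, ∃ n : ℕ, (σ ^ n) (Quotient.mk (Equiv.Perm.SameCycle.setoid σ) a).out = a :=
    fun a => Equiv.Perm.SameCycle.exists_nat_pow_eq
      (Quotient.exact (s := Equiv.Perm.SameCycle.setoid σ) (Quotient.out_eq _))
  choose n hn using h1
  refine ⟨fun a => n a, fun a => ?_⟩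
  have h2 := hn (σ a)
  rw [Quotient.sound (s := Equiv.Perm.SameCycle.setoid σ) (a := σ a) (b := a)
      (Equiv.Perm.sameCycle_apply_left.2 (Equiv.Perm.SameCycle.refl _ _))] at h2
  have h3 := natCast_eq_of_pow_eq (h _) (j := n a + 1) (h2.trans (by
    rw [pow_succ', Equiv.Perm.mul_apply, hn]))
  simp only
  rw [h3]
  push_cast
  rfl

/-- A cycle of length `d k` has `k` points in each degree, and `σ ^ d` permutes those of degree zero
in one cycle. -/
theorem IsGrading.card_minimalPeriod [Finite α] [NeZero d] {σ : Equiv.Perm α} {φ : α → ZMod d}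
    (h : IsGrading σ φ) (k : ℕ) :
    Nat.card {a // minimalPeriod σ a = d * k} =
      d * Nat.card {b : {b // φ b = 0} // minimalPeriod h.zeroPerm b = k} := by
  have hd : 0 < d := Nat.pos_of_ne_zero (NeZero.ne d)
  have hmp : ∀ b : {b // φ b = 0}, d * minimalPeriod h.zeroPerm b = minimalPeriod σ b := by
    intro b
    have h1 := h.dvd_minimalPeriod b.1
    rw [← Function.Semiconj.minimalPeriod_eq (g := Subtype.val) (f := h.zeroPerm) (f' := σ ^ d)
      (fun _ => rfl) Subtype.val_injective b, ← Equiv.Perm.iterate_eq_pow,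
      minimalPeriod_iterate_eq_div_gcd hd.ne', Nat.gcd_eq_right h1, Nat.mul_div_cancel' h1]
  have hpow : ∀ (n : ℕ) a, minimalPeriod σ ((σ ^ n) a) = minimalPeriod σ a := fun n a =>
    Equiv.Perm.SameCycle.minimalPeriod_eq
      (Equiv.Perm.sameCycle_pow_left.2 (Equiv.Perm.SameCycle.refl _ _))
  choose b hb using h.exists_pow_eq
  have hval : ∀ (i : ZMod d) (c : {b // φ b = 0}), φ ((σ ^ i.val) c) = i := by
    intro i c
    rw [h.apply_pow, c.2, zero_add, ZMod.natCast_zmod_val]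
  refine Eq.trans ?_ (congrArg (· * _) (Nat.card_zmod d))
  rw [← Nat.card_prod]
  refine Nat.card_congr ⟨fun a => (φ a, ⟨b a, ?_⟩), fun x => ⟨(σ ^ x.1.val) x.2.1, ?_⟩,
    fun a => Subtype.ext (hb a), fun x => ?_⟩
  · refine Nat.eq_of_mul_eq_mul_left hd ?_
    rw [hmp, ← hpow (φ a).val, hb, a.2]
  · rw [hpow, ← hmp, x.2.2]
  · refine Prod.ext (hval _ _) (Subtype.ext (Subtype.ext ?_))
    have h1 := hb ((σ ^ x.1.val) x.2.1)
    rw [hval] at h1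
    exact (σ ^ x.1.val).injective h1

theorem IsGrading.embDomain_cycleTypeExp [Finite α] {d : ℕ+} {σ : Equiv.Perm α} {φ : α → ZMod d}
    (h : IsGrading σ φ) :
    h.zeroPerm.cycleTypeExp.embDomain (SymFun.mulEmb d) = σ.cycleTypeExp := by
  refine Equiv.Perm.eq_cycleTypeExp fun k => ?_
  by_cases hk : ∃ j, SymFun.mulEmb d j = k
  · obtain ⟨j, rfl⟩ := hk
    rw [Finsupp.embDomain_apply_self, SymFun.mulEmb_apply, PNat.mul_coe, h.card_minimalPeriod,
      mul_assoc, Equiv.Perm.mul_cycleTypeExp]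
  · rw [Finsupp.embDomain_of_notMem_range _ _ _ hk, mul_zero]
    have : IsEmpty {a // minimalPeriod σ a = k} := by
      refine ⟨fun a => ?_⟩
      obtain ⟨j, hj⟩ := h.dvd_minimalPeriod a.1
      rw [a.2] at hj
      have hj0 : 0 < j := Nat.pos_of_ne_zero fun h0 => k.ne_zero (by rw [hj, h0, mul_zero])
      exact hk ⟨⟨j, hj0⟩, PNat.coe_inj.1 hj.symm⟩
    rw [Nat.card_of_isEmpty]

/-- The power of `d` is matched by the number of gradings in `IsGrading.card_eq`. -/
theorem SymFun.zee_embDomain (d : ℕ+) (m : ℕ+ →₀ ℕ) :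
    SymFun.zee (m.embDomain (SymFun.mulEmb d)) = (d : ℚ) ^ SymFun.length m * SymFun.zee m := by
  rw [SymFun.zee, SymFun.zee, Finsupp.prod_embDomain, SymFun.length, Finsupp.prod, Finsupp.prod,
    Finsupp.sum, ← Finset.prod_pow_eq_pow_sum, ← Finset.prod_mul_distrib]
  refine Finset.prod_congr rfl fun k _ => ?_
  rw [SymFun.mulEmb_apply, PNat.mul_coe]
  push_cast
  ring

theorem Equiv.Perm.length_cycleTypeExp [Finite α] (σ : Equiv.Perm α) :
    SymFun.length σ.cycleTypeExp = Fintype.card σ.Cycles := by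
  classical
  rw [cycleTypeExp]
  have h : ∀ s : Finset σ.Cycles,
      SymFun.length (∑ o ∈ s, Finsupp.single (Cycles.length o) 1) = s.card := by
    intro s
    induction s using Finset.induction_on with
    | empty => exact SymFun.length_zero
    | insert a s ha ih =>
      rw [Finset.sum_insert ha, SymFun.length_add, SymFun.length_single, ih,
        Finset.card_insert_of_notMem ha, add_comm]
  exact h _

/-- The pairs of a grading and a tree on the points of degree zero. -/
theorem sum_treeCount_zeroPerm [Finite α] (d : ℕ+) (σ : Equiv.Perm α) :
    (Nat.card (Σ φ : {φ : α → ZMod d // IsGrading σ φ},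
      {q : {a // φ.1 a = 0} → {a // φ.1 a = 0} // EquivTree φ.2.zeroPerm q}) : ℚ) =
      SymFun.ghost (SymFun.frob d SymFun.PreLie) σ.cycleTypeExp := by
  classical
  have := Fintype.ofFinite α
  have := Fintype.ofFinite {φ : α → ZMod d // IsGrading σ φ}
  rcases isEmpty_or_nonempty {φ : α → ZMod d // IsGrading σ φ} with he | ⟨⟨φ, hφ⟩⟩
  -- If the monomial of `σ` came from one under `p_j ↦ p_{d j}`, then `d` would divide all cycle
  -- lengths and a grading would exist.
  · rw [Nat.card_of_isEmpty, Nat.cast_zero, SymFun.ghost, SymFun.coeff_frob_eq_zero, mul_zero]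
    intro n hn
    refine he.elim' ?_
    have h : ∀ a, (d : ℕ) ∣ minimalPeriod σ a := by
      intro a
      have h1 := σ.mul_cycleTypeExp (σ.cycleLength a)
      have h2 : Nat.card {b // minimalPeriod σ b = σ.cycleLength a} ≠ 0 :=
        Nat.card_ne_zero.2 ⟨⟨a, rfl⟩, inferInstance⟩
      rw [← h1, ← hn] at h2
      by_contra h3
      refine h2 ?_
      rw [Finsupp.embDomain_of_notMem_range, mul_zero]
      rintro ⟨j, hj⟩
      exact h3 ⟨j, congrArg PNat.val hj.symm⟩
    exact ⟨_, (exists_isGrading h).choose_spec⟩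
  · have h1 : ∀ ψ : {φ : α → ZMod d // IsGrading σ φ},
        (Nat.card {q : {a // ψ.1 a = 0} → {a // ψ.1 a = 0} // EquivTree ψ.2.zeroPerm q} : ℚ) =
        SymFun.ghost SymFun.PreLie hφ.zeroPerm.cycleTypeExp := by
      intro ψ
      rw [← treeCount, ← ghost_PreLie]
      congr 1
      refine Finsupp.embDomain_injective (SymFun.mulEmb d) ?_
      rw [ψ.2.embDomain_cycleTypeExp, hφ.embDomain_cycleTypeExp]
    have h2 := hφ.embDomain_cycleTypeExp
    rw [Nat.card_sigma, Nat.cast_sum, Finset.sum_congr rfl fun ψ _ => h1 ψ, Finset.sum_const,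
      Finset.card_univ, ← Nat.card_eq_fintype_card, hφ.card_eq, nsmul_eq_mul, ← h2, SymFun.ghost,
      SymFun.ghost, SymFun.coeff_frob, SymFun.zee_embDomain, ← SymFun.length_embDomain d, h2,
      Equiv.Perm.length_cycleTypeExp]
    push_cast
    ring

end Grading

/-! ### Forests with transitively permuted roots; the functional equation of `PreLie` -/

section GradedForest

variable {α : Type} {d : ℕ}

/-- A grading is compatible with a forest if it is constant on its trees and if there is just one
root of degree zero. -/
def IsForestGrading (p : α → α) (φ : α → ZMod d) : Prop :=
  (∀ a, φ (p a) = φ a) ∧ ∃! r, p r = r ∧ φ r = 0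

/-- The map is carried from degree zero to degree `i` by `σ ^ i`; going round once is consistent
because `q` commutes with `σ ^ d`. -/
theorem IsGrading.exists_glue [NeZero d] {σ : Equiv.Perm α} {φ : α → ZMod d} (h : IsGrading σ φ)
    {q : {a // φ a = 0} → {a // φ a = 0}} (hq : ∀ a, q (h.zeroPerm a) = h.zeroPerm (q a)) :
    ∃ p : α → α, ∀ (n : ℕ) (b : {a // φ a = 0}), p ((σ ^ n) b) = (σ ^ n) (q b) := by
  choose b hb using h.exists_pow_eq
  refine ⟨fun a => (σ ^ (φ a).val) (q (b a)), fun n => ?_⟩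
  induction n using Nat.strong_induction_on with
  | _ n ih =>
    intro c
    by_cases hn : n < d
    · have h1 : (φ ((σ ^ n) c)).val = n := by
        rw [h.apply_pow, c.2, zero_add, ZMod.val_natCast, Nat.mod_eq_of_lt hn]
      have h2 := hb ((σ ^ n) c)
      simp only
      rw [h1] at h2 ⊢
      rw [Subtype.ext ((σ ^ n).injective h2)]
    · have hd : 0 < d := Nat.pos_of_ne_zero (NeZero.ne d)
      obtain ⟨m, rfl⟩ := Nat.exists_eq_add_of_le' (not_lt.1 hn)
      have h1 := ih m (by omega) (h.zeroPerm c)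
      rw [hq] at h1
      rw [pow_add]
      exact h1

/-- Equivariance determines the forest by its part of degree zero, and this part is a tree because
it has one root. -/
theorem IsGrading.card_forest [NeZero d] {σ : Equiv.Perm α} {φ : α → ZMod d} (h : IsGrading σ φ) :
    Nat.card {p : α → α // EquivForest σ p ∧ IsForestGrading p φ} =
      Nat.card {q : {a // φ a = 0} → {a // φ a = 0} // EquivTree h.zeroPerm q} := by
  have hpow : ∀ p : α → α, (∀ a, p (σ a) = σ (p a)) → ∀ (n : ℕ) a,
      p ((σ ^ n) a) = (σ ^ n) (p a) := by
    intro p hp n a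
    have hs : Semiconj p σ σ := hp
    rw [← Equiv.Perm.iterate_eq_pow, (hs.iterate_right n).eq]
  have hF : ∀ p : {p : α → α // EquivForest σ p ∧ IsForestGrading p φ},
      EquivTree h.zeroPerm fun a => ⟨p.1 a, (p.2.2.1 a).trans a.2⟩ := by
    rintro ⟨p, ⟨hf, hc⟩, hφ, r, hr, hu⟩
    let F : {a // φ a = 0} → {a // φ a = 0} := fun a => ⟨p a, (hφ a).trans a.2⟩
    refine ⟨⟨fun a => (exists_fixed_iterate_iff (q := F) (p := p) Subtype.val_injective
        (fun _ => rfl) a).2 (hf a),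
      fun a => Subtype.ext (hpow p hc d a)⟩, ⟨r, hr.2⟩, Subtype.ext hr.1, fun s hs => ?_⟩
    exact Subtype.ext (hu s ⟨Subtype.ext_iff.1 hs, s.2⟩)
  refine Nat.card_congr (Equiv.ofBijective (fun p => ⟨_, hF p⟩) ⟨fun p p' hpp => ?_, ?_⟩)
  · refine Subtype.ext (funext fun a => ?_)
    obtain ⟨b, hb⟩ := h.exists_pow_eq a
    rw [← hb, hpow _ p.2.1.2, hpow _ p'.2.1.2]
    exact congrArg _ (Subtype.ext_iff.1 (congrFun (Subtype.ext_iff.1 hpp) b))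
  · rintro ⟨q, ⟨hf, hc⟩, r, hr, hu⟩
    obtain ⟨p, hp⟩ := h.exists_glue hc
    have h0 : ∀ b : {a // φ a = 0}, p b = q b := hp 0
    have hforest : EquivForest σ p := by
      refine ⟨fun a => ?_, fun a => ?_⟩
      · obtain ⟨b, hb⟩ := h.exists_pow_eq a
        rw [← hb]
        exact (exists_fixed_iterate_iff (g := fun c : {a // φ a = 0} => (σ ^ (φ a).val) c)
          ((σ ^ (φ a).val).injective.comp Subtype.val_injective)
          (fun c => (hp (φ a).val c).symm) b).1 (hf b)
      · obtain ⟨b, hb⟩ := h.exists_pow_eq a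
        rw [← hb, hp, ← Equiv.Perm.mul_apply, ← pow_succ', hp, pow_succ', Equiv.Perm.mul_apply]
    refine ⟨⟨p, hforest, fun a => ?_, r, ⟨?_, r.2⟩, fun s hs => ?_⟩, Subtype.ext (funext fun b =>
      Subtype.ext (h0 b))⟩
    · obtain ⟨b, hb⟩ := h.exists_pow_eq a
      rw [← hb, hp, h.apply_pow, h.apply_pow, b.2, (q b).2]
    · rw [h0, hr]
    · exact Subtype.ext_iff.1 (hu ⟨s, hs.2⟩ (Subtype.ext ((h0 _).symm.trans hs.1)))

/-- `σ ^ d` preserves degrees, so it fixes the only root of degree zero. -/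
theorem IsForestGrading.minimalPeriod_eq {σ : Equiv.Perm α} {p : α → α} {φ : α → ZMod d}
    (hp : EquivForest σ p) (hg : IsGrading σ φ) (hφ : IsForestGrading p φ) {r : α} (hr : p r = r)
    (hr0 : φ r = 0) : minimalPeriod σ r = d := by
  refine Nat.dvd_antisymm ?_ (hg.dvd_minimalPeriod r)
  refine IsPeriodicPt.minimalPeriod_dvd ?_
  refine hφ.2.unique ⟨?_, ?_⟩ ⟨hr, hr0⟩
  · have hs : Semiconj p σ σ := hp.2
    rw [(hs.iterate_right d).eq, hr]
  · rw [Equiv.Perm.iterate_eq_pow, hg.zero_iff, hr0]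

/-- A compatible grading amounts to the choice of its root of degree zero: the degree of a point is
the number of steps of `σ` from that root to the root of its tree. -/
theorem card_rooted_transForest [Finite α] [NeZero d] (σ : Equiv.Perm α) :
    Nat.card (Σ φ : {φ : α → ZMod d // IsGrading σ φ},
      {p : α → α // EquivForest σ p ∧ IsForestGrading p φ.1}) =
      Nat.card {x : (α → α) × α // TransForest σ x.1 ∧ x.1 x.2 = x.2 ∧ minimalPeriod σ x.2 = d} := by
  have hr : ∀ x : Σ φ : {φ : α → ZMod d // IsGrading σ φ},
      {p : α → α // EquivForest σ p ∧ IsForestGrading p φ.1}, ∃ r, (x.2.1 r = r ∧ x.1.1 r = 0) ∧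
        ∀ s, x.2.1 s = s ∧ x.1.1 s = 0 → s = r := fun x => x.2.2.2.2
  choose r hr hu using hr
  have hpow : ∀ p : α → α, (∀ a, p (σ a) = σ (p a)) → ∀ (n : ℕ) a,
      p ((σ ^ n) a) = (σ ^ n) (p a) := by
    intro p hp n a
    have hs : Semiconj p σ σ := hp
    rw [← Equiv.Perm.iterate_eq_pow, (hs.iterate_right n).eq]
  have hroots : ∀ x s, x.2.1 s = s → (σ ^ (x.1.1 s).val) (r x) = s := by
    intro x s hs
    obtain ⟨b, hb⟩ := x.1.2.exists_pow_eq s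
    have h1 : (b : α) = r x := by
      refine hu x b ⟨?_, b.2⟩
      refine (σ ^ (x.1.1 s).val).injective ?_
      rw [← hpow _ x.2.2.1.2, hb, hs]
    rw [← h1, hb]
  have hT : ∀ x : Σ φ : {φ : α → ZMod d // IsGrading σ φ},
      {p : α → α // EquivForest σ p ∧ IsForestGrading p φ.1}, TransForest σ x.2.1 := by
    intro x
    refine ⟨x.2.2.1, fun s t hs ht => ?_⟩
    rw [← hroots x s hs, ← hroots x t ht]
    exact Equiv.Perm.sameCycle_pow_left.2
      (Equiv.Perm.sameCycle_pow_right.2 (Equiv.Perm.SameCycle.refl _ _))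
  refine Nat.card_congr (Equiv.ofBijective (fun x => ⟨(x.2.1, r x), hT x, (hr x).1,
    IsForestGrading.minimalPeriod_eq x.2.2.1 x.1.2 x.2.2.2 (hr x).1 (hr x).2⟩) ⟨?_, ?_⟩)
  · intro x y hxy
    have h1 : x.2.1 = y.2.1 := congrArg Prod.fst (Subtype.ext_iff.1 hxy)
    have h2 : r x = r y := congrArg Prod.snd (Subtype.ext_iff.1 hxy)
    have h3 : x.1 = y.1 := by
      refine Subtype.ext (funext fun a => ?_)
      obtain ⟨root, h4, -, -, -, h5⟩ := x.2.2.1.exists_root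
      have h6 : ∀ z : Σ φ : {φ : α → ZMod d // IsGrading σ φ},
          {p : α → α // EquivForest σ p ∧ IsForestGrading p φ.1}, z.2.1 = x.2.1 →
          z.1.1 a = z.1.1 (root a) := by
        intro z hz
        obtain ⟨n, hn⟩ := h5 a
        rw [hn, ← hz]
        have : Semiconj z.1.1 z.2.1 id := z.2.2.2.1
        rw [(this.iterate_right n).eq, iterate_id, id]
      rw [h6 x rfl, h6 y h1.symm]
      have h7 := hroots x (root a) (h4 a)
      conv_rhs => rw [← h7, h2, y.1.2.apply_pow, (hr y).2, zero_add, ZMod.natCast_zmod_val]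
    obtain ⟨φ, p⟩ := x
    obtain ⟨ψ, q⟩ := y
    obtain rfl : φ = ψ := h3
    obtain rfl : p = q := Subtype.ext h1
    rfl
  · rintro ⟨⟨p, ρ⟩, hp, hρ, hd⟩
    simp only at hp hρ hd
    obtain ⟨root, h1, h2, h3, h4, -⟩ := hp.1.exists_root
    have h5 : ∀ a, ∃ n : ℕ, (σ ^ n) ρ = root a := fun a =>
      (hp.2 ρ (root a) hρ (h1 a)).exists_nat_pow_eq
    choose n hn using h5
    have hN : ∀ a (m : ℕ), (σ ^ m) ρ = root a → (n a : ZMod d) = m := fun a m hm =>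
      natCast_eq_of_pow_eq hd.symm.dvd ((hn a).trans hm.symm)
    have hg : IsGrading σ fun a => (n a : ZMod d) := by
      intro a
      refine (hN (σ a) (n a + 1) ?_).trans (by push_cast; rfl)
      rw [h4, ← hn a, pow_succ', Equiv.Perm.mul_apply]
    have hgf : IsForestGrading p fun a => (n a : ZMod d) := by
      refine ⟨fun a => hN _ _ ((hn a).trans (h2 a).symm), ρ, ⟨hρ, ?_⟩, fun s hs => ?_⟩
      · exact (hN ρ 0 (h3 ρ hρ).symm).trans (by simp)
      · have h6 : d ∣ n s := (ZMod.natCast_eq_zero_iff _ _).1 hs.2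
        rw [← hd] at h6
        obtain ⟨k, hk⟩ := h6
        rw [← h3 s hs.1, ← hn s, hk, ← Equiv.Perm.iterate_eq_pow]
        exact (isPeriodicPt_minimalPeriod σ ρ).mul_const k
    refine ⟨⟨⟨_, hg⟩, p, hp.1, hgf⟩, Subtype.ext (Prod.ext rfl ?_)⟩
    exact (hgf.2.unique (hr ⟨⟨_, hg⟩, p, hp.1, hgf⟩) ⟨hρ, (hN ρ 0 (h3 ρ hρ).symm).trans (by simp)⟩)

theorem coeff_logSum {g : SymFun ℚ} (hg : MvPowerSeries.constantCoeff g = 0) {N : ℕ+}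
    {m : ℕ+ →₀ ℕ} (hm : SymFun.degree m ≤ N) :
    MvPowerSeries.coeff m (SymFun.logSum g) =
      ∑ k ∈ Finset.Icc 1 N, (1 / ((k : ℕ) : ℚ)) * MvPowerSeries.coeff m (SymFun.frob k g) := by
  have h := SymFun.mem_degGE.1 (SymFun.logSum_sub_mem hg N) m (by omega)
  rw [map_sub, sub_eq_zero, map_sum] at h
  exact h

/-- The value for `p_d ∘ PreLie` counts forests with `d` transitively permuted roots, one of them
marked. The coefficient `1 / d` in `logSum` forgets the mark, and each forest occurs for just one
`d`. -/
theorem ghost_logSum_PreLie [Finite α] [Nonempty α] (σ : Equiv.Perm α) :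
    SymFun.ghost (SymFun.logSum SymFun.PreLie) σ.cycleTypeExp = transForestCount α σ := by
  classical
  have := Fintype.ofFinite α
  have h0 : MvPowerSeries.constantCoeff SymFun.PreLie = 0 := by
    rw [PreLie_eq_p_mul]
    exact SymFun.constantCoeff_p_mul _
  let N : ℕ+ := ⟨Nat.card α, Nat.card_pos⟩
  have h1 : ∀ d : ℕ+, SymFun.ghost (SymFun.frob d SymFun.PreLie) σ.cycleTypeExp =
      ∑ p : {p : α → α // TransForest σ p}, ∑ r : {r : α // p.1 r = r},
        if minimalPeriod σ r.1 = d then 1 else 0 := by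
    intro d
    have := Fintype.ofFinite {φ : α → ZMod d // IsGrading σ φ}
    rw [← sum_treeCount_zeroPerm, Nat.card_sigma,
      Finset.sum_congr rfl fun φ _ => φ.2.card_forest.symm, ← Nat.card_sigma,
      card_rooted_transForest, Nat.card_congr (β := Σ p : {p : α → α // TransForest σ p},
        {r : {r : α // p.1 r = r} // minimalPeriod σ r.1 = d})
        ⟨fun x => ⟨⟨x.1.1, x.2.1⟩, ⟨x.1.2, x.2.2.1⟩, x.2.2.2⟩,
        fun x => ⟨(x.1.1, x.2.1.1), x.1.2, x.2.1.2, x.2.2⟩, fun _ => rfl, fun _ => rfl⟩,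
      Nat.card_sigma, Nat.cast_sum]
    refine Finset.sum_congr rfl fun p _ => ?_
    rw [Finset.sum_boole, Nat.card_eq_fintype_card, Fintype.card_subtype]
  rw [SymFun.ghost, coeff_logSum h0 (N := N) (Equiv.Perm.degree_cycleTypeExp σ).le, Finset.mul_sum]
  have h2 : ∀ d : ℕ+, SymFun.zee σ.cycleTypeExp * (1 / ((d : ℕ) : ℚ) *
      MvPowerSeries.coeff σ.cycleTypeExp (SymFun.frob d SymFun.PreLie)) =
      ∑ p : {p : α → α // TransForest σ p}, ∑ r : {r : α // p.1 r = r},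
        if minimalPeriod σ r.1 = d then 1 / ((d : ℕ) : ℚ) else 0 := by
    intro d
    rw [mul_left_comm, ← SymFun.ghost, h1, Finset.mul_sum]
    refine Finset.sum_congr rfl fun p _ => ?_
    rw [Finset.mul_sum]
    refine Finset.sum_congr rfl fun r _ => ?_
    rw [mul_ite, mul_one, mul_zero]
  rw [Finset.sum_congr rfl fun d _ => h2 d, Finset.sum_comm, transForestCount,
    Nat.card_eq_fintype_card, Fintype.card_eq_sum_ones, Nat.cast_sum]
  refine Finset.sum_congr rfl fun p _ => ?_
  obtain ⟨root, hr, -⟩ := p.2.1.exists_root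
  let ρ := root (Classical.arbitrary α)
  have hρ : p.1 ρ = ρ := hr _
  have hρN : minimalPeriod σ ρ ≤ Nat.card α := by
    rw [← Equiv.Perm.card_sameCycle]
    exact Finite.card_subtype_le _
  have hmp : ∀ r : {r : α // p.1 r = r}, minimalPeriod σ r.1 = minimalPeriod σ ρ := fun r =>
    Equiv.Perm.SameCycle.minimalPeriod_eq (p.2.2 _ _ r.2 hρ)
  have hcard : Fintype.card {r : α // p.1 r = r} = minimalPeriod σ ρ := by
    rw [← Equiv.Perm.card_sameCycle, ← Nat.card_eq_fintype_card]
    refine Nat.card_congr (Equiv.subtypeEquivRight fun r => ⟨fun h => p.2.2 _ _ h hρ, fun h => ?_⟩)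
    obtain ⟨i, rfl⟩ := h.symm.exists_nat_pow_eq
    have hs : Semiconj p.1 σ σ := p.2.1.2
    rw [← Equiv.Perm.iterate_eq_pow, (hs.iterate_right i).eq, hρ]
  rw [Finset.sum_comm]
  have h3 : ∀ r : {r : α // p.1 r = r}, (∑ d ∈ Finset.Icc 1 N,
      if minimalPeriod σ r.1 = d then 1 / ((d : ℕ) : ℚ) else 0) = 1 / (minimalPeriod σ ρ : ℚ) := by
    intro r
    rw [Finset.sum_eq_single (σ.cycleLength ρ)]
    · exact if_pos (hmp r)
    · intro d _ hd
      rw [if_neg]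
      intro h
      exact hd (PNat.coe_inj.1 (h.symm.trans (hmp r)))
    · intro h
      exact absurd (Finset.mem_Icc.2 (⟨one_le, hρN⟩ : 1 ≤ σ.cycleLength ρ ∧ σ.cycleLength ρ ≤ N)) h
  rw [Finset.sum_congr rfl fun r _ => h3 r, Finset.sum_const, Finset.card_univ, hcard, nsmul_eq_mul,
    Nat.cast_one, mul_one_div_cancel]
  exact Nat.cast_ne_zero.2 (σ.cycleLength ρ).ne_zero

/-- Removal of the root reduces this to the series of forests, for which the logarithmic Euler
derivative is the double count with a marked point. -/
theorem PreLie_eq : SymFun.PreLie = SymFun.p 1 * SymFun.expOf (SymFun.logSum SymFun.PreLie) := by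
  have h0 : MvPowerSeries.constantCoeff SymFun.PreLie = 0 := by
    rw [PreLie_eq_p_mul]
    exact SymFun.constantCoeff_p_mul _
  conv_lhs => rw [PreLie_eq_p_mul]
  congr 1
  refine SymFun.eq_expOf_of_euler (SymFun.constantCoeff_logSum h0) ?_ ?_
  · refine SymFun.ext_ghost fun m => ?_
    obtain ⟨n, σ, rfl⟩ := Equiv.Perm.exists_cycleTypeExp_eq m
    rw [SymFun.ghost_euler, Equiv.Perm.degree_cycleTypeExp, ghost_forestSeries, mul_comm forestSeries]
    refine degree_mul_forestCount σ fun β _ τ => ?_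
    rw [SymFun.ghost_euler, Equiv.Perm.degree_cycleTypeExp]
    rcases isEmpty_or_nonempty β with h | h
    · simp
    · rw [ghost_logSum_PreLie]
  · have h1 := ghost_forestSeries (1 : Equiv.Perm (Fin 0))
    have h2 : (1 : Equiv.Perm (Fin 0)).cycleTypeExp = 0 :=
      SymFun.degree_eq_zero (by rw [Equiv.Perm.degree_cycleTypeExp, Nat.card_fin])
    have : Unique {p : Fin 0 → Fin 0 // EquivForest 1 p} :=
      ⟨⟨⟨id, fun a => a.elim0, fun a => a.elim0⟩⟩,
        fun p => Subtype.ext (funext fun a => a.elim0)⟩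
    rw [h2, SymFun.ghost_zero] at h1
    rw [h1, forestCount, Nat.card_unique, Nat.cast_one]

end GradedForest

/-! ### Stable sorting and the first Eulerian idempotent -/

section Sorting

variable {n : ℕ}

theorem existsUnique_sort {X : Type} [LinearOrder X] {f : Fin n → X} (hf : Injective f) :
    ∃! u : Equiv.Perm (Fin n), ∀ a b, u a < u b ↔ f a < f b := by
  have h1 : StrictMono (f ∘ Tuple.sort f) :=
    (Tuple.monotone_sort f).strictMono_of_injective (hf.comp (Tuple.sort f).injective)
  refine ⟨(Tuple.sort f)⁻¹, fun a b => ?_, fun v hv => ?_⟩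
  · rw [← h1.lt_iff_lt, comp_apply, comp_apply, ← Equiv.Perm.mul_apply, ← Equiv.Perm.mul_apply,
      mul_inv_cancel, Equiv.Perm.one_apply, Equiv.Perm.one_apply]
  · have h2 : StrictMono (f ∘ (v⁻¹ : Equiv.Perm (Fin n))) := by
      intro i j hij
      rw [comp_apply, comp_apply, ← hv, ← Equiv.Perm.mul_apply, ← Equiv.Perm.mul_apply,
        mul_inv_cancel, Equiv.Perm.one_apply, Equiv.Perm.one_apply]
      exact hij
    have h3 := Tuple.unique_monotone h1.monotone h2.monotone
    rw [← inv_inv v]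
    congr 1
    ext i
    exact congrArg _ (hf (congrFun h3 i)).symm

/-- The order `u` is obtained from the order `w` by stable sorting according to the colours. -/
def Sorts {K : Type} [LinearOrder K] (u : Equiv.Perm (Fin n)) (c : Fin n → K)
    (w : Equiv.Perm (Fin n)) : Prop :=
  ∀ a b, u a < u b ↔ c a < c b ∨ c a = c b ∧ w a < w b

theorem existsUnique_sorts {K : Type} [LinearOrder K] (c : Fin n → K) (w : Equiv.Perm (Fin n)) :
    ∃! u, Sorts u c w := by
  have h : Injective fun a => toLex (c a, w a) := by
    intro a b hab
    exact w.injective (congrArg Prod.snd (toLex.injective hab))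
  simpa only [Sorts, Prod.Lex.toLex_lt_toLex] using existsUnique_sort h

theorem sorts_comp {K L : Type} [LinearOrder K] [LinearOrder L] {g : K → L} (hg : StrictMono g)
    {u w : Equiv.Perm (Fin n)} {c : Fin n → K} : Sorts u (g ∘ c) w ↔ Sorts u c w := by
  simp only [Sorts, comp_apply, hg.lt_iff_lt, hg.injective.eq_iff]

/-- The number of colourings by which `u` is obtained from `w`. -/
noncomputable def sortCount (K : Type) [LinearOrder K] (u w : Equiv.Perm (Fin n)) : ℚ :=
  Nat.card {c : Fin n → K // Sorts u c w}

/-- Radix sort: stable sorting by the second colour and then by the first is stable sorting by the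
pair, and the intermediate order is determined by `w` and the second colouring. -/
theorem sum_sortCount_mul (K L : Type) [LinearOrder K] [LinearOrder L] [Fintype K] [Fintype L]
    (u w : Equiv.Perm (Fin n)) :
    ∑ v, sortCount K u v * sortCount L v w = sortCount (K ×ₗ L) u w := by
  have h : ∀ v, sortCount K u v * sortCount L v w =
      Nat.card ({c : Fin n → K // Sorts u c v} × {c : Fin n → L // Sorts v c w}) := by
    intro v
    rw [Nat.card_prod, Nat.cast_mul]
    rfl
  rw [Finset.sum_congr rfl fun v _ => h v, ← Nat.cast_sum, ← Nat.card_sigma, sortCount]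
  have key : ∀ (c : Fin n → K) (c' : Fin n → L) (v : Equiv.Perm (Fin n)), Sorts v c' w →
      (Sorts u c v ↔ Sorts u (fun a => toLex (c a, c' a)) w) := by
    intro c c' v hv
    refine forall_congr' fun a => forall_congr' fun b => ?_
    rw [hv a b]
    simp only [Prod.Lex.toLex_lt_toLex, toLex_inj, Prod.mk.injEq]
    refine iff_congr Iff.rfl ?_
    tauto
  congr 1
  refine Nat.card_congr (Equiv.ofBijective (fun x => ⟨fun a => toLex (x.2.1.1 a, x.2.2.1 a),
    (key _ _ _ x.2.2.2).1 x.2.1.2⟩) ⟨?_, ?_⟩)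
  · rintro ⟨v, ⟨c, hc⟩, c', hc'⟩ ⟨v₁, ⟨c₁, hc₁⟩, c₁', hc₁'⟩ hx
    have h1 := Subtype.ext_iff.1 hx
    obtain rfl : c = c₁ := funext fun a => congrArg Prod.fst (toLex.injective (congrFun h1 a))
    obtain rfl : c' = c₁' := funext fun a => congrArg Prod.snd (toLex.injective (congrFun h1 a))
    obtain rfl : v = v₁ := (existsUnique_sorts c' w).unique hc' hc₁'
    rfl
  · rintro ⟨c, hc⟩
    obtain ⟨v, hv, -⟩ := existsUnique_sorts (fun a => (ofLex (c a)).2) w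
    exact ⟨⟨v, ⟨fun a => (ofLex (c a)).1, (key _ _ v hv).2 hc⟩, _, hv⟩, rfl⟩

/-- The number of surjective colourings by which `u` is obtained from `w`. -/
noncomputable def surjSortCount (u w : Equiv.Perm (Fin n)) (m : ℕ) : ℕ :=
  Nat.card {c : Fin n → Fin m // Surjective c ∧ Sorts u c w}

/-- Only the relative order of the colours in use matters, so they can be renamed. -/
theorem card_sorts_image_eq {K : Type} [LinearOrder K] [Fintype K] (u w : Equiv.Perm (Fin n))
    (T : Finset K) : Nat.card {c : Fin n → K // Sorts u c w ∧ Finset.univ.image c = T} =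
      surjSortCount u w T.card := by
  let e := T.orderEmbOfFin rfl
  have he : ∀ x, x ∈ T ↔ ∃ i, e i = x := fun x => by
    rw [← Set.mem_range, Finset.range_orderEmbOfFin, Finset.mem_coe]
  have him : ∀ c : {c : Fin n → Fin T.card // Surjective c ∧ Sorts u c w},
      Finset.univ.image (e ∘ c.1) = T := by
    intro c
    ext x
    simp only [Finset.mem_image, Finset.mem_univ, true_and, comp_apply, he]
    constructor
    · rintro ⟨a, rfl⟩
      exact ⟨_, rfl⟩
    · rintro ⟨i, rfl⟩
      obtain ⟨a, rfl⟩ := c.2.1 i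
      exact ⟨a, rfl⟩
  refine (Nat.card_congr (Equiv.ofBijective (fun c => ⟨e ∘ c.1,
    (sorts_comp e.strictMono).2 c.2.2, him c⟩) ⟨?_, ?_⟩)).symm
  · intro c c' h
    exact Subtype.ext (e.injective.comp_left (Subtype.ext_iff.1 h))
  · rintro ⟨c, hc, hT⟩
    have h1 : ∀ a, ∃ i, e i = c a := fun a => (he _).1 (hT ▸ Finset.mem_image_of_mem _
      (Finset.mem_univ _))
    choose c' hc' using h1
    obtain rfl : e ∘ c' = c := funext hc'
    refine ⟨⟨c', fun i => ?_, (sorts_comp e.strictMono).1 hc⟩, rfl⟩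
    have h2 := (Finset.ext_iff.1 hT (e i)).2 ((he _).2 ⟨i, rfl⟩)
    rw [Finset.mem_image] at h2
    obtain ⟨a, _, ha⟩ := h2
    exact ⟨a, e.injective ha⟩

/-- Colourings are grouped by the set of colours that occur. Sets of equal size `m` contribute
equally, and their number is a binomial coefficient, polynomial in the number of colours. -/
theorem exists_sortPolynomial (u w : Equiv.Perm (Fin n)) : ∃ P : Polynomial ℚ,
    ∀ (K : Type) [LinearOrder K] [Fintype K], P.eval (Fintype.card K : ℚ) = sortCount K u w := by
  classical
  refine ⟨∑ m ∈ Finset.range (n + 1), Polynomial.C ((surjSortCount u w m : ℚ) / m.factorial) *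
    descPochhammer ℚ m, fun K _ _ => ?_⟩
  have h1 : sortCount K u w = ∑ T : Finset K, (surjSortCount u w T.card : ℚ) := by
    rw [sortCount, ← Nat.cast_sum, Finset.sum_congr rfl fun T _ => (card_sorts_image_eq u w T).symm,
      ← Nat.card_sigma]
    congr 1
    exact Nat.card_congr ⟨fun c => ⟨_, c.1, c.2, rfl⟩, fun x => ⟨x.2.1, x.2.2.1⟩, fun _ => rfl, by
      rintro ⟨T, c, hc, rfl⟩
      rfl⟩
  have h2 : ∀ m, n < m → surjSortCount u w m = 0 := by
    intro m hm
    rw [surjSortCount]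
    have : IsEmpty {c : Fin n → Fin m // Surjective c ∧ Sorts u c w} := by
      refine ⟨fun c => ?_⟩
      have := Fintype.card_le_of_surjective _ c.2.1
      rw [Fintype.card_fin, Fintype.card_fin] at this
      omega
    exact Nat.card_of_isEmpty
  rw [h1, ← Finset.powerset_univ,
    Finset.sum_powerset_apply_card (fun m => (surjSortCount u w m : ℚ)), Finset.card_univ,
    Polynomial.eval_finsetSum]
  have h3 : ∀ m, Polynomial.eval (Fintype.card K : ℚ) (Polynomial.C ((surjSortCount u w m : ℚ) /
      m.factorial) * descPochhammer ℚ m) = (Fintype.card K).choose m • (surjSortCount u w m : ℚ) := by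
    intro m
    rw [Polynomial.eval_mul, Polynomial.eval_C, descPochhammer_eval_eq_descFactorial,
      Nat.descFactorial_eq_factorial_mul_choose, nsmul_eq_mul]
    have : (m.factorial : ℚ) ≠ 0 := Nat.cast_ne_zero.2 m.factorial_ne_zero
    push_cast
    field_simp
  rw [Finset.sum_congr rfl fun m _ => h3 m]
  -- The sum may stop at `n` or at `card K`: at most `n` colours can occur, and no subset of `K` is
  -- larger than `K`.
  have h4 : ∀ N M : ℕ, (∀ m, M < m → (Fintype.card K).choose m • (surjSortCount u w m : ℚ) = 0) →
      M ≤ N → ∑ m ∈ Finset.range (N + 1), (Fintype.card K).choose m • (surjSortCount u w m : ℚ) =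
      ∑ m ∈ Finset.range (M + 1), (Fintype.card K).choose m • (surjSortCount u w m : ℚ) := by
    intro N M h hMN
    refine (Finset.sum_subset (Finset.range_subset_range.2 (by omega)) fun m _ hm => h m ?_).symm
    rw [Finset.mem_range] at hm
    omega
  rcases le_total n (Fintype.card K) with h | h
  · rw [h4 _ n (fun m hm => by rw [h2 m hm]; simp) h]
  · exact h4 _ _ (fun m hm => by rw [Nat.choose_eq_zero_of_lt hm, zero_smul]) h

/-- The number of colourings as a polynomial in the number of colours. -/
noncomputable def sortPolynomial (u w : Equiv.Perm (Fin n)) : Polynomial ℚ :=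
  (exists_sortPolynomial u w).choose

theorem eval_sortPolynomial (u w : Equiv.Perm (Fin n)) (K : Type) [LinearOrder K] [Fintype K] :
    (sortPolynomial u w).eval (Fintype.card K : ℚ) = sortCount K u w :=
  (exists_sortPolynomial u w).choose_spec K

theorem Polynomial.eq_of_eval_natCast {P Q : Polynomial ℚ}
    (h : ∀ k : ℕ, P.eval (k : ℚ) = Q.eval (k : ℚ)) : P = Q :=
  Polynomial.eq_of_infinite_eval_eq _ _ ((Set.infinite_range_of_injective
    (Nat.cast_injective (R := ℚ))).mono (by rintro _ ⟨k, rfl⟩; exact h k))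

/-- The first Eulerian idempotent. -/
noncomputable def eulerian (n : ℕ) : Matrix (Equiv.Perm (Fin n)) (Equiv.Perm (Fin n)) ℚ :=
  fun u w => (sortPolynomial u w).coeff 1

theorem Polynomial.coeff_one_comp_C_mul_X (P : Polynomial ℚ) (a : ℚ) :
    (P.comp (Polynomial.C a * Polynomial.X)).coeff 1 = a * P.coeff 1 := by
  rw [Polynomial.comp_C_mul_X_coeff, pow_one, mul_comm]

/-- The sorting matrices satisfy `S(k) S(l) = S(k l)` and are polynomial in the number of colours;
the coefficients of `k l` on both sides are compared. -/
theorem eulerian_mul_self (n : ℕ) : eulerian n * eulerian n = eulerian n := by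
  have h1 : ∀ (k l : ℕ) (u w : Equiv.Perm (Fin n)),
      ∑ v, (sortPolynomial u v).eval (k : ℚ) * (sortPolynomial v w).eval (l : ℚ) =
        (sortPolynomial u w).eval ((l : ℚ) * k) := by
    intro k l u w
    have h := sum_sortCount_mul (Fin k) (Fin l) u w
    simp only [← eval_sortPolynomial, Fintype.card_fin, Fintype.card_lex, Fintype.card_prod] at h
    rw [h, mul_comm]
    push_cast
    rfl
  have h2 : ∀ (l : ℕ) (u w : Equiv.Perm (Fin n)),
      ∑ v, (sortPolynomial u v).coeff 1 * (sortPolynomial v w).eval (l : ℚ) =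
        l * (sortPolynomial u w).coeff 1 := by
    intro l u w
    rw [← Polynomial.coeff_one_comp_C_mul_X]
    have h : ∑ v, sortPolynomial u v * Polynomial.C ((sortPolynomial v w).eval (l : ℚ)) =
        (sortPolynomial u w).comp (Polynomial.C (l : ℚ) * Polynomial.X) := by
      refine Polynomial.eq_of_eval_natCast fun k => ?_
      rw [Polynomial.eval_finsetSum, Polynomial.eval_comp, Polynomial.eval_mul, Polynomial.eval_C,
        Polynomial.eval_X, ← h1]
      simp only [Polynomial.eval_mul, Polynomial.eval_C]
    rw [← h, Polynomial.finsetSum_coeff]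
    simp only [Polynomial.coeff_mul_C]
  ext u w
  rw [Matrix.mul_apply]
  have h : ∑ v, Polynomial.C ((sortPolynomial u v).coeff 1) * sortPolynomial v w =
      Polynomial.C ((sortPolynomial u w).coeff 1) * Polynomial.X := by
    refine Polynomial.eq_of_eval_natCast fun l => ?_
    rw [Polynomial.eval_finsetSum, Polynomial.eval_mul, Polynomial.eval_C, Polynomial.eval_X,
      mul_comm, ← h2]
    simp only [Polynomial.eval_mul, Polynomial.eval_C]
  have h3 := congrArg (fun P => P.coeff 1) h
  simp only [Polynomial.finsetSum_coeff, Polynomial.coeff_C_mul, Polynomial.coeff_X_one,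
    mul_one] at h3
  exact h3

/-- The Eulerian idempotent fixes the common eigenvectors of the sorting matrices. -/
theorem eulerian_mulVec {x : Equiv.Perm (Fin n) → ℚ}
    (h : ∀ (k : ℕ) u, ∑ w, sortCount (Fin k) u w * x w = k * x u) :
    (eulerian n).mulVec x = x := by
  funext u
  have h1 : ∑ w, sortPolynomial u w * Polynomial.C (x w) = Polynomial.C (x u) * Polynomial.X := by
    refine Polynomial.eq_of_eval_natCast fun k => ?_
    rw [Polynomial.eval_finsetSum, Polynomial.eval_mul, Polynomial.eval_C, Polynomial.eval_X,
      mul_comm, ← h k]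
    refine Finset.sum_congr rfl fun w _ => ?_
    rw [← eval_sortPolynomial, Fintype.card_fin, Polynomial.eval_mul, Polynomial.eval_C]
  have h2 := congrArg (fun P => P.coeff 1) h1
  simp only [Polynomial.finsetSum_coeff, Polynomial.coeff_C_mul, Polynomial.coeff_mul_C,
    Polynomial.coeff_X_one, mul_one] at h2
  exact h2

end Sorting

/-! ### Itineraries and primitive colourings -/

section Itinerary

variable {α K : Type}

/-- The colours of the iterates of a point. -/
def itinerary (τ : Equiv.Perm α) (c : α → K) (a : α) : ℕ → K := fun i => c ((τ ^ i) a)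

/-- A colouring is primitive if a point is determined by its cycle and its itinerary. -/
def IsPrimitive (τ : Equiv.Perm α) (c : α → K) : Prop :=
  ∀ a (j : ℕ), itinerary τ c ((τ ^ j) a) = itinerary τ c a → (τ ^ j) a = a

variable {τ : Equiv.Perm α} {c : α → K}

theorem itinerary_apply (a : α) (i : ℕ) : itinerary τ c (τ a) i = itinerary τ c a (i + 1) := by
  rw [itinerary, itinerary, pow_succ, Equiv.Perm.mul_apply]

theorem itinerary_eq_iff {a b : α} : itinerary τ c a = itinerary τ c b ↔
    c a = c b ∧ itinerary τ c (τ a) = itinerary τ c (τ b) := by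
  constructor
  · intro h
    exact ⟨congrFun h 0, funext fun i => by rw [itinerary_apply, itinerary_apply, h]⟩
  · rintro ⟨h0, h1⟩
    funext i
    cases i with
    | zero => exact h0
    | succ i => rw [← itinerary_apply, ← itinerary_apply, h1]

/-- As `τ` has finite order, the colour of `a` reappears along the orbit of `τ a`, after `orderOf τ
- 1` steps. -/
theorem itinerary_eq_of_apply [Finite α] {a b : α}
    (h : itinerary τ c (τ a) = itinerary τ c (τ b)) : itinerary τ c a = itinerary τ c b := by
  refine itinerary_eq_iff.2 ⟨?_, h⟩
  have h1 : ∀ x, (τ ^ (orderOf τ - 1)) (τ x) = x := by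
    intro x
    rw [← Equiv.Perm.mul_apply, ← pow_succ, Nat.sub_add_cancel (orderOf_pos τ), pow_orderOf_eq_one,
      Equiv.Perm.one_apply]
  have h2 := congrFun h (orderOf τ - 1)
  rwa [itinerary, itinerary, h1, h1] at h2

theorem itinerary_lt_iff [LinearOrder K] {a b : α} :
    toLex (itinerary τ c a) < toLex (itinerary τ c b) ↔ c a < c b ∨
      c a = c b ∧ toLex (itinerary τ c (τ a)) < toLex (itinerary τ c (τ b)) := by
  constructor
  · rintro ⟨i, hi, hlt⟩
    cases i with
    | zero => exact Or.inl hlt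
    | succ i =>
      refine Or.inr ⟨hi 0 (Nat.succ_pos i), i, fun j hj => ?_, ?_⟩
      · have h1 := hi (j + 1) (Nat.succ_lt_succ hj)
        simp only [Pi.toLex_apply] at h1 ⊢
        rw [itinerary_apply, itinerary_apply, h1]
      · simp only [Pi.toLex_apply] at hlt ⊢
        rw [itinerary_apply, itinerary_apply]
        exact hlt
  · rintro (h | ⟨h, i, hi, hlt⟩)
    · exact ⟨0, fun j hj => absurd hj (Nat.not_lt_zero j), h⟩
    · refine ⟨i + 1, fun j hj => ?_, ?_⟩
      · cases j with
        | zero => exact h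
        | succ j =>
          have h1 := hi j (Nat.lt_of_succ_lt_succ hj)
          simp only [Pi.toLex_apply] at h1 ⊢
          rw [← itinerary_apply, ← itinerary_apply, h1]
      · simp only [Pi.toLex_apply] at hlt ⊢
        rw [← itinerary_apply, ← itinerary_apply]
        exact hlt

end Itinerary

/-! ### Orders `w` obtained from `w * τ` by sorting -/

section SelfSorting

variable {n : ℕ} {K : Type} [LinearOrder K] {τ w v : Equiv.Perm (Fin n)} {c : Fin n → K}

/-- Unfolding the sorting condition along the orbit compares the colours one after another, that is,
lexicographically. -/
theorem Sorts.lt_of_itinerary_lt (h : Sorts w c (w * τ)) {a b : Fin n}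
    (hab : toLex (itinerary τ c a) < toLex (itinerary τ c b)) : w a < w b := by
  obtain ⟨i, hi, hlt⟩ := hab
  simp only [Pi.toLex_apply] at hi hlt
  induction i generalizing a b with
  | zero => exact (h a b).2 (Or.inl hlt)
  | succ i ih =>
    refine (h a b).2 (Or.inr ⟨hi 0 (Nat.succ_pos i), ih (fun j hj => ?_) ?_⟩)
    · rw [itinerary_apply, itinerary_apply]
      exact hi _ (Nat.succ_lt_succ hj)
    · rw [itinerary_apply, itinerary_apply]
      exact hlt

/-- The position of a point among the points with the same itinerary. -/
noncomputable def itineraryRank (τ : Equiv.Perm (Fin n)) (c : Fin n → K) (w : Equiv.Perm (Fin n))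
    (a : Fin n) : ℕ := Nat.card {b // itinerary τ c b = itinerary τ c a ∧ w b < w a}

/-- Among points of equal colour the sorting condition says that `τ` preserves the order `w`, so it
maps a class of equal itineraries monotonically onto the next one. -/
theorem Sorts.itineraryRank_apply (h : Sorts w c (w * τ)) (a : Fin n) :
    itineraryRank τ c w (τ a) = itineraryRank τ c w a := by
  refine (Nat.card_congr (τ.subtypeEquiv fun b => ?_)).symm
  constructor
  · rintro ⟨h1, h2⟩
    have h3 := itinerary_eq_iff.1 h1
    exact ⟨h3.2, (((h b a).1 h2).resolve_left fun h4 => h4.ne h3.1).2⟩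
  · rintro ⟨h1, h2⟩
    have h3 := itinerary_eq_of_apply h1
    exact ⟨h3, (h b a).2 (Or.inr ⟨(itinerary_eq_iff.1 h3).1, h2⟩)⟩

theorem eq_of_itineraryRank_eq {K : Type} {c : Fin n → K} {a b : Fin n}
    (h : itinerary τ c a = itinerary τ c b)
    (hr : itineraryRank τ c w a = itineraryRank τ c w b) : a = b := by
  have key : ∀ a b, itinerary τ c a = itinerary τ c b → w a < w b →
      itineraryRank τ c w a < itineraryRank τ c w b := by
    intro a b h hlt
    classical
    rw [itineraryRank, itineraryRank, Nat.card_eq_fintype_card, Nat.card_eq_fintype_card,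
      Fintype.card_subtype, Fintype.card_subtype]
    refine Finset.card_lt_card ((Finset.ssubset_iff_of_subset fun x hx => ?_).2 ⟨a, ?_, ?_⟩)
    · rw [Finset.mem_filter] at hx ⊢
      exact ⟨hx.1, hx.2.1.trans h, hx.2.2.trans hlt⟩
    · exact Finset.mem_filter.2 ⟨Finset.mem_univ _, h, hlt⟩
    · exact fun hx => lt_irrefl _ (Finset.mem_filter.1 hx).2.2
  rcases lt_trichotomy (w a) (w b) with h1 | h1 | h1
  · exact absurd hr (key a b h h1).ne
  · exact w.injective h1
  · exact absurd hr (key b a h.symm h1).ne'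

/-- Powers of `τ` preserve the rank, and itinerary and rank together determine a point. -/
theorem Sorts.isPrimitive (h : Sorts w c (w * τ)) : IsPrimitive τ c := by
  intro a j hj
  refine eq_of_itineraryRank_eq (w := w) hj ?_
  clear hj
  induction j with
  | zero => rfl
  | succ j ih => rw [pow_succ', Equiv.Perm.mul_apply, h.itineraryRank_apply, ih]

theorem Sorts.monotone_itinerary (h : Sorts w c (w * τ)) :
    Monotone ((fun a => toLex (itinerary τ c a)) ∘ (w⁻¹ : Equiv.Perm (Fin n))) := by
  intro i j hij
  by_contra hlt
  have h1 := h.lt_of_itinerary_lt (not_le.1 hlt)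
  rw [← Equiv.Perm.mul_apply, ← Equiv.Perm.mul_apply, mul_inv_cancel] at h1
  exact absurd hij (not_le.2 h1)

/-- A monotone arrangement of the itineraries is unique, so `w` and `v` have equal itineraries at
equal positions. -/
theorem Sorts.itinerary_inv_mul (hw : Sorts w c (w * τ)) (hv : Sorts v c (v * τ)) (a : Fin n) :
    itinerary τ c ((v⁻¹ * w) a) = itinerary τ c a := by
  have h := congrFun (Tuple.unique_monotone hw.monotone_itinerary hv.monotone_itinerary) (w a)
  simp only [comp_apply] at h
  rw [← Equiv.Perm.mul_apply, inv_mul_cancel] at h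
  exact toLex.injective h.symm

theorem Sorts.itineraryRank_inv_mul (hw : Sorts w c (w * τ)) (hv : Sorts v c (v * τ))
    (a : Fin n) : itineraryRank τ c v ((v⁻¹ * w) a) = itineraryRank τ c w a := by
  refine (Nat.card_congr ((v⁻¹ * w).subtypeEquiv fun b => ?_)).symm
  rw [hw.itinerary_inv_mul hv, hw.itinerary_inv_mul hv, ← Equiv.Perm.mul_apply,
    ← Equiv.Perm.mul_apply, mul_inv_cancel_left]

/-- Two orders that are sorted by the same colouring differ by an automorphism. -/
theorem Sorts.inv_mul_apply_apply (hw : Sorts w c (w * τ)) (hv : Sorts v c (v * τ)) (a : Fin n) :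
    (v⁻¹ * w) (τ a) = τ ((v⁻¹ * w) a) := by
  refine eq_of_itineraryRank_eq (τ := τ) (c := c) (w := v) ?_ ?_
  · rw [hw.itinerary_inv_mul hv]
    exact (itinerary_eq_iff.1 (hw.itinerary_inv_mul hv a).symm).2
  · rw [hw.itineraryRank_inv_mul hv, hw.itineraryRank_apply, hv.itineraryRank_apply,
      hw.itineraryRank_inv_mul hv]

theorem Sorts.mul_of_commute (hv : Sorts v c (v * τ)) {g : Equiv.Perm (Fin n)}
    (hg : ∀ a, g (τ a) = τ (g a)) (hc : ∀ a, c (g a) = c a) : Sorts (v * g) c (v * g * τ) := by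
  intro a b
  have h := hv (g a) (g b)
  rw [hc, hc] at h
  simpa only [Equiv.Perm.mul_apply, hg] using h

/-- Points are ordered by itinerary and then by cycle. Primitivity makes the order total, and the
sorting condition holds because `τ` keeps the cycle and drops the first colour of the itinerary. -/
theorem IsPrimitive.exists_sorts (h : IsPrimitive τ c) : ∃ w, Sorts w c (w * τ) := by
  let R : Fin n → Fin (Fintype.card τ.Cycles) := fun a =>
    Fintype.equivFin τ.Cycles (Quotient.mk (Equiv.Perm.SameCycle.setoid τ) a)
  have hR : ∀ a, R (τ a) = R a := by
    intro a
    refine congrArg (Fintype.equivFin τ.Cycles) (Quotient.sound ?_)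
    exact Equiv.Perm.sameCycle_apply_left.2 (Equiv.Perm.SameCycle.refl _ _)
  have hinj : Injective fun a => toLex (toLex (itinerary τ c a), R a) := by
    intro a b hab
    have h1 := toLex.injective hab
    have h2 : itinerary τ c a = itinerary τ c b := toLex.injective (congrArg Prod.fst h1)
    have h3 := Quotient.exact ((Fintype.equivFin τ.Cycles).injective (congrArg Prod.snd h1))
    obtain ⟨j, rfl⟩ := Equiv.Perm.SameCycle.exists_nat_pow_eq h3
    exact (h a j h2.symm).symm
  obtain ⟨w, hw, -⟩ := existsUnique_sort hinj
  refine ⟨w, fun a b => ?_⟩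
  rw [Equiv.Perm.mul_apply, Equiv.Perm.mul_apply, hw, hw, Prod.Lex.toLex_lt_toLex,
    Prod.Lex.toLex_lt_toLex]
  simp only [itinerary_eq_iff (a := a), toLex_inj, hR]
  have h1 := itinerary_lt_iff (τ := τ) (c := c) (a := a) (b := b)
  tauto

end SelfSorting

/-- The pairs of an automorphism of a permutation and an invariant primitive colouring. -/
abbrev PrimitivePair (K : Type) {α : Type} (τ : Equiv.Perm α) : Type :=
  {x : Equiv.Perm α × (α → K) //
    ((∀ a, x.1 (τ a) = τ (x.1 a)) ∧ ∀ a, x.2 (x.1 a) = x.2 a) ∧ IsPrimitive τ x.2}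

/-- The number of pairs of an automorphism of a permutation and an invariant primitive
colouring. -/
noncomputable def primitiveCount (K : Type) {α : Type} (τ : Equiv.Perm α) : ℚ :=
  Nat.card (PrimitivePair K τ)

/-- A colouring that occurs is primitive, and the orders sorted by it form a torsor under the
automorphisms of `τ` that preserve it. The idea is that of Gessel and Reutenauer's count of
permutations by cycle type. -/
theorem sum_sortCount_eq {n : ℕ} (K : Type) [LinearOrder K] [Finite K] (τ : Equiv.Perm (Fin n)) :
    ∑ w : Equiv.Perm (Fin n), sortCount K w (w * τ) = primitiveCount K τ := by
  rw [primitiveCount]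
  simp only [sortCount]
  rw [← Nat.cast_sum, ← Nat.card_sigma]
  congr 1
  have h : ∀ c : {c : Fin n → K // IsPrimitive τ c}, ∃ w, Sorts w c.1 (w * τ) :=
    fun c => c.2.exists_sorts
  choose w hw using h
  refine (Nat.card_congr (Equiv.ofBijective (fun x => ⟨w ⟨x.1.2, x.2.2⟩ * x.1.1, x.1.2,
    (hw ⟨x.1.2, x.2.2⟩).mul_of_commute x.2.1.1 x.2.1.2⟩) ⟨?_, ?_⟩)).symm
  · rintro ⟨⟨g, c⟩, hg⟩ ⟨⟨g', c'⟩, hg'⟩ h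
    have h1 := congrArg (fun x => x.2.1) h
    have h2 := congrArg (fun x => x.1) h
    simp only at h1 h2
    subst h1
    rw [mul_right_inj] at h2
    subst h2
    rfl
  · rintro ⟨v, c, hv⟩
    have hp := hv.isPrimitive
    refine ⟨⟨((w ⟨c, hp⟩)⁻¹ * v, c), ⟨hv.inv_mul_apply_apply (hw ⟨c, hp⟩), fun a => ?_⟩, hp⟩, ?_⟩
    · exact congrFun (hv.itinerary_inv_mul (hw ⟨c, hp⟩) a) 0
    · refine Sigma.subtype_ext ?_ rfl
      exact mul_inv_cancel_left _ _

/-! ### Adding one cycle to a permutation -/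

section PrimitiveCount

variable {α β K : Type}

theorem pow_apply_of_semiconj {τ : Equiv.Perm α} {ρ : Equiv.Perm β} {h : β → α}
    (hh : ∀ b, h (ρ b) = τ (h b)) (j : ℕ) (b : β) : (τ ^ j) (h b) = h ((ρ ^ j) b) := by
  have hs : Semiconj h ρ τ := hh
  rw [← Equiv.Perm.iterate_eq_pow, ← Equiv.Perm.iterate_eq_pow, (hs.iterate_right j).eq]

theorem itinerary_of_semiconj {τ : Equiv.Perm α} {ρ : Equiv.Perm β} {h : β → α}
    (hh : ∀ b, h (ρ b) = τ (h b)) (c : α → K) (b : β) :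
    itinerary τ c (h b) = itinerary ρ (c ∘ h) b := by
  funext i
  rw [itinerary, pow_apply_of_semiconj hh]
  rfl

theorem IsPrimitive.comp {τ : Equiv.Perm α} {ρ : Equiv.Perm β} {h : β → α} (hi : Injective h)
    (hh : ∀ b, h (ρ b) = τ (h b)) {c : α → K} (hc : IsPrimitive τ c) : IsPrimitive ρ (c ∘ h) := by
  intro b j hj
  rw [← itinerary_of_semiconj hh, ← itinerary_of_semiconj hh, ← pow_apply_of_semiconj hh] at hj
  refine hi ?_
  rw [← pow_apply_of_semiconj hh, hc _ _ hj]

theorem isPrimitive_sumCongr {τ : Equiv.Perm α} {ρ : Equiv.Perm β} {c : α ⊕ β → K} :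
    IsPrimitive (Equiv.Perm.sumCongr τ ρ) c ↔
      IsPrimitive τ (c ∘ Sum.inl) ∧ IsPrimitive ρ (c ∘ Sum.inr) := by
  have h1 : ∀ b, Sum.inl (τ b) = Equiv.Perm.sumCongr τ ρ (Sum.inl b) := fun _ => rfl
  have h2 : ∀ b, Sum.inr (ρ b) = Equiv.Perm.sumCongr τ ρ (Sum.inr b) := fun _ => rfl
  refine ⟨fun h => ⟨h.comp Sum.inl_injective h1, h.comp Sum.inr_injective h2⟩, ?_⟩
  rintro ⟨hl, hr⟩ (a | b) j hj
  · rw [pow_apply_of_semiconj h1, itinerary_of_semiconj h1, itinerary_of_semiconj h1] at hj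
    rw [pow_apply_of_semiconj h1, hl _ _ hj]
  · rw [pow_apply_of_semiconj h2, itinerary_of_semiconj h2, itinerary_of_semiconj h2] at hj
    rw [pow_apply_of_semiconj h2, hr _ _ hj]

theorem primitiveCount_permCongr (e : α ≃ β) (τ : Equiv.Perm α) :
    primitiveCount K (e.permCongr τ) = primitiveCount K τ := by
  have h1 : ∀ b, e.symm (e.permCongr τ b) = τ (e.symm b) := fun b => by simp
  have h2 : ∀ a, e (τ a) = e.permCongr τ (e a) := fun a => by simp
  refine congrArg _ (Nat.card_congr (Equiv.subtypeEquiv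
    (e.permCongr.prodCongr (e.arrowCongr (Equiv.refl K))) fun x => ?_)).symm
  obtain ⟨g, c⟩ := x
  refine and_congr (and_congr ?_ ?_) ?_
  · rw [← e.forall_congr_right]
    simp
  · rw [← e.forall_congr_right]
    simp
  · constructor
    · exact fun h => h.comp e.symm.injective h1
    · intro h
      have h3 := h.comp e.injective h2
      convert h3 using 1
      funext a
      simp

/-- The involution of a sum that exchanges the second summand with its image in the first. -/
theorem exists_exchange {h : β → α} (hi : Injective h) : ∃ s : Equiv.Perm (α ⊕ β),
    (∀ x, s (s x) = x) ∧ (∀ b, s (Sum.inr b) = Sum.inl (h b)) ∧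
      ∀ a, (∀ b, h b ≠ a) → s (Sum.inl a) = Sum.inl a := by
  classical
  let f : α ⊕ β → α ⊕ β := Sum.elim
    (fun a => if ha : ∃ b, h b = a then Sum.inr ha.choose else Sum.inl a) (Sum.inl ∘ h)
  have h1 : ∀ b, f (Sum.inl (h b)) = Sum.inr b := by
    intro b
    have hb : ∃ b', h b' = h b := ⟨b, rfl⟩
    exact (dif_pos hb).trans (congrArg _ (hi hb.choose_spec))
  have h2 : ∀ a, (∀ b, h b ≠ a) → f (Sum.inl a) = Sum.inl a := fun a ha =>
    dif_neg fun ⟨b, hb⟩ => ha b hb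
  have hf : Involutive f := by
    rintro (a | b)
    · by_cases ha : ∃ b, h b = a
      · obtain ⟨b, rfl⟩ := ha
        rw [h1]
        rfl
      · rw [h2 a fun b hb => ha ⟨b, hb⟩, h2 a fun b hb => ha ⟨b, hb⟩]
    · exact h1 b
  exact ⟨hf.toPerm, hf, fun _ => rfl, h2⟩

theorem exists_eq_sumCongr_one [Finite α] [Finite β] {f : Equiv.Perm (α ⊕ β)}
    (hf : ∀ b, f (Sum.inr b) = Sum.inr b) : ∃ g, f = Equiv.Perm.sumCongr g 1 := by
  have h : Set.MapsTo f (Set.range Sum.inl) (Set.range Sum.inl) := by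
    rintro _ ⟨a, rfl⟩
    rcases hfa : f (Sum.inl a) with a' | b
    · exact ⟨a', rfl⟩
    · rw [← hf b] at hfa
      exact absurd (f.injective hfa) Sum.inl_ne_inr
  obtain ⟨⟨g, g'⟩, rfl⟩ := Equiv.Perm.mem_sumCongrHom_range_of_perm_mapsTo_inl h
  have : g' = 1 := Equiv.ext fun b => Sum.inr_injective (hf b)
  exact ⟨g, by rw [this]; rfl⟩

/-- An automorphism maps the new cycle either to itself, and then identically by primitivity, or
injectively into the old points, and then the colours of the new cycle are prescribed by those of
its image. In the second case the exchange with the image leaves an automorphism that fixes the new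
cycle. -/
theorem primitiveCount_sumCongr [Finite α] [Finite β] [Finite K] (τ : Equiv.Perm α)
    (ρ : Equiv.Perm β) (b₀ : β) (hρ : ∀ b, ∃ n : ℕ, (ρ ^ n) b₀ = b) :
    primitiveCount K (Equiv.Perm.sumCongr τ ρ) =
      (Nat.card {c : β → K // IsPrimitive ρ c} +
        Nat.card {h : β → α // Injective h ∧ ∀ b, h (ρ b) = τ (h b)}) * primitiveCount K τ := by
  have hinl : ∀ b, Sum.inl (τ b) = Equiv.Perm.sumCongr τ ρ (Sum.inl b) := fun _ => rfl
  have hinr : ∀ b, Sum.inr (ρ b) = Equiv.Perm.sumCongr τ ρ (Sum.inr b) := fun _ => rfl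
  have hex : ∀ h : {h : β → α // Injective h ∧ ∀ b, h (ρ b) = τ (h b)}, ∃ s : Equiv.Perm (α ⊕ β),
    (∀ x, s (s x) = x) ∧ (∀ b, s (Sum.inr b) = Sum.inl (h.1 b)) ∧
      ∀ a, (∀ b, h.1 b ≠ a) → s (Sum.inl a) = Sum.inl a := fun h => exists_exchange h.2.1
  choose s hs hsr hsl using hex
  have hsl' : ∀ h b, s h (Sum.inl (h.1 b)) = Sum.inr b := fun h b => by rw [← hsr, hs]
  have hsτ : ∀ h x, s h (Equiv.Perm.sumCongr τ ρ x) = Equiv.Perm.sumCongr τ ρ (s h x) := by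
    rintro h (a | b)
    · by_cases ha : ∃ b, h.1 b = a
      · obtain ⟨b, rfl⟩ := ha
        rw [← hinl, ← h.2.2, hsl', hsl']
        rfl
      · rw [← hinl, hsl h a fun b hb => ha ⟨b, hb⟩, hsl, hinl]
        intro b hb
        obtain ⟨b', rfl⟩ := ρ.surjective b
        rw [h.2.2] at hb
        exact ha ⟨b', τ.injective hb⟩
    · rw [← hinr, hsr, hsr, h.2.2]
      rfl
  have hsc : ∀ h (c : α ⊕ β → K), (∀ b, c (Sum.inr b) = c (Sum.inl (h.1 b))) →
      ∀ x, c (s h x) = c x := by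
    rintro h c hc (a | b)
    · by_cases ha : ∃ b, h.1 b = a
      · obtain ⟨b, rfl⟩ := ha
        rw [hsl', hc]
      · rw [hsl h a fun b hb => ha ⟨b, hb⟩]
    · rw [hsr, hc]
  have hA : ∀ (x : PrimitivePair K τ) (c : {c : β → K // IsPrimitive ρ c}),
      ((∀ y, Equiv.Perm.sumCongr x.1.1 1 (Equiv.Perm.sumCongr τ ρ y) =
        Equiv.Perm.sumCongr τ ρ (Equiv.Perm.sumCongr x.1.1 1 y)) ∧
        ∀ y, Sum.elim x.1.2 c.1 (Equiv.Perm.sumCongr x.1.1 1 y) = Sum.elim x.1.2 c.1 y) ∧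
      IsPrimitive (Equiv.Perm.sumCongr τ ρ) (Sum.elim x.1.2 c.1) := by
    intro x c
    refine ⟨⟨?_, ?_⟩, isPrimitive_sumCongr.2 ⟨x.2.2, c.2⟩⟩
    · rintro (a | b)
      · exact congrArg Sum.inl (x.2.1.1 a)
      · rfl
    · rintro (a | b)
      · exact x.2.1.2 a
      · rfl
  have hB : ∀ (x : PrimitivePair K τ) (h : {h : β → α // Injective h ∧ ∀ b, h (ρ b) = τ (h b)}),
      ((∀ y, (s h * Equiv.Perm.sumCongr x.1.1 1 : Equiv.Perm (α ⊕ β)) (Equiv.Perm.sumCongr τ ρ y) =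
        Equiv.Perm.sumCongr τ ρ ((s h * Equiv.Perm.sumCongr x.1.1 1 : Equiv.Perm (α ⊕ β)) y)) ∧
        ∀ y, Sum.elim x.1.2 (x.1.2 ∘ h.1) ((s h * Equiv.Perm.sumCongr x.1.1 1 : Equiv.Perm (α ⊕ β)) y) =
          Sum.elim x.1.2 (x.1.2 ∘ h.1) y) ∧
      IsPrimitive (Equiv.Perm.sumCongr τ ρ) (Sum.elim x.1.2 (x.1.2 ∘ h.1)) := by
    intro x h
    refine ⟨⟨?_, fun y => ?_⟩, isPrimitive_sumCongr.2 ⟨x.2.2, x.2.2.comp h.2.1 h.2.2⟩⟩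
    · rintro (a | b)
      · exact (congrArg (s h) (congrArg Sum.inl (x.2.1.1 a))).trans
          (hsτ h (Sum.inl (x.1.1 a)))
      · exact hsτ h (Sum.inr b)
    · refine (hsc h (Sum.elim x.1.2 (x.1.2 ∘ h.1)) (fun b => rfl) _).trans ?_
      rcases y with a | b
      · exact x.2.1.2 a
      · rfl
  let F : ({c : β → K // IsPrimitive ρ c} ⊕
      {h : β → α // Injective h ∧ ∀ b, h (ρ b) = τ (h b)}) × PrimitivePair K τ →
      PrimitivePair K (Equiv.Perm.sumCongr τ ρ) := fun x => Sum.elim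
    (fun c => ⟨(Equiv.Perm.sumCongr x.2.1.1 1, Sum.elim x.2.1.2 c.1), hA x.2 c⟩)
    (fun h => ⟨(s h * Equiv.Perm.sumCongr x.2.1.1 1, Sum.elim x.2.1.2 (x.2.1.2 ∘ h.1)),
      hB x.2 h⟩) x.1
  have hinjc : ∀ (f f' : α → K) (k k' : β → K), Sum.elim f k = Sum.elim f' k' → f = f' ∧ k = k' :=
    fun f f' k k' h => ⟨congrArg (· ∘ Sum.inl) h, congrArg (· ∘ Sum.inr) h⟩
  have hinjg : ∀ g g' : Equiv.Perm α,
      Equiv.Perm.sumCongr g (1 : Equiv.Perm β) = Equiv.Perm.sumCongr g' 1 → g = g' := fun g g' h =>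
    Equiv.ext fun a => Sum.inl_injective (β := β) (Equiv.congr_fun h (Sum.inl a))
  rw [primitiveCount, primitiveCount, ← Nat.cast_add, ← Nat.cast_mul, ← Nat.card_sum,
    ← Nat.card_prod]
  congr 1
  refine (Nat.card_congr (Equiv.ofBijective F ⟨?_, ?_⟩)).symm
  · rintro ⟨c | h, ⟨⟨g, c'⟩, hg⟩⟩ ⟨c₁ | h₁, ⟨⟨g₁, c₁'⟩, hg₁⟩⟩ hx
    · have h1 := congrArg Prod.fst (Subtype.ext_iff.1 hx)
      have h2 := hinjc _ _ _ _ (congrArg Prod.snd (Subtype.ext_iff.1 hx))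
      obtain rfl := hinjg _ _ h1
      obtain rfl := h2.1
      obtain rfl : c = c₁ := Subtype.ext h2.2
      rfl
    · have h1 := Equiv.congr_fun (congrArg Prod.fst (Subtype.ext_iff.1 hx)) (Sum.inr b₀)
      exact absurd (h1.trans (hsr h₁ b₀)) Sum.inr_ne_inl
    · have h1 := Equiv.congr_fun (congrArg Prod.fst (Subtype.ext_iff.1 hx)) (Sum.inr b₀)
      exact absurd ((hsr h b₀).symm.trans h1) Sum.inl_ne_inr
    · have h1 : s h * Equiv.Perm.sumCongr g 1 = s h₁ * Equiv.Perm.sumCongr g₁ 1 :=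
        congrArg Prod.fst (Subtype.ext_iff.1 hx)
      have h2 := hinjc _ _ _ _ (congrArg Prod.snd (Subtype.ext_iff.1 hx))
      obtain rfl : h = h₁ := Subtype.ext (funext fun b => Sum.inl_injective
        ((hsr h b).symm.trans ((Equiv.congr_fun h1 (Sum.inr b)).trans (hsr h₁ b))))
      obtain rfl := hinjg _ _ (mul_left_cancel h1)
      obtain rfl := h2.1
      rfl
  · rintro ⟨⟨g, c⟩, ⟨hg, hgc⟩, hp⟩
    simp only at hg hgc hp
    have hp' := isPrimitive_sumCongr.1 hp
    have hpow : ∀ n x, g ((Equiv.Perm.sumCongr τ ρ ^ n) x) = (Equiv.Perm.sumCongr τ ρ ^ n) (g x) :=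
      fun n x => (pow_apply_of_semiconj hg n x).symm
    rcases hg0 : g (Sum.inr b₀) with y | b
    · have h1 : ∀ b, ∃ a, g (Sum.inr b) = Sum.inl a := by
        intro b
        obtain ⟨n, rfl⟩ := hρ b
        refine ⟨(τ ^ n) y, ?_⟩
        rw [← pow_apply_of_semiconj hinr, hpow, hg0, pow_apply_of_semiconj hinl]
      choose h hh using h1
      have hh' : Injective h ∧ ∀ b, h (ρ b) = τ (h b) := by
        constructor
        · intro b b' hb
          have := (hh b).trans ((congrArg Sum.inl hb).trans (hh b').symm)
          exact Sum.inr_injective (g.injective this)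
        · intro b
          refine Sum.inl_injective (β := β) ?_
          rw [← hh, hinr, hg, hh, hinl]
      have hcr : ∀ b, c (Sum.inr b) = c (Sum.inl (h b)) := fun b => by rw [← hh, hgc]
      -- Composed with the exchange along `h`, the automorphism fixes every point of the new cycle.
      obtain ⟨g', hg'⟩ := exists_eq_sumCongr_one (f := s ⟨h, hh'⟩ * g) fun b => by
        rw [Equiv.Perm.mul_apply, hh]
        exact hsl' ⟨h, hh'⟩ b
      have hg2 : g = s ⟨h, hh'⟩ * Equiv.Perm.sumCongr g' 1 := by
        rw [← hg']
        ext x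
        exact (hs _ _).symm
      refine ⟨(Sum.inr ⟨h, hh'⟩, ⟨(g', c ∘ Sum.inl), ⟨fun a => ?_, fun a => ?_⟩, hp'.1⟩),
        Subtype.ext (Prod.ext hg2.symm ?_)⟩
      · refine Sum.inl_injective (β := β) ?_
        have h3 : ∀ x, Equiv.Perm.sumCongr g' 1 x = s ⟨h, hh'⟩ (g x) := fun x => by
          rw [← hg']; rfl
        exact (h3 (Sum.inl (τ a))).trans ((congrArg _ (hg (Sum.inl a))).trans
          ((hsτ _ _).trans (congrArg (Equiv.Perm.sumCongr τ ρ) (h3 (Sum.inl a)).symm)))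
      · have h3 : Sum.inl (g' a) = s ⟨h, hh'⟩ (g (Sum.inl a)) := by
          rw [← Equiv.Perm.mul_apply, hg']; rfl
        change c (Sum.inl (g' a)) = c (Sum.inl a)
        rw [h3, hsc ⟨h, hh'⟩ c hcr, hgc]
      · funext x
        rcases x with a | b
        · rfl
        · exact (hcr b).symm
    · obtain ⟨j, rfl⟩ := hρ b
      -- `g` commutes with the permutation and preserves colours, so `b₀` and its image have equal
      -- itineraries.
      have hj : (ρ ^ j) b₀ = b₀ := by
        refine hp'.2 b₀ j (funext fun i => ?_)
        rw [itinerary, itinerary, comp_apply, ← pow_apply_of_semiconj hinr, ← hg0, ← hpow, hgc,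
          pow_apply_of_semiconj hinr]
        rfl
      rw [hj] at hg0
      obtain ⟨g', hg'⟩ := exists_eq_sumCongr_one (f := g) fun b => by
        obtain ⟨n, rfl⟩ := hρ b
        rw [← pow_apply_of_semiconj hinr, hpow, hg0]
      subst hg'
      refine ⟨(Sum.inl ⟨_, hp'.2⟩, ⟨(g', c ∘ Sum.inl), ⟨fun a => ?_, fun a => ?_⟩, hp'.1⟩),
        Subtype.ext (Prod.ext rfl ?_)⟩
      · exact Sum.inl_injective (hg (Sum.inl a))
      · exact hgc (Sum.inl a)
      · exact Sum.elim_comp_inl_inr c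

end PrimitiveCount

/-! ### Primitive words and the polynomial of a cycle type -/

section Necklaces

variable {K : Type}

/-- The shift of a sequence. -/
def seqShift (x : ℕ → K) : ℕ → K := fun i => x (i + 1)

theorem seqShift_iterate (m : ℕ) (x : ℕ → K) (i : ℕ) : seqShift^[m] x i = x (i + m) := by
  induction m generalizing i with
  | zero => rfl
  | succ m ih => rw [iterate_succ_apply', seqShift, ih, add_assoc, add_comm 1]

theorem isPeriodicPt_seqShift_iff {m : ℕ} {x : ℕ → K} :
    IsPeriodicPt seqShift m x ↔ ∀ i, x (i + m) = x i := by
  rw [IsPeriodicPt, IsFixedPt, funext_iff]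
  simp only [seqShift_iterate]

/-- The sequences of period dividing `m` are the functions on `ℤ/m`. -/
theorem exists_equiv_periodic (m : ℕ) [NeZero m] :
    ∃ e : (ZMod m → K) ≃ {x : ℕ → K // IsPeriodicPt seqShift m x}, ∀ c (i : ℕ), (e c).1 i = c i := by
  refine ⟨⟨fun c => ⟨fun i => c i, isPeriodicPt_seqShift_iff.2 fun i => by simp⟩,
    fun x z => x.1 z.val, fun c => ?_, fun x => ?_⟩, fun c i => rfl⟩
  · funext z
    simp
  · refine Subtype.ext (funext fun i => ?_)
    have h : Periodic x.1 m := isPeriodicPt_seqShift_iff.1 x.2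
    simp only [ZMod.val_natCast]
    exact h.map_mod_nat i

/-- On a single cycle a coincidence of two itineraries is a translation period of the whole
colouring. -/
theorem isPrimitive_addRight_iff {m : ℕ} [NeZero m] (c : ZMod m → K) :
    IsPrimitive (Equiv.addRight (1 : ZMod m)) c ↔
      minimalPeriod seqShift (fun i : ℕ => c i) = m := by
  have hpow : ∀ (j : ℕ) (a : ZMod m), (Equiv.addRight (1 : ZMod m) ^ j) a = a + j := by
    intro j a
    induction j with
    | zero => simp
    | succ j ih => rw [pow_succ', Equiv.Perm.mul_apply, ih]; simp [add_assoc]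
  have hper : ∀ j : ℕ, IsPeriodicPt seqShift j (fun i : ℕ => c i) ↔ ∀ a, c (a + j) = c a := by
    intro j
    rw [isPeriodicPt_seqShift_iff]
    constructor
    · intro h a
      have := h a.val
      rwa [Nat.cast_add, ZMod.natCast_zmod_val] at this
    · intro h i
      rw [Nat.cast_add, h]
  have hm : minimalPeriod seqShift (fun i : ℕ => c i) ∣ m :=
    IsPeriodicPt.minimalPeriod_dvd ((hper m).2 fun a => by simp)
  constructor
  · intro h
    refine Nat.dvd_antisymm hm ?_
    have h1 := (hper _).1 (isPeriodicPt_minimalPeriod seqShift (fun i : ℕ => c i))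
    have h2 := h 0 (minimalPeriod seqShift fun i : ℕ => c i) (funext fun i => ?_)
    · rw [hpow, zero_add] at h2
      exact (ZMod.natCast_eq_zero_iff _ _).1 h2
    · rw [itinerary, itinerary, hpow, hpow, hpow, add_right_comm, h1]
  · intro h a j hj
    have h1 : ∀ b, c (b + j) = c b := by
      intro b
      have h2 := congrFun hj (b - a).val
      rw [itinerary, itinerary, hpow, hpow, hpow, ZMod.natCast_zmod_val] at h2
      rwa [show a + j + (b - a) = b + j by ring, show a + (b - a) = b by ring] at h2
    have h3 := IsPeriodicPt.minimalPeriod_dvd ((hper j).2 h1)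
    rw [h] at h3
    rw [hpow, (ZMod.natCast_eq_zero_iff _ _).2 h3, add_zero]

/-- The number of primitive words of length `m` in `K`. -/
theorem sum_card_isPrimitive [Finite K] {m : ℕ} (hm : 0 < m) :
    ∑ d ∈ m.divisors, Nat.card {x : ℕ → K // minimalPeriod seqShift x = d} = Nat.card K ^ m := by
  have : NeZero m := ⟨hm.ne'⟩
  obtain ⟨e, -⟩ := exists_equiv_periodic (K := K) m
  have hfin : Finite {x : ℕ → K // IsPeriodicPt seqShift m x} := Finite.of_equiv _ e
  have hdvd : ∀ d : m.divisors, ∀ x : ℕ → K, minimalPeriod seqShift x = d.1 →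
      IsPeriodicPt seqShift m x := by
    intro d x hx
    have h := (isPeriodicPt_minimalPeriod seqShift x)
    rw [hx] at h
    exact h.trans_dvd (Nat.dvd_of_mem_divisors d.2)
  have hfin2 : ∀ d : m.divisors, Finite {x : ℕ → K // minimalPeriod seqShift x = d.1} := fun d =>
    Finite.of_injective (fun x => (⟨x.1, hdvd d x.1 x.2⟩ : {x // IsPeriodicPt seqShift m x}))
      fun x y h => Subtype.ext (Subtype.mk_eq_mk.1 h)
  have h1 : Nat.card (ZMod m → K) = Nat.card K ^ m := by rw [Nat.card_fun, Nat.card_zmod]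
  rw [← h1, Nat.card_congr e, ← Finset.sum_coe_sort, ← Nat.card_sigma]
  exact Nat.card_congr ⟨fun x => ⟨x.2.1, hdvd x.1 x.2.1 x.2.2⟩,
    fun x => ⟨⟨_, Nat.mem_divisors.2 ⟨x.2.minimalPeriod_dvd, hm.ne'⟩⟩, x.1, rfl⟩, by
      rintro ⟨⟨d, hd⟩, x, hx⟩
      obtain rfl : minimalPeriod seqShift x = d := hx
      rfl, fun x => rfl⟩

/-- The number of primitive words of length `m`, as a polynomial in the number of letters. -/
noncomputable def necklacePolynomial (m : ℕ) : Polynomial ℚ :=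
  ∑ x ∈ m.divisorsAntidiagonal,
    Polynomial.C (ArithmeticFunction.moebius x.1 : ℚ) * Polynomial.X ^ x.2

/-- Möbius inversion of the count of all words of length `m` by their least period. -/
theorem eval_necklacePolynomial [Finite K] {m : ℕ} [NeZero m] :
    (necklacePolynomial m).eval (Nat.card K : ℚ) =
      Nat.card {c : ZMod m → K // IsPrimitive (Equiv.addRight (1 : ZMod m)) c} := by
  have h := (ArithmeticFunction.sum_eq_iff_sum_mul_moebius_eq
    (f := fun d => (Nat.card {x : ℕ → K // minimalPeriod seqShift x = d} : ℚ))
    (g := fun m => (Nat.card K : ℚ) ^ m)).1 (fun m hm => by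
      rw [← Nat.cast_sum, sum_card_isPrimitive hm]; push_cast; rfl) m (NeZero.pos m)
  rw [necklacePolynomial, Polynomial.eval_finsetSum]
  simp only [Polynomial.eval_mul, Polynomial.eval_C, Polynomial.eval_pow, Polynomial.eval_X]
  rw [h]
  congr 1
  obtain ⟨e, he⟩ := exists_equiv_periodic (K := K) m
  have hper : ∀ x : ℕ → K, minimalPeriod seqShift x = m → IsPeriodicPt seqShift m x := by
    intro x hx
    have h := isPeriodicPt_minimalPeriod seqShift x
    rwa [hx] at h
  have he' : ∀ c, minimalPeriod seqShift (e c).1 = m ↔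
      IsPrimitive (Equiv.addRight (1 : ZMod m)) c := by
    intro c
    rw [isPrimitive_addRight_iff, show (e c).1 = fun i : ℕ => c i from funext (he c)]
  refine (Nat.card_congr (Equiv.ofBijective (fun c => ⟨(e c.1).1, (he' c.1).2 c.2⟩)
    ⟨fun c c' h => ?_, fun x => ?_⟩)).symm
  · exact Subtype.ext (e.injective (Subtype.ext (Subtype.mk_eq_mk.1 h)))
  · obtain ⟨c, hc⟩ := e.surjective ⟨x.1, hper x.1 x.2⟩
    have h1 : (e c).1 = x.1 := congrArg Subtype.val hc
    exact ⟨⟨c, (he' c).1 (by rw [h1, x.2])⟩, Subtype.ext h1⟩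

theorem coeff_zero_necklacePolynomial (m : ℕ) : (necklacePolynomial m).coeff 0 = 0 := by
  rw [necklacePolynomial, Polynomial.finsetSum_coeff]
  refine Finset.sum_eq_zero fun x hx => ?_
  have h := Nat.mem_divisorsAntidiagonal.1 hx
  have hx2 : x.2 ≠ 0 := fun h0 => h.2 (by rw [← h.1, h0, mul_zero])
  rw [Polynomial.coeff_C_mul, Polynomial.coeff_X_pow, if_neg hx2.symm, mul_zero]

theorem coeff_one_necklacePolynomial {m : ℕ} (hm : m ≠ 0) :
    (necklacePolynomial m).coeff 1 = ArithmeticFunction.moebius m := by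
  rw [necklacePolynomial, Polynomial.finsetSum_coeff, Finset.sum_eq_single (m, 1)]
  · simp
  · rintro ⟨i, j⟩ hx hne
    have h := Nat.mem_divisorsAntidiagonal.1 hx
    have hj : j ≠ 1 := by
      rintro rfl
      exact hne (Prod.ext (by simpa using h.1) rfl)
    rw [Polynomial.coeff_C_mul, Polynomial.coeff_X_pow, if_neg hj.symm, mul_zero]
  · intro h
    exact absurd (Nat.mem_divisorsAntidiagonal.2 ⟨mul_one m, hm⟩) h

/-- An equivariant map is determined by the image of `0`; injectivity means that this image has
period exactly `m`. -/
theorem card_equivariant_zmod {α : Type} [Finite α] (τ : Equiv.Perm α) (m : ℕ+) :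
    Nat.card {h : ZMod m → α // Injective h ∧ ∀ b, h (Equiv.addRight (1 : ZMod m) b) = τ (h b)} =
      m * τ.cycleTypeExp m := by
  rw [Equiv.Perm.mul_cycleTypeExp]
  have hval : ∀ (h : ZMod m → α), (∀ b, h (Equiv.addRight (1 : ZMod m) b) = τ (h b)) →
      ∀ z : ZMod m, h z = (τ ^ z.val) (h 0) := by
    intro h hh z
    have hs : Semiconj h (Equiv.addRight (1 : ZMod m)) τ := hh
    have hn : ∀ n : ℕ, h n = (τ ^ n) (h 0) := by
      intro n
      induction n with
      | zero => simp
      | succ n ih => rw [pow_succ', Equiv.Perm.mul_apply, ← ih, ← hh]; simp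
    rw [← hn, ZMod.natCast_zmod_val]
  refine Nat.card_congr (Equiv.ofBijective (fun h => ⟨h.1 0, ?_⟩) ⟨fun h h' h0 => ?_, fun y => ?_⟩)
  · rw [Function.Semiconj.minimalPeriod_eq (f := Equiv.addRight (1 : ZMod m)) h.2.2 h.2.1 0,
      Equiv.Perm.minimalPeriod_addRight_one]
  · refine Subtype.ext (funext fun z => ?_)
    rw [hval _ h.2.2, hval _ h'.2.2]
    exact congrArg _ (Subtype.ext_iff.1 h0)
  · obtain ⟨y, hy⟩ := y
    have hcast : ∀ n : ℕ, (τ ^ (n : ZMod m).val) y = (τ ^ n) y := by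
      intro n
      rw [ZMod.val_natCast, ← Equiv.Perm.iterate_eq_pow, ← Equiv.Perm.iterate_eq_pow]
      conv_rhs => rw [← iterate_mod_minimalPeriod_eq, hy]
    refine ⟨⟨fun z => (τ ^ z.val) y, fun z z' hz => ?_, fun z => ?_⟩, Subtype.ext ?_⟩
    · have h1 := natCast_eq_of_pow_eq (d := m) hy.symm.dvd hz
      rwa [ZMod.natCast_zmod_val, ZMod.natCast_zmod_val] at h1
    · have h1 := hcast (z.val + 1)
      rw [Nat.cast_add, ZMod.natCast_zmod_val, Nat.cast_one] at h1
      rw [pow_succ', Equiv.Perm.mul_apply] at h1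
      exact h1
    · simp

/-- The number of pairs of an automorphism and an invariant primitive colouring, as a polynomial
in the number of colours. -/
noncomputable def centralizerPolynomial (m : ℕ+ →₀ ℕ) : Polynomial ℚ :=
  m.prod fun d e => ∏ j ∈ Finset.range e,
    (necklacePolynomial d + Polynomial.C (((d : ℕ) : ℚ) * j))

theorem centralizerPolynomial_add_single (m : ℕ+ →₀ ℕ) (k : ℕ+) :
    centralizerPolynomial (m + Finsupp.single k 1) = centralizerPolynomial m *
      (necklacePolynomial k + Polynomial.C (((k : ℕ) : ℚ) * m k)) := by
  classical
  have h : ∀ (n : ℕ+ →₀ ℕ) (s : Finset ℕ+), n.support ⊆ s → centralizerPolynomial n =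
      ∏ d ∈ s, ∏ j ∈ Finset.range (n d),
        (necklacePolynomial d + Polynomial.C (((d : ℕ) : ℚ) * j)) := by
    intro n s hs
    refine Finset.prod_subset hs fun d _ hd => ?_
    rw [Finsupp.notMem_support_iff.1 hd]
    simp
  rw [h m (insert k m.support) (Finset.subset_insert _ _),
    h (m + Finsupp.single k 1) (insert k m.support) (Finsupp.support_add.trans
      (Finset.union_subset (Finset.subset_insert _ _) (Finsupp.support_single_subset.trans
        (Finset.singleton_subset_iff.2 (Finset.mem_insert_self _ _))))),
    ← Finset.mul_prod_erase _ _ (Finset.mem_insert_self k _),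
    ← Finset.mul_prod_erase (insert k m.support) _ (Finset.mem_insert_self k _),
    Finsupp.add_apply, Finsupp.single_eq_same, Finset.prod_range_succ]
  have h2 : ∀ d ∈ (insert k m.support).erase k, (m + Finsupp.single k 1 : ℕ+ →₀ ℕ) d = m d := by
    intro d hd
    rw [Finsupp.add_apply, Finsupp.single_eq_of_ne (Finset.ne_of_mem_erase hd), add_zero]
  rw [Finset.prod_congr (s₁ := (insert k m.support).erase k) rfl fun d hd => by rw [h2 d hd]]
  ring

theorem cycleTypeExp_sumCongr {α β : Type} [Finite α] [Finite β] (τ : Equiv.Perm α)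
    (ρ : Equiv.Perm β) :
    (Equiv.Perm.sumCongr τ ρ).cycleTypeExp = τ.cycleTypeExp + ρ.cycleTypeExp := by
  refine (Equiv.Perm.eq_cycleTypeExp fun k => ?_).symm
  rw [Finsupp.add_apply, mul_add, Equiv.Perm.mul_cycleTypeExp, Equiv.Perm.mul_cycleTypeExp,
    ← Nat.card_sum]
  refine Nat.card_congr (Equiv.trans (Equiv.sumCongr (Equiv.subtypeEquivRight fun a => ?_)
    (Equiv.subtypeEquivRight fun b => ?_)) Equiv.subtypeSum.symm)
  · rw [Function.Semiconj.minimalPeriod_eq (g := Sum.inl) (f := τ)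
      (f' := Equiv.Perm.sumCongr τ ρ) (fun _ => rfl) Sum.inl_injective a]
  · rw [Function.Semiconj.minimalPeriod_eq (g := Sum.inr) (f := ρ)
      (f' := Equiv.Perm.sumCongr τ ρ) (fun _ => rfl) Sum.inr_injective b]

theorem cycleTypeExp_addRight_one (k : ℕ+) :
    (Equiv.addRight (1 : ZMod k)).cycleTypeExp = Finsupp.single k 1 := by
  classical
  refine (Equiv.Perm.eq_cycleTypeExp fun j => ?_).symm
  simp only [Equiv.Perm.minimalPeriod_addRight_one, PNat.coe_inj]
  by_cases h : k = j
  · subst h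
    rw [Finsupp.single_eq_same, mul_one, Nat.card_congr (Equiv.subtypeUnivEquiv fun _ => rfl),
      Nat.card_zmod]
  · rw [Finsupp.single_eq_of_ne' h, mul_zero]
    have : IsEmpty {a : ZMod k // k = j} := ⟨fun a => h a.2⟩
    rw [Nat.card_of_isEmpty]

/-- Induction on the number of cycles. A new `k`-cycle has its own primitive colourings, and `k`
times as many embeddings into the old points as there are old `k`-cycles; these are the two terms of
the new factor. -/
theorem exists_eval_centralizerPolynomial (m : ℕ+ →₀ ℕ) :
    ∃ (n : ℕ) (σ : Equiv.Perm (Fin n)), σ.cycleTypeExp = m ∧ ∀ (K : Type) [Finite K],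
      (centralizerPolynomial m).eval (Nat.card K : ℚ) = primitiveCount K σ := by
  classical
  obtain ⟨l, hl⟩ : ∃ l, SymFun.length m = l := ⟨_, rfl⟩
  induction l generalizing m with
  | zero =>
    have hm : m = 0 := by
      ext k
      by_contra hk
      exact hk (Finset.sum_eq_zero_iff.1 hl k (Finsupp.mem_support_iff.2 hk))
    subst hm
    refine ⟨0, 1, SymFun.degree_eq_zero (by rw [Equiv.Perm.degree_cycleTypeExp, Nat.card_fin]),
      fun K _ => ?_⟩
    have : Unique (PrimitivePair K (1 : Equiv.Perm (Fin 0))) :=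
      ⟨⟨⟨(1, fun a => a.elim0), ⟨fun a => a.elim0, fun a => a.elim0⟩, fun a => a.elim0⟩⟩,
        fun x => Subtype.ext (Prod.ext (Subsingleton.elim _ _) (funext fun a => a.elim0))⟩
    rw [centralizerPolynomial, Finsupp.prod_zero_index, Polynomial.eval_one, primitiveCount,
      Nat.card_unique, Nat.cast_one]
  | succ l ih =>
    obtain ⟨k, hk⟩ : ∃ k, m k ≠ 0 := by
      by_contra h
      push Not at h
      rw [show m = 0 from Finsupp.ext h, SymFun.length_zero] at hl
      omega
    obtain ⟨m', rfl⟩ : ∃ m', m = m' + Finsupp.single k 1 :=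
      ⟨m - Finsupp.single k 1, (tsub_add_cancel_of_le (Finsupp.single_le_iff.2
        (Nat.one_le_iff_ne_zero.2 hk))).symm⟩
    rw [SymFun.length_add, SymFun.length_single] at hl
    obtain ⟨n, σ, hσ, h⟩ := ih m' (by omega)
    let e := Finite.equivFin (Fin n ⊕ ZMod k)
    refine ⟨_, e.permCongr (Equiv.Perm.sumCongr σ (Equiv.addRight (1 : ZMod k))), ?_, fun K _ => ?_⟩
    · rw [Equiv.Perm.cycleTypeExp_permCongr, cycleTypeExp_sumCongr, hσ, cycleTypeExp_addRight_one]
    · rw [primitiveCount_permCongr, primitiveCount_sumCongr σ _ (0 : ZMod k),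
        card_equivariant_zmod, centralizerPolynomial_add_single, Polynomial.eval_mul, h,
        Polynomial.eval_add, Polynomial.eval_C, eval_necklacePolynomial, hσ]
      · push_cast
        ring
      · intro b
        refine ⟨b.val, ?_⟩
        have hpow : ∀ j : ℕ, (Equiv.addRight (1 : ZMod k) ^ j) 0 = j := by
          intro j
          induction j with
          | zero => simp
          | succ j ih => rw [pow_succ', Equiv.Perm.mul_apply, ih]; simp
        rw [hpow, ZMod.natCast_zmod_val]

theorem eval_centralizerPolynomial (K : Type) [Finite K] {n : ℕ} (σ : Equiv.Perm (Fin n)) :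
    (centralizerPolynomial σ.cycleTypeExp).eval (Nat.card K : ℚ) = primitiveCount K σ := by
  obtain ⟨n', τ, hτ, h⟩ := exists_eval_centralizerPolynomial σ.cycleTypeExp
  obtain rfl : n' = n := by
    have h1 := congrArg SymFun.degree hτ
    rwa [Equiv.Perm.degree_cycleTypeExp, Equiv.Perm.degree_cycleTypeExp, Nat.card_fin,
      Nat.card_fin] at h1
  obtain ⟨g, hg⟩ := isConj_iff.1 (Equiv.Perm.isConj_iff_cycleTypeExp.2 hτ)
  rw [h, ← primitiveCount_permCongr g τ, ← hg]
  congr 1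

/-- Only the factor with `j = 0` has no constant term, and its linear coefficient is `μ(d)`; the
others contribute their constant terms `d j`. -/
theorem coeff_one_centralizerPolynomial_single (d : ℕ+) {e : ℕ} (he : e ≠ 0) :
    (centralizerPolynomial (Finsupp.single d e)).coeff 1 =
      ArithmeticFunction.moebius (d : ℕ) * ((d : ℕ) : ℚ) ^ (e - 1) * (e - 1).factorial := by
  obtain ⟨e, rfl⟩ := Nat.exists_eq_succ_of_ne_zero he
  induction e with
  | zero =>
    rw [centralizerPolynomial, Finsupp.prod_single_index (by simp)]
    simp [coeff_one_necklacePolynomial d.ne_zero]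
  | succ e ih =>
    rw [Nat.succ_eq_add_one, Finsupp.single_add, centralizerPolynomial_add_single,
      Polynomial.mul_coeff_one, ih (Nat.succ_ne_zero e)]
    have h0 : (centralizerPolynomial (Finsupp.single d e.succ)).coeff 0 = 0 := by
      rw [centralizerPolynomial, Finsupp.prod_single_index (by simp), Finset.prod_range_succ',
        Polynomial.mul_coeff_zero, Polynomial.coeff_add, coeff_zero_necklacePolynomial]
      simp
    rw [h0, zero_mul, zero_add, Polynomial.coeff_add, coeff_zero_necklacePolynomial, Polynomial.coeff_C_zero,
      Finsupp.single_eq_same, Nat.succ_eq_add_one, Nat.add_sub_cancel, Nat.add_sub_cancel,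
      Nat.factorial_succ]
    push_cast
    ring

theorem X_dvd_prod_necklacePolynomial {d e : ℕ} (he : e ≠ 0) : Polynomial.X ∣
    ∏ j ∈ Finset.range e, (necklacePolynomial d + Polynomial.C ((d : ℚ) * j)) := by
  obtain ⟨e, rfl⟩ := Nat.exists_eq_succ_of_ne_zero he
  rw [Finset.prod_range_succ']
  refine dvd_mul_of_dvd_right ?_ _
  rw [Polynomial.X_dvd_iff, Polynomial.coeff_add, coeff_zero_necklacePolynomial]
  simp

/-- Each occurring cycle length gives a factor divisible by `X`, so two lengths give `X ^ 2`;
without cycles the polynomial is `1`. -/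
theorem coeff_one_centralizerPolynomial_eq_zero {m : ℕ+ →₀ ℕ}
    (h : ∀ d e, e ≠ 0 → m ≠ Finsupp.single d e) : (centralizerPolynomial m).coeff 1 = 0 := by
  classical
  rcases Finset.eq_empty_or_nonempty m.support with h0 | ⟨d, hd⟩
  · rw [Finsupp.support_eq_empty.1 h0, centralizerPolynomial, Finsupp.prod_zero_index,
      Polynomial.coeff_one, if_neg one_ne_zero]
  · have hd' := Finsupp.mem_support_iff.1 hd
    obtain ⟨d', hd1, hne⟩ : ∃ d' ∈ m.support, d' ≠ d := by
      by_contra hcon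
      push Not at hcon
      refine h d (m d) hd' (Finsupp.ext fun k => ?_)
      by_cases hk : k = d
      · rw [hk, Finsupp.single_eq_same]
      · rw [Finsupp.single_eq_of_ne hk]
        by_contra hk'
        exact hk (hcon k (Finsupp.mem_support_iff.2 hk'))
    rw [centralizerPolynomial, Finsupp.prod, ← Finset.mul_prod_erase _ _ hd,
      ← Finset.mul_prod_erase _ _ (Finset.mem_erase.2 ⟨hne, hd1⟩)]
    obtain ⟨A, hA⟩ := X_dvd_prod_necklacePolynomial (d := d) hd'
    obtain ⟨B, hB⟩ := X_dvd_prod_necklacePolynomial (d := d') (Finsupp.mem_support_iff.1 hd1)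
    rw [hA, hB, mul_assoc, mul_assoc, mul_left_comm A, Polynomial.coeff_X_mul,
      Polynomial.coeff_X_mul_zero]

/-- The character of the image of the first Eulerian idempotent. -/
theorem sum_eulerian {n : ℕ} (σ : Equiv.Perm (Fin n)) :
    ∑ w, eulerian n w (w * σ) = (centralizerPolynomial σ.cycleTypeExp).coeff 1 := by
  have h : ∑ w, sortPolynomial w (w * σ) = centralizerPolynomial σ.cycleTypeExp := by
    refine Polynomial.eq_of_eval_natCast fun k => ?_
    have h1 := sum_sortCount_eq (Fin k) σ
    rw [← eval_centralizerPolynomial, Nat.card_fin] at h1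
    rw [← h1, Polynomial.eval_finsetSum]
    refine Finset.sum_congr rfl fun w _ => ?_
    rw [← eval_sortPolynomial, Fintype.card_fin]
  rw [← h, Polynomial.finsetSum_coeff]
  rfl

end Necklaces

/-! ### The free Lie algebra inside the free associative algebra -/

section Words

attribute [local instance] LieRing.ofAssociativeRing

variable {n : ℕ}

/-- The free associative algebra on `n` letters, with the words as a basis. -/
abbrev WordAlgebra (n : ℕ) : Type := MonoidAlgebra ℚ (FreeMonoid (Fin n))

/-- The embedding of the free Lie algebra into the free associative algebra. -/
noncomputable def lieToWords (n : ℕ) : FreeLieAlgebra ℚ (Fin n) →ₗ⁅ℚ⁆ WordAlgebra n :=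
  FreeLieAlgebra.lift ℚ fun i => MonoidAlgebra.single (FreeMonoid.of i) 1

theorem lieToWords_of (i : Fin n) : lieToWords n (FreeLieAlgebra.of ℚ i) =
    MonoidAlgebra.single (FreeMonoid.of i) 1 := FreeLieAlgebra.lift_of_apply _ _

theorem lieToWords_lie (x y : FreeLieAlgebra ℚ (Fin n)) : lieToWords n ⁅x, y⁆ =
    lieToWords n x * lieToWords n y - lieToWords n y * lieToWords n x := by
  rw [LieHom.map_lie, LieRing.of_associative_ring_bracket]

/-- The words in which each letter in `S` occurs exactly once and no other letter occurs. -/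
def multilinearWords (S : Finset (Fin n)) : Set (WordAlgebra n) :=
  (fun l => MonoidAlgebra.single (FreeMonoid.ofList l) 1) '' {l | l.Nodup ∧ l.toFinset = S}

theorem mul_mem_span_multilinearWords {S T : Finset (Fin n)} (hST : Disjoint S T)
    {x y : WordAlgebra n} (hx : x ∈ Submodule.span ℚ (multilinearWords S))
    (hy : y ∈ Submodule.span ℚ (multilinearWords T)) :
    x * y ∈ Submodule.span ℚ (multilinearWords (S ∪ T)) := by
  have h := Submodule.mul_mem_mul hx hy
  rw [Submodule.span_mul_span] at h
  refine Submodule.span_mono ?_ h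
  rintro _ ⟨_, ⟨l, ⟨hl, rfl⟩, rfl⟩, _, ⟨l', ⟨hl', rfl⟩, rfl⟩, rfl⟩
  refine ⟨l ++ l', ⟨List.nodup_append'.2 ⟨hl, hl', List.disjoint_toFinset_iff_disjoint.1 hST⟩,
    List.toFinset_append⟩, ?_⟩
  simp only [MonoidAlgebra.single_mul_single, mul_one, FreeMonoid.ofList_append]

theorem IsLieMonomial.lieToWords_mem {S : Finset (Fin n)} {x : FreeLieAlgebra ℚ (Fin n)}
    (h : IsLieMonomial S x) : lieToWords n x ∈ Submodule.span ℚ (multilinearWords S) := by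
  induction h with
  | of i =>
    rw [lieToWords_of]
    exact Submodule.subset_span ⟨[i], by simp, rfl⟩
  | @lie S T x y hST _ _ hx hy =>
    rw [lieToWords_lie]
    refine Submodule.sub_mem _ (mul_mem_span_multilinearWords hST hx hy) ?_
    rw [Finset.union_comm]
    exact mul_mem_span_multilinearWords hST.symm hy hx

theorem IsLieMonomial.nonempty {S : Finset (Fin n)} {x : FreeLieAlgebra ℚ (Fin n)}
    (h : IsLieMonomial S x) : S.Nonempty := by
  induction h with
  | of i => exact Finset.singleton_nonempty i
  | lie _ _ _ hx _ => exact hx.mono Finset.subset_union_left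

/-- The right-normed bracket of the letters of a word. -/
noncomputable def rightBracket : List (Fin n) → FreeLieAlgebra ℚ (Fin n)
  | [] => 0
  | [a] => FreeLieAlgebra.of ℚ a
  | a :: b :: l => ⁅FreeLieAlgebra.of ℚ a, rightBracket (b :: l)⁆

theorem rightBracket_cons (a : Fin n) {l : List (Fin n)} (hl : l ≠ []) :
    rightBracket (a :: l) = ⁅FreeLieAlgebra.of ℚ a, rightBracket l⁆ := by
  obtain ⟨b, l, rfl⟩ := List.exists_cons_of_ne_nil hl
  rfl

theorem isLieMonomial_rightBracket {l : List (Fin n)} (hl : l ≠ []) (hd : l.Nodup) :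
    IsLieMonomial l.toFinset (rightBracket l) := by
  induction l with
  | nil => exact absurd rfl hl
  | cons a l ih =>
    rw [List.nodup_cons] at hd
    rcases eq_or_ne l [] with rfl | h
    · exact IsLieMonomial.of a
    · rw [rightBracket_cons a h, List.toFinset_cons, Finset.insert_eq]
      refine IsLieMonomial.lie ?_ (IsLieMonomial.of a) (ih h hd.2)
      rw [Finset.disjoint_singleton_left, List.mem_toFinset]
      exact hd.1

/-- In `⁅a, x⁆ = a x - x a` the words of the second product end in `a`, whereas the given word ends
in another letter. -/
theorem coeff_lieToWords_rightBracket {l : List (Fin n)} (hl : l ≠ []) (hd : l.Nodup) :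
    (lieToWords n (rightBracket l)).coeff (FreeMonoid.ofList l) = 1 := by
  induction l with
  | nil => exact absurd rfl hl
  | cons a l ih =>
    rw [List.nodup_cons] at hd
    rcases eq_or_ne l [] with rfl | h
    · rw [rightBracket, lieToWords_of, MonoidAlgebra.coeff_single]
      exact Finsupp.single_eq_same
    · rw [rightBracket_cons a h, lieToWords_lie, MonoidAlgebra.coeff_sub, Finsupp.sub_apply,
        lieToWords_of, MonoidAlgebra.coeff_single_mul_eq_mul_coeff (FreeMonoid.ofList l),
        ih h hd.2, MonoidAlgebra.coeff_mul_single_of_forall_mul_ne, mul_one, sub_zero]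
      · intro d hda
        have h1 : FreeMonoid.toList d ++ [a] = a :: l := congrArg FreeMonoid.toList hda
        refine hd.1 ?_
        have h2 := congrArg List.getLast? h1
        rw [List.getLast?_append, List.getLast?_cons_of_ne_nil h] at h2
        exact List.mem_of_getLast? (by simpa using h2.symm)
      · intro d _
        rw [FreeMonoid.ofList_cons]
        exact mul_right_inj _

/-- The linear map that sends a word to the right-normed bracket of its letters. -/
noncomputable def bracketing (n : ℕ) : WordAlgebra n →ₗ[ℚ] FreeLieAlgebra ℚ (Fin n) :=
  (Finsupp.linearCombination ℚ fun l : FreeMonoid (Fin n) => rightBracket l.toList) ∘ₗ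
    (MonoidAlgebra.coeffLinearEquiv ℚ).toLinearMap

theorem bracketing_single (l : FreeMonoid (Fin n)) (r : ℚ) :
    bracketing n (MonoidAlgebra.single l r) = r • rightBracket l.toList :=
  Finsupp.linearCombination_single ℚ r l

/-- The action of the free associative algebra on the free Lie algebra that extends the adjoint
representation. -/
noncomputable def wordAd (n : ℕ) :
    WordAlgebra n →ₐ[ℚ] Module.End ℚ (FreeLieAlgebra ℚ (Fin n)) :=
  MonoidAlgebra.lift ℚ _ _ (FreeMonoid.lift fun i => LieAlgebra.ad ℚ _ (FreeLieAlgebra.of ℚ i))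

/-- Both sides are Lie homomorphisms in `x` that agree on the generators. -/
theorem wordAd_lieToWords (x y : FreeLieAlgebra ℚ (Fin n)) :
    wordAd n (lieToWords n x) y = ⁅x, y⁆ := by
  have h : ((wordAd n : WordAlgebra n →ₗ⁅ℚ⁆ Module.End ℚ (FreeLieAlgebra ℚ (Fin n))).comp
      (lieToWords n)) = LieAlgebra.ad ℚ (FreeLieAlgebra ℚ (Fin n)) := by
    refine FreeLieAlgebra.hom_ext fun i => ?_
    rw [LieHom.comp_apply, lieToWords_of]
    change wordAd n _ = _
    rw [wordAd, MonoidAlgebra.lift_single, one_smul, FreeMonoid.lift_eval_of]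
  exact LinearMap.congr_fun (LieHom.congr_fun h x) y

/-- A right-normed bracket is extended on the left by adjoint actions of letters. The words of `y`
must be nonempty, because the empty word is bracketed to zero. -/
theorem bracketing_mul (x : WordAlgebra n) {S : Finset (Fin n)} (hS : S.Nonempty)
    {y : WordAlgebra n} (hy : y ∈ Submodule.span ℚ (multilinearWords S)) :
    bracketing n (x * y) = wordAd n x (bracketing n y) := by
  induction hy using Submodule.span_induction with
  | zero => rw [mul_zero, map_zero, map_zero]
  | add y z _ _ hy hz => rw [mul_add, map_add, map_add, map_add, hy, hz]
  | smul r y _ hy => rw [mul_smul_comm, map_smul, map_smul, map_smul, hy]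
  | mem y hy =>
    obtain ⟨l, ⟨hd, rfl⟩, rfl⟩ := hy
    have hl : l ≠ [] := by
      rintro rfl
      exact Finset.not_nonempty_empty hS
    induction x using MonoidAlgebra.induction_linear with
    | zero => rw [zero_mul, map_zero, map_zero, LinearMap.zero_apply]
    | add x z hx hz => rw [add_mul, map_add, map_add, LinearMap.add_apply, hx, hz]
    | single w r =>
      simp only [MonoidAlgebra.single_mul_single, mul_one, bracketing_single, one_smul, wordAd,
        MonoidAlgebra.lift_single, LinearMap.smul_apply]
      congr 1
      induction w using FreeMonoid.inductionOn' with
      | one => simp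
      | of_mul a w ih =>
        rw [MonoidHom.map_mul, FreeMonoid.lift_eval_of, Module.End.mul_apply, ← ih, mul_assoc,
          LieAlgebra.ad_apply]
        refine rightBracket_cons a ?_
        exact List.append_ne_nil_of_right_ne_nil w.toList hl

/-- The Dynkin–Specht–Wever theorem for multilinear elements. -/
theorem IsLieMonomial.bracketing_lieToWords {S : Finset (Fin n)} {x : FreeLieAlgebra ℚ (Fin n)}
    (h : IsLieMonomial S x) : bracketing n (lieToWords n x) = (S.card : ℚ) • x := by
  induction h with
  | of i =>
    rw [lieToWords_of, bracketing_single, Finset.card_singleton, Nat.cast_one]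
    rfl
  | lie hST h1 h2 hx hy =>
    -- By induction the image of `⁅x, y⁆` is `ad x` of `|T| y` minus `ad y` of `|S| x`, and
    -- antisymmetry collects the factor `|S| + |T|`.
    rw [lieToWords_lie, map_sub, bracketing_mul _ h2.nonempty h2.lieToWords_mem,
      bracketing_mul _ h1.nonempty h1.lieToWords_mem, hx, hy, map_smul, map_smul,
      wordAd_lieToWords, wordAd_lieToWords, Finset.card_union_of_disjoint hST, Nat.cast_add,
      add_smul, sub_eq_add_neg, ← smul_neg, lie_skew, add_comm]

end Words

/-! ### Coproduct, concatenation and the sorting matrices -/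

section Words

attribute [local instance] LieRing.ofAssociativeRing

variable {n : ℕ}

theorem List.prod_ofFn_mulSingle {M : Type*} [Monoid M] {k : ℕ} (j : Fin k) (x : M) :
    (List.ofFn (Pi.mulSingle j x : Fin k → M)).prod = x := by
  induction k with
  | zero => exact j.elim0
  | succ k ih =>
    rw [List.ofFn_succ, List.prod_cons]
    induction j using Fin.cases with
    | zero =>
      rw [Pi.mulSingle_eq_same, List.prod_eq_one, mul_one]
      intro y hy
      obtain ⟨i, rfl⟩ := List.mem_ofFn.1 hy
      exact Pi.mulSingle_eq_of_ne (Fin.succ_ne_zero i) x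
    | succ j =>
      rw [Pi.mulSingle_eq_of_ne (Fin.succ_ne_zero j).symm, one_mul]
      refine Eq.trans ?_ (ih j)
      congr 2
      funext i
      simp only [Pi.mulSingle_apply, Fin.succ_inj]

/-- The iterated coproduct of the free associative algebra with primitive letters. -/
noncomputable def coproduct (n k : ℕ) :
    WordAlgebra n →ₐ[ℚ] MonoidAlgebra ℚ (Fin k → FreeMonoid (Fin n)) :=
  MonoidAlgebra.lift ℚ _ _ (FreeMonoid.lift fun i =>
    ∑ j, MonoidAlgebra.single (Pi.mulSingle j (FreeMonoid.of i)) 1)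

/-- The inclusion of the words into a factor of the coproduct. -/
noncomputable def slot {k : ℕ} (j : Fin k) :
    WordAlgebra n →ₐ[ℚ] MonoidAlgebra ℚ (Fin k → FreeMonoid (Fin n)) :=
  MonoidAlgebra.mapDomainAlgHom ℚ ℚ (MonoidHom.mulSingle (fun _ => FreeMonoid (Fin n)) j)

theorem slot_single {k : ℕ} (j : Fin k) (l : FreeMonoid (Fin n)) (r : ℚ) :
    slot j (MonoidAlgebra.single l r) = MonoidAlgebra.single (Pi.mulSingle j l) r :=
  MonoidAlgebra.mapDomain_single

theorem commute_slot {k : ℕ} {i j : Fin k} (h : i ≠ j) (x y : WordAlgebra n) :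
    Commute (slot i x) (slot j y) := by
  induction x using MonoidAlgebra.induction_linear with
  | zero => rw [map_zero]; exact Commute.zero_left _
  | add x z hx hz => rw [map_add]; exact hx.add_left hz
  | single l r =>
    induction y using MonoidAlgebra.induction_linear with
    | zero => rw [map_zero]; exact Commute.zero_right _
    | add x z hx hz => rw [map_add]; exact hx.add_right hz
    | single l' r' =>
      rw [slot_single, slot_single]
      exact MonoidAlgebra.single_commute_single (Pi.mulSingle_commute
        (f := fun _ => FreeMonoid (Fin n)) h l l') (Commute.all _ _)

/-- Lie elements are primitive. -/
theorem IsLieMonomial.coproduct_lieToWords (k : ℕ) {S : Finset (Fin n)}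
    {x : FreeLieAlgebra ℚ (Fin n)} (h : IsLieMonomial S x) :
    coproduct n k (lieToWords n x) = ∑ j, slot j (lieToWords n x) := by
  induction h with
  | of i =>
    simp only [lieToWords_of, slot_single]
    rw [coproduct, MonoidAlgebra.lift_single, one_smul, FreeMonoid.lift_eval_of]
  | @lie S T x y _ _ _ hx hy =>
    simp only [lieToWords_lie, map_sub, map_mul, hx, hy, Finset.sum_mul_sum,
      Finset.sum_sub_distrib]
    rw [Finset.sum_comm (f := fun i j => slot i (lieToWords n y) * slot j (lieToWords n x)),
      ← Finset.sum_sub_distrib, ← Finset.sum_sub_distrib]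
    refine Finset.sum_congr rfl fun i _ => ?_
    -- Different slots commute, so only the diagonal terms of the commutator survive.
    rw [← Finset.sum_sub_distrib, Finset.sum_eq_single i]
    · intro j _ hj
      rw [(commute_slot hj.symm _ _).eq, sub_self]
    · intro hi
      exact absurd (Finset.mem_univ i) hi

/-- The concatenation of the factors of the coproduct. -/
noncomputable def concatenation (n k : ℕ) :
    MonoidAlgebra ℚ (Fin k → FreeMonoid (Fin n)) →ₗ[ℚ] WordAlgebra n :=
  MonoidAlgebra.mapDomainLinearMap ℚ ℚ fun v => (List.ofFn v).prod

theorem concatenation_slot {k : ℕ} (j : Fin k) (x : WordAlgebra n) :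
    concatenation n k (slot j x) = x := by
  induction x using MonoidAlgebra.induction_linear with
  | zero => rw [map_zero, map_zero]
  | add x z hx hz => rw [map_add, map_add, hx, hz]
  | single l r =>
    rw [slot_single, concatenation, MonoidAlgebra.mapDomainLinearMap_single,
      List.prod_ofFn_mulSingle]

/-- Concatenation after the coproduct is the `k`-th Adams operation of the Hopf algebra of words; it
multiplies primitive elements by `k`. -/
theorem IsLieMonomial.concatenation_coproduct (k : ℕ) {S : Finset (Fin n)}
    {x : FreeLieAlgebra ℚ (Fin n)} (h : IsLieMonomial S x) :
    concatenation n k (coproduct n k (lieToWords n x)) = (k : ℚ) • lieToWords n x := by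
  rw [h.coproduct_lieToWords, map_sum]
  simp only [concatenation_slot, Finset.sum_const, Finset.card_univ, Fintype.card_fin,
    Nat.cast_smul_eq_nsmul]

/-- The word in which the letter `a` stands at the position `w a`. -/
def permWord (w : Equiv.Perm (Fin n)) : FreeMonoid (Fin n) := FreeMonoid.ofList (List.ofFn w.symm)

theorem permWord_injective : Injective (permWord (n := n)) := by
  intro v w h
  have h1 : List.ofFn v.symm = List.ofFn w.symm := h
  exact Equiv.symm_bijective.injective (DFunLike.coe_injective (List.ofFn_injective h1))

theorem prod_map_mulSingle {k : ℕ} (c : Fin n → Fin k) (l : List (Fin n)) (j : Fin k) :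
    (l.map fun a => (Pi.mulSingle (c a) (FreeMonoid.of a) : Fin k → FreeMonoid (Fin n))).prod j =
      FreeMonoid.ofList (l.filter fun a => c a = j) := by
  induction l with
  | nil => rfl
  | cons a l ih =>
    rw [List.map_cons, List.prod_cons, Pi.mul_apply, ih]
    by_cases h : c a = j
    · subst h
      rw [Pi.mulSingle_eq_same, List.filter_cons_of_pos (by simp), FreeMonoid.ofList_cons]
    · rw [Pi.mulSingle_eq_of_ne (Ne.symm h), List.filter_cons_of_neg (by simpa using h), one_mul]

theorem pairwise_ofFn_symm (w : Equiv.Perm (Fin n)) :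
    (List.ofFn w.symm).Pairwise fun a b => w a < w b := by
  rw [List.pairwise_ofFn]
  intro i j hij
  rwa [Equiv.apply_symm_apply, Equiv.apply_symm_apply]

/-- Reading the letters colour by colour, each colour in the order `w`, lists them increasingly for
`u`, and a sorted list is determined by its members. -/
theorem flatten_filter_eq {k : ℕ} {c : Fin n → Fin k} {u w : Equiv.Perm (Fin n)}
    (h : Sorts u c w) :
    (List.ofFn fun j => (List.ofFn w.symm).filter fun a => c a = j).flatten =
      List.ofFn u.symm := by
  have h1 : ((List.ofFn fun j => (List.ofFn w.symm).filter fun a => c a = j).flatten).Pairwise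
      fun a b => u a < u b := by
    rw [List.pairwise_flatten]
    constructor
    · intro l hl
      obtain ⟨j, rfl⟩ := List.mem_ofFn.1 hl
      refine List.Pairwise.imp_of_mem ?_ ((pairwise_ofFn_symm w).filter _)
      intro a b ha hb hab
      rw [List.mem_filter, decide_eq_true_iff] at ha hb
      exact (h a b).2 (Or.inr ⟨ha.2.trans hb.2.symm, hab⟩)
    · rw [List.pairwise_ofFn]
      intro i j hij a ha b hb
      rw [List.mem_filter, decide_eq_true_iff] at ha hb
      exact (h a b).2 (Or.inl (by rwa [ha.2, hb.2]))
  have h2 := pairwise_ofFn_symm u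
  have hn : ∀ {l : List (Fin n)}, l.Pairwise (fun a b => u a < u b) → l.Nodup :=
    fun hl => hl.imp fun hab => by
      rintro rfl
      exact lt_irrefl _ hab
  refine List.Perm.eq_of_pairwise (fun a b _ _ hab hba => absurd hba hab.asymm) h1 h2
    ((List.perm_ext_iff_of_nodup (hn h1) (hn h2)).2 fun a => iff_of_true ?_ ?_)
  · rw [List.mem_flatten]
    refine ⟨_, List.mem_ofFn.2 ⟨c a, rfl⟩, ?_⟩
    rw [List.mem_filter, decide_eq_true_iff]
    exact ⟨List.mem_ofFn.2 ⟨w a, w.symm_apply_apply a⟩, rfl⟩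
  · exact List.mem_ofFn.2 ⟨u a, u.symm_apply_apply a⟩

theorem coproduct_permWord (k : ℕ) (w : Equiv.Perm (Fin n)) :
    coproduct n k (MonoidAlgebra.single (permWord w) 1) =
      ∑ c : Fin n → Fin k, MonoidAlgebra.single ((List.ofFn w.symm).map fun a =>
        (Pi.mulSingle (c a) (FreeMonoid.of a) : Fin k → FreeMonoid (Fin n))).prod 1 := by
  rw [coproduct, MonoidAlgebra.lift_single, one_smul, FreeMonoid.lift_apply]
  change (List.map _ (List.ofFn w.symm)).prod = _
  rw [List.map_ofFn, ← MultilinearMap.mkPiAlgebraFin_apply (R := ℚ)]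
  simp only [comp_def]
  rw [MultilinearMap.map_sum]
  refine (Fintype.sum_equiv (w.arrowCongr (Equiv.refl (Fin k))) _ _ fun c => ?_).symm
  rw [MultilinearMap.mkPiAlgebraFin_apply, ← MonoidAlgebra.of_apply, map_list_prod, List.map_map,
    List.map_ofFn]
  rfl

/-- The coproduct puts each letter into one of `k` slots, which is its colour, and concatenation of
the slots is the stable sort. So the sorting matrix is the matrix of the Adams operation on
multilinear words. -/
theorem concatenation_coproduct_permWord (k : ℕ) (u w : Equiv.Perm (Fin n)) :
    (concatenation n k (coproduct n k (MonoidAlgebra.single (permWord w) 1))).coeff (permWord u) =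
      sortCount (Fin k) u w := by
  classical
  have h : ∀ c : Fin n → Fin k, (List.ofFn ((List.ofFn w.symm).map fun a =>
      (Pi.mulSingle (c a) (FreeMonoid.of a) : Fin k → FreeMonoid (Fin n))).prod).prod =
        permWord u ↔ Sorts u c w := by
    intro c
    obtain ⟨v, hv, -⟩ := existsUnique_sorts c w
    have h1 : (List.ofFn ((List.ofFn w.symm).map fun a =>
      (Pi.mulSingle (c a) (FreeMonoid.of a) : Fin k → FreeMonoid (Fin n))).prod).prod =
        permWord v := by
      rw [funext fun j => prod_map_mulSingle c (List.ofFn w.symm) j, permWord,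
        ← flatten_filter_eq hv, FreeMonoid.ofList_flatten, List.map_ofFn]
      rfl
    rw [h1, permWord_injective.eq_iff]
    constructor
    · rintro rfl
      exact hv
    · exact (existsUnique_sorts c w).unique hv
  rw [coproduct_permWord, map_sum, MonoidAlgebra.coeff_sum, Finsupp.finsetSum_apply]
  simp only [concatenation, MonoidAlgebra.mapDomainLinearMap_single,
    MonoidAlgebra.coeff_single, Finsupp.single_apply, h]
  rw [Finset.sum_boole, sortCount, Nat.card_eq_fintype_card, Fintype.card_subtype]

end Words

/-! ### The character of `Lie(n)` -/

section LieCharacter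

attribute [local instance] LieRing.ofAssociativeRing

variable {n : ℕ}

theorem toFinset_ofFn_symm (w : Equiv.Perm (Fin n)) :
    (List.ofFn w.symm).toFinset = Finset.univ :=
  Finset.eq_univ_iff_forall.2 fun a =>
    List.mem_toFinset.2 (List.mem_ofFn.2 ⟨w a, w.symm_apply_apply a⟩)

theorem exists_ofFn_symm_eq {l : List (Fin n)} (hd : l.Nodup) (hl : l.toFinset = Finset.univ) :
    ∃ w : Equiv.Perm (Fin n), List.ofFn w.symm = l := by
  have h : l.length = n := by
    rw [← List.toFinset_card_of_nodup hd, hl, Finset.card_univ, Fintype.card_fin]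
  let g : Fin n → Fin n := fun i => l.get (i.cast h.symm)
  have hg : Injective g := (List.nodup_iff_injective_get.1 hd).comp (Fin.cast_injective h.symm)
  refine ⟨(Equiv.ofBijective g (Finite.injective_iff_bijective.1 hg)).symm, ?_⟩
  rw [Equiv.symm_symm]
  refine List.ext_get (by rw [List.length_ofFn, h]) fun i h1 h2 => ?_
  rw [List.get_ofFn]
  rfl

theorem eq_sum_permWord {y : WordAlgebra n}
    (hy : y ∈ Submodule.span ℚ (multilinearWords Finset.univ)) :
    y = ∑ w, y.coeff (permWord w) • MonoidAlgebra.single (permWord w) 1 := by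
  induction hy using Submodule.span_induction with
  | zero => simp
  | add y z _ _ hy hz =>
    simp only [MonoidAlgebra.coeff_add, Finsupp.add_apply, add_smul, Finset.sum_add_distrib]
    rw [← hy, ← hz]
  | smul r y _ hy =>
    simp only [MonoidAlgebra.coeff_smul, Finsupp.smul_apply, smul_assoc, ← Finset.smul_sum]
    rw [← hy]
  | mem y hy =>
    obtain ⟨l, ⟨hd, hl⟩, rfl⟩ := hy
    obtain ⟨w, rfl⟩ := exists_ofFn_symm_eq hd hl
    rw [Finset.sum_eq_single w]
    · rw [MonoidAlgebra.coeff_single, permWord, Finsupp.single_eq_same, one_smul]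
    · intro v _ hv
      rw [MonoidAlgebra.coeff_single, Finsupp.single_eq_of_ne, zero_smul]
      exact fun h => hv (permWord_injective h)
    · intro h
      exact absurd (Finset.mem_univ w) h

/-- The coefficients of the multilinear words. -/
noncomputable def wordCoeff (n : ℕ) : lieOperad n →ₗ[ℚ] Equiv.Perm (Fin n) → ℚ where
  toFun x w := (lieToWords n x).coeff (permWord w)
  map_add' x y := by
    funext w
    rw [Submodule.coe_add, map_add, MonoidAlgebra.coeff_add, Finsupp.add_apply, Pi.add_apply]
  map_smul' r x := by
    funext w
    rw [Submodule.coe_smul, map_smul, MonoidAlgebra.coeff_smul, Finsupp.smul_apply,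
      Pi.smul_apply, RingHom.id_apply]

theorem wordCoeff_apply (x : lieOperad n) (w : Equiv.Perm (Fin n)) :
    wordCoeff n x w = (lieToWords n x).coeff (permWord w) := rfl

theorem lieOperad_induction {P : FreeLieAlgebra ℚ (Fin n) → Prop} (h0 : P 0)
    (hadd : ∀ x y, P x → P y → P (x + y)) (hsmul : ∀ (r : ℚ) x, P x → P (r • x))
    (h : ∀ x, IsLieMonomial Finset.univ x → P x) (x : lieOperad n) : P x := by
  obtain ⟨x, hx⟩ := x
  exact Submodule.span_induction h h0 (fun x y _ _ => hadd x y) (fun r x _ => hsmul r x) hx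

theorem lieToWords_eq_sum (x : lieOperad n) :
    lieToWords n x = ∑ w, wordCoeff n x w • MonoidAlgebra.single (permWord w) 1 := by
  refine eq_sum_permWord ?_
  refine lieOperad_induction (P := fun x => lieToWords n x ∈ Submodule.span ℚ _) ?_ ?_ ?_ ?_ x
  · rw [map_zero]
    exact Submodule.zero_mem _
  · intro x y hx hy
    rw [map_add]
    exact Submodule.add_mem _ hx hy
  · intro r x hx
    rw [map_smul]
    exact Submodule.smul_mem _ r hx
  · exact fun x hx => hx.lieToWords_mem

theorem rightBracket_mem_lieOperad (w : Equiv.Perm (Fin n)) :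
    rightBracket (List.ofFn w.symm) ∈ lieOperad n := by
  rcases eq_or_ne (List.ofFn w.symm) [] with h | h
  · rw [h]
    exact Submodule.zero_mem _
  · refine Submodule.subset_span ?_
    have := isLieMonomial_rightBracket h (List.nodup_ofFn.2 w.symm.injective)
    rwa [toFinset_ofFn_symm] at this

/-- The normalised right-normed bracketing of the multilinear words. -/
noncomputable def permBracket (n : ℕ) : (Equiv.Perm (Fin n) → ℚ) →ₗ[ℚ] lieOperad n :=
  (1 / n : ℚ) • Fintype.linearCombination ℚ fun w : Equiv.Perm (Fin n) =>
    (⟨rightBracket (List.ofFn w.symm), rightBracket_mem_lieOperad w⟩ : lieOperad n)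

theorem permBracket_apply (v : Equiv.Perm (Fin n) → ℚ) : permBracket n v =
    (1 / n : ℚ) • ∑ w, v w • (⟨rightBracket (List.ofFn w.symm), rightBracket_mem_lieOperad w⟩ :
      lieOperad n) := rfl

/-- This is Dynkin–Specht–Wever, the factor `n` being removed by the normalisation. In particular
multilinear Lie elements are determined by their words. -/
theorem permBracket_wordCoeff (hn : n ≠ 0) (x : lieOperad n) :
    permBracket n (wordCoeff n x) = x := by
  have h : bracketing n (lieToWords n x) = (n : ℚ) • (x : FreeLieAlgebra ℚ (Fin n)) := by
    refine lieOperad_induction (P := fun x => bracketing n (lieToWords n x) = (n : ℚ) • x)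
      ?_ ?_ ?_ ?_ x
    · rw [map_zero, map_zero, smul_zero]
    · intro x y hx hy
      rw [map_add, map_add, hx, hy, smul_add]
    · intro r x hx
      rw [map_smul, map_smul, hx, smul_comm]
    · intro x hx
      rw [hx.bracketing_lieToWords, Finset.card_univ, Fintype.card_fin]
  have hn' : (n : ℚ) ≠ 0 := Nat.cast_ne_zero.2 hn
  rw [lieToWords_eq_sum, map_sum] at h
  refine Subtype.ext ?_
  rw [permBracket_apply, Submodule.coe_smul, Submodule.coe_sum, one_div, inv_smul_eq_iff₀ hn', ← h]
  refine Finset.sum_congr rfl fun w _ => ?_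
  rw [map_smul, bracketing_single, one_smul]
  rfl

/-- A right-normed bracket contains its own word with coefficient one, so all `n!` diagonal entries
are `1 / n`. As the composite projects onto a copy of `Lie(n)`, this is its dimension, found without
a basis. -/
theorem trace_wordCoeff_comp_permBracket (hn : n ≠ 0) :
    LinearMap.trace ℚ _ (wordCoeff n ∘ₗ permBracket n) = (n - 1).factorial := by
  have hn' : (n : ℚ) ≠ 0 := Nat.cast_ne_zero.2 hn
  have h : ∀ w : Equiv.Perm (Fin n), wordCoeff n (permBracket n (Pi.single w 1)) w = 1 / n := by
    intro w
    rw [permBracket, LinearMap.smul_apply, Fintype.linearCombination_apply_single, map_smul,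
      Pi.smul_apply, one_smul, wordCoeff_apply, permWord, coeff_lieToWords_rightBracket _
      (List.nodup_ofFn.2 w.symm.injective), smul_eq_mul, mul_one]
    intro h
    exact hn (List.ofFn_eq_nil_iff.1 h)
  rw [← Matrix.toLin'_toMatrix' (wordCoeff n ∘ₗ permBracket n), Matrix.trace_toLin'_eq,
    Matrix.trace]
  simp only [Matrix.diag_apply, LinearMap.toMatrix'_apply, LinearMap.comp_apply]
  rw [Finset.sum_congr rfl fun w _ => h w, Finset.sum_const, Finset.card_univ, Fintype.card_perm,
    Fintype.card_fin, ← Nat.mul_factorial_pred hn, nsmul_eq_mul, Nat.cast_mul]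
  field_simp

theorem sum_sortCount_mul_wordCoeff (k : ℕ) (u : Equiv.Perm (Fin n)) (x : lieOperad n) :
    ∑ w, sortCount (Fin k) u w * wordCoeff n x w = k * wordCoeff n x u := by
  have h : concatenation n k (coproduct n k (lieToWords n x)) = (k : ℚ) • lieToWords n x := by
    refine lieOperad_induction (P := fun x => concatenation n k (coproduct n k (lieToWords n x)) =
      (k : ℚ) • lieToWords n x) ?_ ?_ ?_ ?_ x
    · rw [map_zero, map_zero, map_zero, smul_zero]
    · intro x y hx hy
      rw [map_add, map_add, map_add, hx, hy, smul_add]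
    · intro r x hx
      rw [map_smul, map_smul, map_smul, hx, smul_comm]
    · exact fun x hx => hx.concatenation_coproduct k
  have h1 := congrArg (fun y => y.coeff (permWord u)) h
  simp only [MonoidAlgebra.coeff_smul, Finsupp.smul_apply, smul_eq_mul, ← wordCoeff_apply] at h1
  rw [← h1, lieToWords_eq_sum, map_sum, map_sum, MonoidAlgebra.coeff_sum, Finsupp.finsetSum_apply]
  refine Finset.sum_congr rfl fun w _ => ?_
  rw [map_smul, map_smul, MonoidAlgebra.coeff_smul, Finsupp.smul_apply,
    concatenation_coproduct_permWord, smul_eq_mul, mul_comm]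

theorem eulerian_mulVec_wordCoeff (x : lieOperad n) :
    (eulerian n).mulVec (wordCoeff n x) = wordCoeff n x :=
  eulerian_mulVec fun k u => sum_sortCount_mul_wordCoeff k u x

theorem trace_eulerian (hn : n ≠ 0) : (eulerian n).trace = (n - 1).factorial := by
  have h := sum_eulerian (1 : Equiv.Perm (Fin n))
  have h1 : (1 : Equiv.Perm (Fin n)).cycleTypeExp = Finsupp.single 1 n := by
    refine (Equiv.Perm.eq_cycleTypeExp fun k => ?_).symm
    have h2 : ∀ a, minimalPeriod (1 : Equiv.Perm (Fin n)) a = 1 := fun a =>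
      minimalPeriod_eq_one_iff_isFixedPt.2 rfl
    simp only [h2]
    rcases eq_or_ne k 1 with rfl | hk
    · simp
    · have h3 : (1 : ℕ) ≠ k := fun h => hk (PNat.coe_injective h.symm)
      simp [h3, hk]
  simp only [mul_one] at h
  rw [h1, coeff_one_centralizerPolynomial_single 1 hn] at h
  rw [Matrix.trace]
  simpa using h

/-- Since `w` records positions, relabelling the letters is a right multiplication. -/
theorem permWord_mul (σ w : Equiv.Perm (Fin n)) :
    permWord w = FreeMonoid.map σ (permWord (w * σ)) := by
  have h : List.ofFn w.symm = (List.ofFn (w * σ).symm).map σ := by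
    rw [List.map_ofFn]
    congr 1
    funext i
    exact (σ.apply_symm_apply _).symm
  exact congrArg FreeMonoid.ofList h

theorem lieToWords_lieAction (σ : Equiv.Perm (Fin n)) (x : FreeLieAlgebra ℚ (Fin n)) :
    lieToWords n (lieAction σ x) =
      MonoidAlgebra.mapDomainAlgHom ℚ ℚ (FreeMonoid.map σ) (lieToWords n x) := by
  have h : (lieToWords n).comp (lieAction σ) = ((MonoidAlgebra.mapDomainAlgHom ℚ ℚ
      (FreeMonoid.map σ) : WordAlgebra n →ₐ[ℚ] WordAlgebra n) :
        WordAlgebra n →ₗ⁅ℚ⁆ WordAlgebra n).comp (lieToWords n) := by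
    refine FreeLieAlgebra.hom_ext fun i => ?_
    rw [LieHom.comp_apply, LieHom.comp_apply, lieAction, FreeLieAlgebra.lift_of_apply,
      lieToWords_of, lieToWords_of]
    exact (MonoidAlgebra.mapDomain_single (R := ℚ) (f := FreeMonoid.map σ)
      (a := FreeMonoid.of i)).symm
  exact LieHom.congr_fun h x

/-- The action of the symmetric group on the multilinear part of the free Lie algebra. -/
noncomputable def lieRep (σ : Equiv.Perm (Fin n)) : lieOperad n →ₗ[ℚ] lieOperad n :=
  (lieAction σ : FreeLieAlgebra ℚ (Fin n) →ₗ[ℚ] FreeLieAlgebra ℚ (Fin n)).restrict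
    (lieAction_mem σ)

theorem wordCoeff_lieRep (σ : Equiv.Perm (Fin n)) (x : lieOperad n) :
    wordCoeff n (lieRep σ x) = wordCoeff n x ∘ (· * σ) := by
  funext w
  rw [wordCoeff_apply, comp_apply, wordCoeff_apply]
  change (lieToWords n (lieAction σ x)).coeff _ = _
  rw [lieToWords_lieAction, permWord_mul σ w]
  exact Finsupp.mapDomain_apply (List.map_injective_iff.2 σ.injective) _ _

/-- The idempotent `E` fixes the copy of `Lie(n)` and has its dimension as trace, so it projects
onto it; the character is the trace of relabelling after `E`. -/
theorem lieCharacter_eq_sum_eulerian (hn : n ≠ 0) (σ : Equiv.Perm (Fin n)) :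
    lieCharacter n σ = ∑ w, eulerian n (w * σ) w := by
  let f := wordCoeff n
  let h := permBracket n
  let E := Matrix.toLin' (eulerian n)
  have hhf : h ∘ₗ f = LinearMap.id := LinearMap.ext (permBracket_wordCoeff hn)
  have hEf : E ∘ₗ f = f := LinearMap.ext fun x => by
    rw [LinearMap.comp_apply, Matrix.toLin'_apply, eulerian_mulVec_wordCoeff]
  have hEE : E ∘ₗ E = E := by rw [← Matrix.toLin'_mul, eulerian_mul_self]
  have hfin : Module.Finite ℚ (lieOperad n) := Module.Finite.of_injective f
    (LeftInverse.injective (g := h) (permBracket_wordCoeff hn))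
  have hFE : f ∘ₗ h ∘ₗ E = E := by
    -- An idempotent whose trace is `(n - 1)! - (n - 1)! = 0` vanishes in characteristic zero; so
    -- `E` maps into the copy of `Lie(n)`.
    have hP : IsIdempotentElem (E - f ∘ₗ h ∘ₗ E) := by
      change (E - f ∘ₗ h ∘ₗ E) ∘ₗ (E - f ∘ₗ h ∘ₗ E) = _
      have h1 : E ∘ₗ (E - f ∘ₗ h ∘ₗ E) = E - f ∘ₗ h ∘ₗ E := by
        rw [LinearMap.comp_sub, hEE, ← LinearMap.comp_assoc, hEf]
      have h2 : h ∘ₗ f ∘ₗ h ∘ₗ E = h ∘ₗ E := by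
        rw [← LinearMap.comp_assoc, hhf, LinearMap.id_comp]
      rw [LinearMap.sub_comp, LinearMap.comp_assoc, LinearMap.comp_assoc, h1, LinearMap.comp_sub,
        h2, sub_self, LinearMap.comp_zero, sub_zero]
    have h2 : LinearMap.trace ℚ _ (E - f ∘ₗ h ∘ₗ E) = 0 := by
      rw [map_sub, ← LinearMap.comp_assoc, LinearMap.trace_comp_comm', ← LinearMap.comp_assoc, hEf,
        trace_wordCoeff_comp_permBracket hn, Matrix.trace_toLin'_eq, trace_eulerian hn, sub_self]
    exact (sub_eq_zero.1 (LinearMap.IsIdempotentElem.eq_zero_of_trace_eq_zero hP h2)).symm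
  have h3 : lieRep σ = (lieRep σ ∘ₗ h ∘ₗ E) ∘ₗ f := by
    rw [LinearMap.comp_assoc, LinearMap.comp_assoc, hEf, hhf, LinearMap.comp_id]
  have h4 : f ∘ₗ lieRep σ ∘ₗ h ∘ₗ E = LinearMap.funLeft ℚ ℚ (· * σ) ∘ₗ E := by
    conv_rhs => rw [← hFE]
    exact LinearMap.ext fun v => wordCoeff_lieRep σ (h (E v))
  rw [lieCharacter]
  change LinearMap.trace ℚ _ (lieRep σ) = _
  rw [h3, LinearMap.trace_comp_comm', h4]
  have h5 : LinearMap.funLeft ℚ ℚ (· * σ) ∘ₗ E =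
      Matrix.toLin' (Matrix.of fun u w => eulerian n (u * σ) w) := rfl
  rw [h5, Matrix.trace_toLin'_eq]
  rfl

theorem lieCharacter_eq (σ : Equiv.Perm (Fin n)) :
    lieCharacter n σ = (centralizerPolynomial σ.cycleTypeExp).coeff 1 := by
  rcases eq_or_ne n 0 with rfl | hn
  · have h : lieOperad 0 = ⊥ := by
      rw [lieOperad, Submodule.span_eq_bot]
      exact fun x hx => absurd hx.nonempty (by simp)
    have h1 : Subsingleton (lieOperad 0) := by
      rw [h]
      infer_instance
    rw [coeff_one_centralizerPolynomial_eq_zero]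
    · rw [lieCharacter, Subsingleton.elim (LinearMap.restrict _ _) 0, map_zero]
    · intro d e he h2
      have h3 := Equiv.Perm.degree_cycleTypeExp σ
      rw [h2, Nat.card_eq_fintype_card, Fintype.card_fin, SymFun.degree, Finsupp.sum_single_index
        (by rw [mul_zero])] at h3
      exact mul_ne_zero d.ne_zero he h3
  -- After reindexing, the trace is the sum for the inverse permutation, which has the same cycle
  -- lengths.
  · have h : σ⁻¹.cycleTypeExp = σ.cycleTypeExp :=
      Equiv.Perm.isConj_iff_cycleTypeExp.1
        (Equiv.Perm.isConj_iff_cycleType_eq.2 (Equiv.Perm.cycleType_inv σ))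
    rw [lieCharacter_eq_sum_eulerian hn, ← h, ← sum_eulerian]
    refine Fintype.sum_equiv (Equiv.mulRight σ) _ _ fun w => ?_
    rw [Equiv.coe_mulRight, mul_inv_cancel_right]

end LieCharacter

/-! ### The coefficients of `Lie` and the conclusion -/

namespace SymFun

theorem ghost_Lie (m : ℕ+ →₀ ℕ) : ghost Lie m = (centralizerPolynomial m).coeff 1 := by
  obtain ⟨_, σ, rfl⟩ := Equiv.Perm.exists_cycleTypeExp_eq m
  rw [Lie, ghost_frobeniusSeries, lieCharacter_eq]
  intro σ τ
  rw [lieCharacter_eq, lieCharacter_eq,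
    Equiv.Perm.isConj_iff_cycleTypeExp.1 (isConj_iff.2 ⟨τ, rfl⟩ : IsConj σ (τ * σ * τ⁻¹))]

/-- The value `μ(d) d^(n-1) (n-1)!` of the character is divided by `z = d^n n!`. -/
theorem coeff_Lie_single (d : ℕ+) (n : ℕ) (hn : n ≠ 0) :
    MvPowerSeries.coeff (Finsupp.single d n) Lie =
      (ArithmeticFunction.moebius (d : ℕ) : ℚ) / ((d : ℕ) * n) := by
  have h : zee (Finsupp.single d n) = (d : ℚ) ^ n * (n.factorial : ℚ) :=
    Finsupp.prod_single_index (by simp)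
  have hd : ((d : ℕ) : ℚ) ≠ 0 := Nat.cast_ne_zero.2 d.ne_zero
  have hf : ((n - 1).factorial : ℚ) ≠ 0 := Nat.cast_ne_zero.2 (n - 1).factorial_ne_zero
  have hn' : (n : ℚ) ≠ 0 := Nat.cast_ne_zero.2 hn
  rw [coeff_eq_ghost_div, ghost_Lie, coeff_one_centralizerPolynomial_single d hn, h,
    ← Nat.mul_factorial_pred hn, Nat.cast_mul, ← mul_pow_sub_one hn ((d : ℕ) : ℚ)]
  field_simp

theorem coeff_Lie_eq_zero (m : ℕ+ →₀ ℕ) (h : ∀ d n, n ≠ 0 → m ≠ Finsupp.single d n) :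
    MvPowerSeries.coeff m Lie = 0 := by
  rw [coeff_eq_ghost_div, ghost_Lie, coeff_one_centralizerPolynomial_eq_zero h, zero_div]

end SymFun

theorem mainTheorem6 :
    (∃! H : SymFun (Polynomial ℚ), SymFun.IsHALpa H) ∧
    (∃! M : SymFun ℚ, SymFun.IsAnticyclicPreLie M) ∧
    ∀ (H : SymFun (Polynomial ℚ)) (M : SymFun ℚ),
      SymFun.IsHALpa H → SymFun.IsAnticyclicPreLie M →
        SymFun.atOne (SymFun.HAL H) = -SymFun.suspension 1 M ∧
        SymFun.atOne H = SymFun.p 1 - SymFun.suspension 1 SymFun.PreLie ∧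
        SymFun.atOne (SymFun.HALp H) = SymFun.p 1 * SymFun.suspension 1 SymFun.PreLie ∧
        MvPowerSeries.pderiv ℚ 1 (SymFun.atOne (SymFun.HAL H)) =
          SymFun.suspension 1 SymFun.PreLie :=
  SymFun.main_of_series PreLie_eq fun _ hg =>
    SymFun.plethQ_suspension_plethQ_Comm SymFun.coeff_Lie_single SymFun.coeff_Lie_eq_zero hg
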